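/- For $n\ge 1$ consider the following discrete-time $n\times n$ input-queued switch. Its state is the vector $q(t)=(q_{ij}(t))_{1\le i,j\le n}$ of queue lengths (nonnegative integers). A feasible schedule is a matrix $s\in\{0,1\}^{n\times n}$ all of whose row sums and column sums are at most $1$. A scheduling policy picks in each time slot, possibly at random, a feasible schedule $s(t)$ on the basis of $q(t)$; then arrivals $a(t)$ occur and $q_{ij}(t+1)=\max(0,\,q_{ij}(t)+a_{ij}(t)-s_{ij}(t))$. The arrivals $a_{ij}(t)$ are Bernoulli, independent over all $i,j,t$, and independent of the past queue lengths and of the schedules, so that $q(t)$ is a Markov chain. The switch is stable if $\limsup_{C\to\infty}\limsup_{t\to\infty}\mathbb P(\sum_{i,j}q_{ij}(t)\ge C)=0$. A MaxWeight policy always picks a feasible schedule $s$ that maximizes $\sum_{i,j}q_{ij}(t)s_{ij}$; ties are broken by an arbitrary rule, possibly random and depending on $q(t)$ (for instance uniformly at random). Let $\beta>0$, $n_0\ge 1$, and let $\gamma_n>0$ $(n\ge n_0)$ be a sequence with $\gamma_n=\Theta(1)$ as $n\to\infty$ and $\gamma_n n^{-\beta}\le 1$ for all $n\ge n_0$. For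 $n\ge n_0$ let the $n$-th system be an $n\times n$ switch in which every $a_{ij}(t)$ has mean $(1-\gamma_n n^{-\beta})/n$, so that the load is $1-\gamma_n n^{-\beta}$. (a) Universal lower bound. Let $n\ge n_0$. If the $n$-th system, under some scheduling policy and started from some initial distribution, is stable and its queue length vector converges in distribution to a random vector $\bar q^{(n)}$, then $$\mathbb E\Big[\sum_{i,j}\bar q^{(n)}_{ij}\Big]\ \ge\ \frac{(1-\gamma_n n^{-\beta})^2}{2\gamma_n}\,n^{\beta}(n-1).$$ Hence this mean is $\Omega(n^{1+\beta})$, with a constant that does not depend on the policy: there is $c>0$ such that for all large $n$ it is at least $c\,n^{1+\beta}$, for every such policy and initial distribution. (b) MaxWeight. For each $n\ge n_0$ let the $n$-th system operate under a MaxWeight policy. Then its queue length chain is positive recurrent (the set of states that can be reached from the empty switch is irreducible, and all its states have finite mean return time), and from every initial distribution it converges in distribution to one and the same random vector $\bar q^{(n)}$. If $\beta>4$, then there are sequences $B_3(n)$ and $B_4(n)$, both $o(n^{1+\beta})$, such that for every $n\ge n_0$ with $2\gamma_n\le n^{\beta-1}$ the mean $\mathbb E[\sum_{i,j}\bar q^{(n)}_{ij}]$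 is finite and $$\frac{n^{1+\beta}}{\gamma_n}-B_3(n)\ \le\ \mathbb E\Big[\sum_{i,j}\bar q^{(n)}_{ij}\Big]\ \le\ \frac{n^{1+\beta}}{\gamma_n}+B_4(n).$$ Thus, for $\beta>4$, the mean total queue length under MaxWeight is $\Theta(n^{1+\beta})$. This scaling is optimal: there is $C>0$ such that for all large $n$ it is at most $C$ times the steady-state mean total queue length of every policy as in (a). -/

import Mathlib

open Filter Topology MeasureTheory ProbabilityTheory Asymptotics
open scoped ENNReal BigOperators

namespace InputQueuedSwitch

noncomputable section

/-- Queue length vectors of an `n × n` switch: `q i j` is the number of packets waiting at input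
port `i` for output port `j`. The (product) topology and σ-algebra are the discrete ones. -/
abbrev QueueState (n : ℕ) : Type := Fin n → Fin n → ℕ

/-- The total queue length `∑ i, ∑ j, q i j`. -/
def totalQueue {n : ℕ} (q : QueueState n) : ℕ := ∑ i, ∑ j, q i j

/-- The feasible schedules: `0`-`1` matrices in which every row sum and every column sum is at most
one, that is, the matchings between input ports and output ports. -/
def feasibleSchedules (n : ℕ) : Set (Fin n → Fin n → ℕ) :=
  {s | (∀ i j, s i j = 0 ∨ s i j = 1) ∧ (∀ j, ∑ i, s i j ≤ 1) ∧ (∀ i, ∑ j, s i j ≤ 1)}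

/-- A scheduling policy picks, possibly at random, a feasible schedule on the basis of the current
queue length vector. -/
def Policy (n : ℕ) : Type := QueueState n → PMF (feasibleSchedules n)

/-- The weight `⟨q, s⟩ = ∑ i, ∑ j, q i j * s i j` of the schedule `s`. -/
def weight {n : ℕ} (q : QueueState n) (s : Fin n → Fin n → ℕ) : ℕ := ∑ i, ∑ j, q i j * s i j

/-- A MaxWeight policy only picks feasible schedules that have the largest weight among all feasible
schedules. The rule that breaks ties is left arbitrary, so that this covers uniformly random
tie-breaking (among all the maximizers, or among those that are perfect matchings). -/
def IsMaxWeight {n : ℕ} (A : Policy n) : Prop :=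
  ∀ q : QueueState n, ∀ s ∈ (A q).support, ∀ s' ∈ feasibleSchedules n,
    weight q s' ≤ weight q s

/-- The joint law of the arrivals in one time slot: the `n²` arrival counts are independent
Bernoulli variables, equal to `1` with probability `p` and to `0` with probability `1 - p`. -/
def arrivalLaw (n : ℕ) (p : unitInterval) : PMF (Fin n → Fin n → ℕ) :=
  (Measure.pi fun _ : Fin n => Measure.pi fun _ : Fin n => bernoulliMeasure (1 : ℕ) 0 p).toPMF

/-- The queue lengths `[q + a - s]⁺` after one slot (subtraction on `ℕ` is truncated at `0`). -/
def nextQueue {n : ℕ} (q a s : Fin n → Fin n → ℕ) : QueueState n :=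
  fun i j => q i j + a i j - s i j

/-- The transition law of the queue length Markov chain: a schedule is picked on the basis of the
current queue lengths, arrivals independent of it occur, and packets are served. -/
def transition {n : ℕ} (p : unitInterval) (A : Policy n) (q : QueueState n) :
    PMF (QueueState n) :=
  (A q).bind fun s => (arrivalLaw n p).bind fun a => PMF.pure (nextQueue q a s)

/-- The law at time `t` of the Markov chain with transition law `K` and initial law `μ₀`. -/
def lawAt {α : Type*} (K : α → PMF α) (μ₀ : PMF α) : ℕ → PMF α
  | 0 => μ₀
  | t + 1 => (lawAt K μ₀ t).bind K

/-- Stability: `limsup_{C → ∞} limsup_{t → ∞} P(∑ i j, q i j (t) ≥ C) = 0`. -/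
def IsStable {n : ℕ} (p : unitInterval) (A : Policy n) (μ₀ : PMF (QueueState n)) : Prop :=
  limsup (fun C : ℕ => limsup (fun t : ℕ =>
    (lawAt (transition p A) μ₀ t).toMeasure {q | C ≤ totalQueue q}) atTop) atTop = 0

/-- A discrete law on the queue length vectors, as a probability measure; the probability measures
carry the topology of weak convergence. -/
def toProbabilityMeasure {n : ℕ} (μ : PMF (QueueState n)) : ProbabilityMeasure (QueueState n) :=
  ⟨μ.toMeasure, inferInstance⟩

/-- Started from the law `μ₀`, the queue lengths converge in distribution to `π`. -/
def ConvergesInLaw {n : ℕ} (p : unitInterval) (A : Policy n) (μ₀ π : PMF (QueueState n)) : Prop :=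
  Tendsto (fun t : ℕ => toProbabilityMeasure (lawAt (transition p A) μ₀ t)) atTop
    (𝓝 (toProbabilityMeasure π))

/-- The mean total queue length under the law `π`, an element of `[0, ∞]`. -/
def meanTotalQueue {n : ℕ} (π : PMF (QueueState n)) : ℝ≥0∞ :=
  ∑' q, π q * (totalQueue q : ℝ≥0∞)

/-- `avoidProb K x t y` is the probability that the chain started at `y` does not visit `x` at any
of the times `1, …, t`. -/
def avoidProb {α : Type*} (K : α → PMF α) (x : α) : ℕ → α → ℝ≥0∞
  | 0, _ => 1
  | t + 1, y => ∑' z, K y z * ({x}ᶜ : Set α).indicator (avoidProb K x t) z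

/-- The mean return time `E_x[T_x] = ∑_{t ≥ 0} P_x(T_x > t)`, where `T_x ≥ 1` is the time of the
first return to `x`. -/
def meanReturnTime {α : Type*} (K : α → PMF α) (x : α) : ℝ≥0∞ := ∑' t : ℕ, avoidProb K x t x

/-- `y` can be reached from `x` with positive probability in finitely many steps. -/
def Reachable {α : Type*} (K : α → PMF α) (x y : α) : Prop :=
  Relation.ReflTransGen (fun u v => v ∈ (K u).support) x y

/-- Positive recurrence of the queue length chain on its state space, the set of the states that can
be reached from the empty switch: on this set the chain is irreducible (every state leads back to
the empty switch), and every mean return time is finite. -/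
def IsPositiveRecurrent {n : ℕ} (p : unitInterval) (A : Policy n) : Prop :=
  ∀ q : QueueState n, Reachable (transition p A) 0 q →
    Reachable (transition p A) q 0 ∧ meanReturnTime (transition p A) q < ∞

end

end InputQueuedSwitch

/-! Write `ε = γ n * n ^ (-β) = 1 - n p`, and let `T` be the stationary mean total queue length.
Under a stationary law with `T` finite, the increment of the square of a linear functional of the
queues has mean zero. A row or a column with content `L` has at most one departure `D` per slot, so
there the balance reads `2 ε E[L] = 2 E[L (1 - D)] + (n p)² (1 - 1/n) + r` with `0 ≤ r ≤ 2 n ε`.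
Dropping the nonnegative terms and summing over rows gives the universal lower bound
(`IsStationary.le_meanTotalQueue`). It applies to any limit in law, since such a limit is stationary
(`ConvergesInLaw.isStationary`), and it is trivial when `T` is infinite.

For MaxWeight the squared norm is a Lyapunov function, because the chosen weight is at least the
total queue length divided by `n`. Foster's criterion (`tsum_avoidProb_ne_top`) gives positive
recurrence, the occupation measure of an excursion gives a stationary law, and two independent
copies that meet at the empty switch give convergence from every initial law.

For the asymptotics the terms `E[L (1 - D)]` have to be controlled. The first ingredient is state
space collapse. Let `y` be the distance from `q` to the cone of matrices `v i + w j`. MaxWeight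
gains at least `y / n` over the average weight, so `y ^ 4` has drift at most `- y ^ 3 / n + O(n ^
5)` as long as `n ε ≤ 1/2`, whence `E[y ^ 3] = O(n ^ 6)` (`tsum_sqrt_sqDist_cube_le`). The second
ingredient is to add the row and column balances and subtract `1/n` times the balance of the total.
The correlations of queue lengths and idleness then combine into `idleCorrelation`, which vanishes
on the cone because the idle ports can be matched fractionally through empty queues
(`exists_idle_matching`). By Cauchy-Schwarz it is at most `4 n y √U`, where `U` is the number of
idle ports and `E[U] = n ε`.

Since `U` is an integer, Hölder's inequality bounds the mean of `n y √U` by a multiple of `n * n ^ 2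
* (n ε) ^ (2/3)`, which is `o(n)` exactly when `β > 4`. The remaining terms give `ε T = n + o(n)`
(`abs_meanTotalQueue_sub_le`). -/

namespace InputQueuedSwitch

noncomputable section

/-! ### Markov chains on a discrete space -/

section Markov

variable {α : Type*}

/-- The expectation of `f` after one step of the chain started at `x`. -/
def stepMean (K : α → PMF α) (f : α → ℝ≥0∞) (x : α) : ℝ≥0∞ := ∑' z, K x z * f z

/-- Stationarity of a law, tested against all nonnegative functions. -/
def IsStationary (K : α → PMF α) (π : PMF α) : Prop :=
  ∀ f : α → ℝ≥0∞, ∑' x, π x * stepMean K f x = ∑' x, π x * f x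

lemma stepMean_mono (K : α → PMF α) {f g : α → ℝ≥0∞} (h : ∀ x, f x ≤ g x) (x : α) :
    stepMean K f x ≤ stepMean K g x :=
  ENNReal.tsum_le_tsum fun z => mul_le_mul_right (h z) _

lemma stepMean_add (K : α → PMF α) (f g : α → ℝ≥0∞) (x : α) :
    stepMean K (fun z => f z + g z) x = stepMean K f x + stepMean K g x := by
  simp [stepMean, mul_add, ENNReal.tsum_add]

lemma stepMean_const (K : α → PMF α) (c : ℝ≥0∞) (x : α) : stepMean K (fun _ => c) x = c := by
  simp [stepMean, ENNReal.tsum_mul_right, PMF.tsum_coe]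

lemma stepMean_const_mul (K : α → PMF α) (c : ℝ≥0∞) (f : α → ℝ≥0∞) (x : α) :
    stepMean K (fun z => c * f z) x = c * stepMean K f x := by
  simp only [stepMean, ← ENNReal.tsum_mul_left]
  exact tsum_congr fun z => by ring

lemma stepMean_finset_sum {ι : Type*} (K : α → PMF α) (s : Finset ι) (f : ι → α → ℝ≥0∞) (x : α) :
    stepMean K (fun z => ∑ i ∈ s, f i z) x = ∑ i ∈ s, stepMean K (f i) x := by
  classical
  induction s using Finset.induction_on with
  | empty => simp [stepMean]
  | insert a s ha ih => simp_rw [Finset.sum_insert ha, stepMean_add, ih]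

lemma stepMean_le_const (K : α → PMF α) {f : α → ℝ≥0∞} {c : ℝ≥0∞} (h : ∀ x, f x ≤ c) (x : α) :
    stepMean K f x ≤ c :=
  (stepMean_mono K h x).trans (stepMean_const K c x).le

lemma tsum_bind_mul (p : PMF α) (K : α → PMF α) (f : α → ℝ≥0∞) :
    ∑' y, p.bind K y * f y = ∑' x, p x * stepMean K f x := by
  simp only [PMF.bind_apply, ← ENNReal.tsum_mul_right, stepMean, ← ENNReal.tsum_mul_left]
  rw [ENNReal.tsum_comm]
  exact tsum_congr fun x => tsum_congr fun y => by ring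

/-- Duality: evolving the law forward is the same as evolving the test function backward. This lets
the coupling below work with functions only. -/
lemma tsum_lawAt_mul (K : α → PMF α) (μ₀ : PMF α) (t : ℕ) (f : α → ℝ≥0∞) :
    ∑' y, lawAt K μ₀ t y * f y = ∑' x, μ₀ x * (stepMean K)^[t] f x := by
  induction t generalizing f with
  | zero => rfl
  | succ t ih => rw [lawAt, tsum_bind_mul, ih, Function.iterate_succ_apply]

/-- The probability of not visiting `o` at any of the times `0, …, t`. -/
def avoidFrom (K : α → PMF α) (o : α) (t : ℕ) : α → ℝ≥0∞ :=
  ({o}ᶜ : Set α).indicator (avoidProb K o t)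

lemma avoidProb_succ (K : α → PMF α) (o : α) (t : ℕ) (x : α) :
    avoidProb K o (t + 1) x = stepMean K (avoidFrom K o t) x := rfl

lemma avoidFrom_self (K : α → PMF α) (o : α) (t : ℕ) : avoidFrom K o t o = 0 := by
  simp [avoidFrom]

lemma avoidFrom_of_ne (K : α → PMF α) {o x : α} (h : x ≠ o) (t : ℕ) :
    avoidFrom K o t x = avoidProb K o t x := by
  simp [avoidFrom, h]

lemma avoidFrom_le (K : α → PMF α) (o : α) (t : ℕ) (x : α) :
    avoidFrom K o t x ≤ avoidProb K o t x :=
  Set.indicator_le_self _ _ _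

lemma avoidProb_le_one (K : α → PMF α) (o : α) (t : ℕ) (x : α) : avoidProb K o t x ≤ 1 := by
  induction t generalizing x with
  | zero => exact le_rfl
  | succ t ih =>
    rw [avoidProb_succ]
    exact stepMean_le_const K (fun z => (avoidFrom_le K o t z).trans (ih z)) x

lemma stepMean_lt_one (K : α → PMF α) {g : α → ℝ≥0∞} (hg : ∀ x, g x ≤ 1) {x z : α}
    (hz : z ∈ (K x).support) (h : g z < 1) : stepMean K g x < 1 := by
  have h1 : ∑' w, K x w = 1 := (K x).tsum_coe
  rw [stepMean, ← h1]
  refine ENNReal.tsum_lt_tsum (i := z) ?_ (fun w => ?_) ?_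
  · exact ((ENNReal.tsum_le_tsum fun w => mul_le_of_le_one_right' (hg w)).trans_lt
      (by rw [h1]; exact ENNReal.one_lt_top)).ne
  · exact mul_le_of_le_one_right' (hg w)
  · calc K x z * g z < K x z * 1 :=
        ENNReal.mul_lt_mul_right ((K x).mem_support_iff z |>.1 hz) ((K x).apply_ne_top z) h
      _ = K x z := mul_one _

/-- Induction along a path to `o`: one step of positive probability into a state with a chance to
hit `o` leaves a chance to hit `o`. -/
lemma exists_avoidProb_lt_one (K : α → PMF α) {o x : α} (hx : x ≠ o) (h : Reachable K x o) :
    ∃ N, avoidProb K o N x < 1 := by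
  induction h using Relation.ReflTransGen.head_induction_on with
  | refl => exact absurd rfl hx
  | @head a c hac _ ih =>
    have key : ∃ N, avoidFrom K o N c < 1 := by
      by_cases hc : c = o
      · exact ⟨0, by simp [hc, avoidFrom_self]⟩
      · obtain ⟨N, hN⟩ := ih hc
        exact ⟨N, (avoidFrom_le K o N c).trans_lt hN⟩
    obtain ⟨N, hN⟩ := key
    exact ⟨N + 1, stepMean_lt_one K
      (fun z => (avoidFrom_le K o N z).trans (avoidProb_le_one K o N z)) hac hN⟩

/-- The sum is the mean of the hitting time of `o` truncated at `N`. Off `o` one step shifts its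
terms by one, so it decreases by the probability of hitting `o` within `N` steps. -/
lemma stepMean_sum_avoidFrom (K : α → PMF α) {o x : α} (hx : x ≠ o) (N : ℕ) :
    stepMean K (fun z => ∑ k ∈ Finset.range N, avoidFrom K o k z) x + 1 =
      ∑ k ∈ Finset.range N, avoidFrom K o k x + avoidProb K o N x := by
  rw [stepMean_finset_sum]
  simp_rw [← avoidProb_succ, avoidFrom_of_ne K hx]
  rw [← Finset.sum_range_succ, Finset.sum_range_succ']
  rfl

/-- A drift condition outside a finite set from which `o` can be reached yields a drift condition
outside `o`. -/
lemma exists_drift_off_point (K : α → PMF α) (o : α) (F : Finset α)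
    (hr : ∀ x ∈ F, Reachable K x o) (f : α → ℝ≥0∞) (hf : ∀ x, f x ≠ ∞)
    (hKf : ∀ x, stepMean K f x ≠ ∞) (hd : ∀ x, x ∉ F → x ≠ o → stepMean K f x + 1 ≤ f x) :
    ∃ h : α → ℝ≥0∞, (∀ x, h x ≠ ∞) ∧ (∀ x, stepMean K h x ≠ ∞) ∧
      ∀ x, x ≠ o → stepMean K h x + 1 ≤ h x := by
  classical
  induction F using Finset.induction_on generalizing f with
  | empty => exact ⟨f, hf, hKf, fun x hx => hd x (by simp) hx⟩
  | insert y F hy ih =>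
    have hr' : ∀ x ∈ F, Reachable K x o := fun x hx => hr x (Finset.mem_insert_of_mem hx)
    by_cases hyo : y = o
    · refine ih hr' f hf hKf fun x hx hxo => hd x ?_ hxo
      simp only [Finset.mem_insert, not_or]
      exact ⟨fun h => hxo (h.trans hyo), hx⟩
    obtain ⟨N, hN⟩ := exists_avoidProb_lt_one K hyo (hr y (Finset.mem_insert_self _ _))
    -- `u` is bounded, does not increase in mean off `o`, and decreases at `y` by `c > 0`. Adding a
    -- large multiple of it to `f` repairs the drift at `y` without spoiling it elsewhere.
    set u : α → ℝ≥0∞ := fun z => ∑ k ∈ Finset.range N, avoidFrom K o k z with hu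
    have hule : ∀ x, u x ≤ N := fun x => by
      refine (Finset.sum_le_sum fun k _ =>
        (avoidFrom_le K o k x).trans (avoidProb_le_one K o k x)).trans ?_
      simp
    have hKu : ∀ x, stepMean K u x ≠ ∞ := fun x =>
      ((stepMean_le_const K hule x).trans_lt (ENNReal.natCast_lt_top N)).ne
    have hufin : ∀ x, u x ≠ ∞ := fun x => ((hule x).trans_lt (ENNReal.natCast_lt_top N)).ne
    have hstep : ∀ x, x ≠ o → stepMean K u x ≤ u x := fun x hx => by
      have h1 := stepMean_sum_avoidFrom K hx N
      have h2 : stepMean K u x + 1 ≤ u x + 1 := by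
        rw [h1]; gcongr; exact avoidProb_le_one K o N x
      exact (ENNReal.add_le_add_iff_right ENNReal.one_ne_top).1 h2
    set c : ℝ≥0∞ := 1 - avoidProb K o N y with hc
    have hc0 : c ≠ 0 := (tsub_pos_of_lt hN).ne'
    have hcfin : c ≠ ∞ := (tsub_le_self.trans_lt ENNReal.one_lt_top).ne
    have hstepy : stepMean K u y + c ≤ u y := by
      have h1 := stepMean_sum_avoidFrom K hyo N
      have h2 : c + avoidProb K o N y = 1 := tsub_add_cancel_of_le hN.le
      rw [← h2, ← add_assoc] at h1
      exact ((ENNReal.add_left_inj hN.ne_top).1 h1).le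
    -- This choice makes the decrease `C * c` of `C * u` at `y` pay for all of `stepMean K f y + 1`.
    set C : ℝ≥0∞ := (stepMean K f y + 1) / c with hC
    have hCfin : C ≠ ∞ := ENNReal.div_ne_top (by simp [hKf y]) hc0
    have hCc : C * c = stepMean K f y + 1 := ENNReal.div_mul_cancel hc0 hcfin
    have hK' : ∀ x, stepMean K (fun z => f z + C * u z) x = stepMean K f x + C * stepMean K u x :=
      fun x => by rw [stepMean_add, stepMean_const_mul]
    refine ih hr' (fun z => f z + C * u z) (fun x => ?_) (fun x => ?_) fun x hx hxo => ?_
    · exact ENNReal.add_ne_top.2 ⟨hf x, ENNReal.mul_ne_top hCfin (hufin x)⟩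
    · rw [hK']
      exact ENNReal.add_ne_top.2 ⟨hKf x, ENNReal.mul_ne_top hCfin (hKu x)⟩
    · rw [hK']
      by_cases hxy : x = y
      · subst hxy
        calc stepMean K f x + C * stepMean K u x + 1
            = C * (stepMean K u x + c) := by rw [mul_add, hCc]; ring
          _ ≤ C * u x := by gcongr
          _ ≤ f x + C * u x := le_add_self
      · calc stepMean K f x + C * stepMean K u x + 1
            = (stepMean K f x + 1) + C * stepMean K u x := by ring
          _ ≤ f x + C * u x :=
            add_le_add (hd x (by simp [hxy, hx]) hxo) (mul_le_mul_right (hstep x hxo) _)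

/-- Foster's criterion: all mean hitting times of `o` are finite. -/
theorem tsum_avoidProb_ne_top (K : α → PMF α) (o : α) (F : Finset α)
    (hr : ∀ x ∈ F, Reachable K x o) (f : α → ℝ≥0∞) (hf : ∀ x, f x ≠ ∞)
    (hKf : ∀ x, stepMean K f x ≠ ∞) (hd : ∀ x, x ∉ F → stepMean K f x + 1 ≤ f x) (x : α) :
    ∑' t, avoidProb K o t x ≠ ∞ := by
  obtain ⟨h, hfin, hKfin, hdrift⟩ :=
    exists_drift_off_point K o F hr f hf hKf fun x hx _ => hd x hx
  -- The truncated mean hitting time is bounded by the Lyapunov function: lengthening the truncation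
  -- by one step turns `h` into `stepMean K h + 1 ≤ h`.
  have key : ∀ m x, ∑ t ∈ Finset.range m, avoidFrom K o t x ≤ h x := by
    intro m
    induction m with
    | zero => simp
    | succ m ih =>
      intro x
      by_cases hx : x = o
      · simp [hx, avoidFrom_self]
      · rw [Finset.sum_range_succ']
        have : ∀ t, avoidFrom K o (t + 1) x = stepMean K (avoidFrom K o t) x := fun t => by
          rw [avoidFrom_of_ne K hx, avoidProb_succ]
        simp_rw [this]
        rw [← stepMean_finset_sum]
        have h0 : avoidFrom K o 0 x = 1 := avoidFrom_of_ne K hx 0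
        rw [h0]
        exact (add_le_add_left (stepMean_mono K ih x) 1).trans (hdrift x hx)
  have bound : ∑' t, avoidProb K o t x ≤ 1 + stepMean K h x := by
    rw [ENNReal.tsum_eq_iSup_nat]
    refine iSup_le fun m => ?_
    cases m with
    | zero => simp
    | succ m =>
      rw [Finset.sum_range_succ', add_comm]
      simp_rw [avoidProb_succ]
      rw [← stepMean_finset_sum]
      exact add_le_add le_rfl (stepMean_mono K (key m) x)
  exact (bound.trans_lt (by simp [lt_top_iff_ne_top, hKfin x])).ne

/-- The chain made of two independent copies. -/
def pairChain (K : α → PMF α) (x : α × α) : PMF (α × α) :=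
  (K x.1).bind fun y => (K x.2).bind fun z => PMF.pure (y, z)

lemma pairChain_apply (K : α → PMF α) (x y : α × α) :
    pairChain K x y = K x.1 y.1 * K x.2 y.2 := by
  classical
  rw [pairChain, PMF.bind_apply, tsum_eq_single y.1, PMF.bind_apply, tsum_eq_single y.2]
  · simp
  · intro b hb
    rw [PMF.pure_apply, if_neg (fun h => hb (by rw [h])), mul_zero]
  · intro b hb
    rw [PMF.bind_apply, ENNReal.tsum_eq_zero.2, mul_zero]
    intro i
    rw [PMF.pure_apply, if_neg (fun h => hb (by rw [h])), mul_zero]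

lemma stepMean_pairChain_fst (K : α → PMF α) (f : α → ℝ≥0∞) (x : α × α) :
    stepMean (pairChain K) (fun z => f z.1) x = stepMean K f x.1 := by
  simp only [stepMean, pairChain_apply]
  rw [ENNReal.tsum_prod']
  refine tsum_congr fun a => ?_
  calc ∑' b, K x.1 a * K x.2 b * f a = ∑' b, (K x.1 a * f a) * K x.2 b :=
        tsum_congr fun b => by ring
    _ = K x.1 a * f a := by rw [ENNReal.tsum_mul_left, PMF.tsum_coe, mul_one]

lemma stepMean_pairChain_snd (K : α → PMF α) (f : α → ℝ≥0∞) (x : α × α) :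
    stepMean (pairChain K) (fun z => f z.2) x = stepMean K f x.2 := by
  simp only [stepMean, pairChain_apply]
  rw [ENNReal.tsum_prod', ENNReal.tsum_comm]
  refine tsum_congr fun b => ?_
  calc ∑' a, K x.1 a * K x.2 b * f b = ∑' a, (K x.2 b * f b) * K x.1 a :=
        tsum_congr fun a => by ring
    _ = K x.2 b * f b := by rw [ENNReal.tsum_mul_left, PMF.tsum_coe, mul_one]

/-- The coupling inequality. -/
lemma iterate_stepMean_le_add_avoidFrom (K : α → PMF α) (o : α) {φ : α → ℝ≥0∞}
    (hφ : ∀ x, φ x ≤ 1) (t : ℕ) (x : α × α) :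
    (stepMean K)^[t] φ x.1 ≤ (stepMean K)^[t] φ x.2 + avoidFrom (pairChain K) (o, o) t x := by
  -- The copies never have to be glued together: when both sit at `o`, the two iterates are equal,
  -- and up to that time the error term carries the difference.
  induction t generalizing x with
  | zero =>
    by_cases hx : x = (o, o)
    · simp [hx]
    · rw [avoidFrom_of_ne _ hx]
      exact (hφ x.1).trans le_add_self
  | succ t ih =>
    by_cases hx : x = (o, o)
    · simp [hx]
    · rw [avoidFrom_of_ne _ hx, Function.iterate_succ_apply', avoidProb_succ,
        ← stepMean_pairChain_fst K _ x, ← stepMean_pairChain_snd K _ x, ← stepMean_add]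
      exact stepMean_mono _ ih x

/-- Convergence to a stationary law, uniformly over test functions with values in `[0, 1]`, when two
independent copies of the chain have finite mean meeting times. -/
theorem tendsto_tsum_lawAt_mul (K : α → PMF α) (o : α) [Countable α]
    (hfin : ∀ x, ∑' t, avoidProb (pairChain K) (o, o) t x ≠ ∞) (π μ₀ : PMF α)
    (hπ : IsStationary K π) {φ : α → ℝ≥0∞} (hφ : ∀ x, φ x ≤ 1) :
    Tendsto (fun t => ∑' x, lawAt K μ₀ t x * φ x) atTop (𝓝 (∑' x, π x * φ x)) := by
  have hit : ∀ t, ∑' x, π x * (stepMean K)^[t] φ x = ∑' x, π x * φ x := by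
    intro t
    induction t with
    | zero => rfl
    | succ t ih => rw [Function.iterate_succ_apply', hπ, ih]
  -- A pointwise inequality on pairs, integrated against the product of two laws.
  have gen : ∀ (μ ν : PMF α) (g : α → ℝ≥0∞) (h : α → ℝ≥0∞) (a : α × α → ℝ≥0∞),
      (∀ x : α × α, g x.1 ≤ h x.2 + a x) →
      ∑' x, μ x * g x ≤ ∑' y, ν y * h y + ∑' x : α × α, (μ x.1 * ν x.2) * a x := by
    intro μ ν g h a hgh
    have e1 : ∑' x, μ x * g x = ∑' x : α × α, (μ x.1 * ν x.2) * g x.1 := by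
      rw [ENNReal.tsum_prod']
      refine tsum_congr fun x => ?_
      calc μ x * g x = (μ x * g x) * ∑' y, ν y := by rw [PMF.tsum_coe, mul_one]
        _ = _ := by rw [← ENNReal.tsum_mul_left]; exact tsum_congr fun y => by ring
    have e2 : ∑' y, ν y * h y = ∑' x : α × α, (μ x.1 * ν x.2) * h x.2 := by
      rw [ENNReal.tsum_prod', ENNReal.tsum_comm]
      refine tsum_congr fun y => ?_
      calc ν y * h y = (ν y * h y) * ∑' x, μ x := by rw [PMF.tsum_coe, mul_one]
        _ = _ := by rw [← ENNReal.tsum_mul_left]; exact tsum_congr fun x => by ring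
    rw [e1, e2, ← ENNReal.tsum_add]
    refine ENNReal.tsum_le_tsum fun x => ?_
    rw [← mul_add]
    exact mul_le_mul_right (hgh x) _
  -- Finite mean meeting times make the avoidance probabilities tend to `0` pointwise; the product
  -- law dominates.
  have small : ∀ μ ν : PMF α, Tendsto (fun t => ∑' x : α × α, (μ x.1 * ν x.2) *
      avoidFrom (pairChain K) (o, o) t x) atTop (𝓝 0) := by
    intro μ ν
    let _ : MeasurableSpace (α × α) := ⊤
    have hm : ∀ g : α × α → ℝ≥0∞, ∑' x, g x = ∫⁻ x, g x ∂Measure.count := fun g =>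
      (lintegral_count' (measurable_from_top)).symm
    simp_rw [hm]
    have h0 : (0 : ℝ≥0∞) = ∫⁻ _ : α × α, 0 ∂Measure.count := by simp
    rw [h0]
    refine tendsto_lintegral_of_dominated_convergence (fun x => μ x.1 * ν x.2)
      (fun t => measurable_from_top) (fun t => Eventually.of_forall fun x => ?_) ?_
      (Eventually.of_forall fun x => ?_)
    · exact mul_le_of_le_one_right' ((avoidFrom_le _ _ _ _).trans (avoidProb_le_one _ _ _ _))
    · rw [← hm, ENNReal.tsum_prod']
      simp [ENNReal.tsum_mul_left, PMF.tsum_coe]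
    · have h1 : Tendsto (fun t => avoidProb (pairChain K) (o, o) t x) atTop (𝓝 0) :=
        ENNReal.tendsto_atTop_zero_of_tsum_ne_top (hfin x)
      have h2 : Tendsto (fun t => avoidFrom (pairChain K) (o, o) t x) atTop (𝓝 0) :=
        tendsto_of_tendsto_of_tendsto_of_le_of_le tendsto_const_nhds h1 (fun _ => zero_le)
          fun t => avoidFrom_le _ _ _ _
      simpa using ENNReal.Tendsto.const_mul h2
        (Or.inr (ENNReal.mul_ne_top (μ.apply_ne_top _) (ν.apply_ne_top _)))
  have up : ∀ t, ∑' x, lawAt K μ₀ t x * φ x ≤ ∑' x, π x * φ x +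
      ∑' x : α × α, (μ₀ x.1 * π x.2) * avoidFrom (pairChain K) (o, o) t x := fun t => by
    rw [tsum_lawAt_mul, ← hit t]
    exact gen _ _ _ _ _ fun x => iterate_stepMean_le_add_avoidFrom K o hφ t x
  have lo : ∀ t, ∑' x, π x * φ x ≤ ∑' x, lawAt K μ₀ t x * φ x +
      ∑' x : α × α, (π x.1 * μ₀ x.2) * avoidFrom (pairChain K) (o, o) t x := fun t => by
    rw [tsum_lawAt_mul, ← hit t]
    exact gen _ _ _ _ _ fun x => iterate_stepMean_le_add_avoidFrom K o hφ t x
  have hπfin : ∑' x, π x * φ x ≠ ∞ :=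
    ((ENNReal.tsum_le_tsum fun x => mul_le_of_le_one_right' (hφ x)).trans_lt
      (by rw [PMF.tsum_coe]; exact ENNReal.one_lt_top)).ne
  refine tendsto_of_tendsto_of_tendsto_of_le_of_le
    (g := fun t => ∑' x, π x * φ x -
      ∑' x : α × α, (π x.1 * μ₀ x.2) * avoidFrom (pairChain K) (o, o) t x)
    (h := fun t => ∑' x, π x * φ x +
      ∑' x : α × α, (μ₀ x.1 * π x.2) * avoidFrom (pairChain K) (o, o) t x) ?_ ?_
    (fun t => tsub_le_iff_right.2 (lo t)) up
  · simpa using ENNReal.Tendsto.sub tendsto_const_nhds (small π μ₀) (Or.inl hπfin)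
  · simpa using (small μ₀ π).const_add (∑' x, π x * φ x)

/-- The occupation law of a chain started at `o` and killed when it returns to `o`. -/
def tabooLaw [DecidableEq α] (K : α → PMF α) (o : α) : ℕ → α → ℝ≥0∞
  | 0, y => if y = o then 1 else 0
  | t + 1, y => if y = o then 0 else ∑' x, tabooLaw K o t x * K x y

/-- The Markov property at time `t`: avoiding `o` for `t + s` steps means being somewhere off `o`
after `t` steps without a return, then avoiding it for `s` more. The proof moves one step at a time
from the measure to the function. -/
lemma tsum_tabooLaw_mul_avoidProb [DecidableEq α] (K : α → PMF α) (o : α) (t s : ℕ) :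
    ∑' y, tabooLaw K o t y * avoidProb K o s y = avoidProb K o (t + s) o := by
  induction t generalizing s with
  | zero =>
    rw [tsum_eq_single o fun y hy => by simp [tabooLaw, hy]]
    simp [tabooLaw]
  | succ t ih =>
    rw [show t + 1 + s = t + (s + 1) by ring, ← ih (s + 1)]
    simp_rw [avoidProb_succ, stepMean, ← ENNReal.tsum_mul_left]
    rw [ENNReal.tsum_comm]
    refine tsum_congr fun y => ?_
    by_cases hy : y = o
    · simp [hy, avoidFrom_self, tabooLaw]
    · rw [tabooLaw, if_neg hy, avoidFrom_of_ne K hy, ← ENNReal.tsum_mul_right]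
      exact tsum_congr fun x => by ring

/-- A state with finite mean return time carries a stationary law. -/
theorem exists_isStationary (K : α → PMF α) (o : α) (h : meanReturnTime K o ≠ ∞) :
    ∃ π : PMF α, IsStationary K π := by
  classical
  set m := meanReturnTime K o with hm
  have hmass : ∀ t, ∑' y, tabooLaw K o t y = avoidProb K o t o := fun t => by
    simpa [avoidProb] using tsum_tabooLaw_mul_avoidProb K o t 0
  -- The mean occupation measure of one excursion from `o`; its total mass is the mean return time.
  set μ : α → ℝ≥0∞ := fun y => ∑' t, tabooLaw K o t y with hμ
  have hμm : ∑' y, μ y = m := by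
    rw [hμ, ENNReal.tsum_comm]
    exact tsum_congr hmass
  have hm1 : 1 ≤ m := by
    rw [hm, meanReturnTime]
    exact ENNReal.le_tsum 0
  have hm0 : m ≠ 0 := (zero_lt_one.trans_le hm1).ne'
  -- the mass that returns to `o`
  have hret : ∀ t, ∑' x, tabooLaw K o t x * K x o + avoidProb K o (t + 1) o =
      avoidProb K o t o := fun t => by
    rw [← hmass (t + 1), ← hmass t]
    have e : ∑' y, tabooLaw K o t y = ∑' y, ∑' x, tabooLaw K o t x * K x y := by
      rw [ENNReal.tsum_comm]
      exact tsum_congr fun x => by rw [ENNReal.tsum_mul_left, PMF.tsum_coe, mul_one]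
    rw [e]
    have : ∀ y, ∑' x, tabooLaw K o t x * K x y =
        (if y = o then ∑' x, tabooLaw K o t x * K x o else 0) + tabooLaw K o (t + 1) y := by
      intro y
      by_cases hy : y = o
      · simp [hy, tabooLaw]
      · simp [hy, tabooLaw]
    rw [tsum_congr this, ENNReal.tsum_add, tsum_ite_eq]
  -- The chance of a first return at time `t + 1` is a difference of consecutive avoidance
  -- probabilities. The telescoping sum may be cancelled because the mean return time is finite.
  have hretsum : ∑' t, ∑' x, tabooLaw K o t x * K x o = 1 := by
    have h1 : ∑' t, ∑' x, tabooLaw K o t x * K x o + ∑' t, avoidProb K o (t + 1) o =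
        1 + ∑' t, avoidProb K o (t + 1) o := by
      rw [← ENNReal.tsum_add, tsum_congr hret, tsum_eq_zero_add' ENNReal.summable]
      rfl
    refine (ENNReal.add_left_inj ?_).1 h1
    have : ∑' t, avoidProb K o (t + 1) o ≤ m := by
      rw [hm, meanReturnTime,
        tsum_eq_zero_add' (f := fun t => avoidProb K o t o) ENNReal.summable]
      exact le_add_self
    exact (this.trans_lt (lt_top_iff_ne_top.2 h)).ne
  have hinv : ∀ y, ∑' x, μ x * K x y = μ y := by
    intro y
    simp_rw [hμ, ← ENNReal.tsum_mul_right]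
    rw [ENNReal.tsum_comm]
    by_cases hy : y = o
    · subst hy
      rw [hretsum, tsum_eq_single 0]
      · simp [tabooLaw]
      · intro t ht
        obtain ⟨s, rfl⟩ := Nat.exists_eq_succ_of_ne_zero ht
        simp [tabooLaw]
    · rw [tsum_eq_zero_add' (f := fun t => tabooLaw K o t y) ENNReal.summable]
      simp [tabooLaw, hy]
  refine ⟨PMF.normalize μ (by rwa [hμm]) (by rwa [hμm]), fun f => ?_⟩
  simp only [PMF.normalize_apply, stepMean, ← ENNReal.tsum_mul_left]
  rw [ENNReal.tsum_comm]
  refine tsum_congr fun y => ?_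
  conv_rhs => rw [← hinv y, ← ENNReal.tsum_mul_right, ← ENNReal.tsum_mul_right]
  exact tsum_congr fun x => by ring

/-- The comparison theorem for a stationary law: no integrability of `f` is needed. -/
theorem IsStationary.tsum_mul_le {K : α → PMF α} {π : PMF α} (hπ : IsStationary K π)
    {f g : α → ℝ≥0∞} {b : ℝ≥0∞} (hf : ∀ x, f x ≠ ∞)
    (hd : ∀ x, stepMean K f x + g x ≤ f x + b) : ∑' x, π x * g x ≤ b := by
  classical
  -- `f` need not be integrable, so it is replaced by `min f M`. The drift survives on `f ≤ M`, and
  -- elsewhere `min f M` is already at its maximum and cannot grow.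
  have trunc : ∀ M : ℕ, ∑' x, π x * (if f x ≤ M then g x else 0) ≤ b := by
    intro M
    have h1 : ∀ x, stepMean K (fun z => min (f z) M) x + (if f x ≤ M then g x else 0) ≤
        min (f x) M + b := by
      intro x
      by_cases hx : f x ≤ M
      · rw [if_pos hx, min_eq_left hx]
        exact (add_le_add_left (stepMean_mono K (fun z => min_le_left _ _) x) _).trans (hd x)
      · rw [if_neg hx, min_eq_right (not_le.1 hx).le, add_zero]
        exact (stepMean_le_const K (fun z => min_le_right _ _) x).trans le_self_add
    have h2 : ∑' x, π x * (stepMean K (fun z => min (f z) M) x + (if f x ≤ M then g x else 0)) ≤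
        ∑' x, π x * (min (f x) M + b) :=
      ENNReal.tsum_le_tsum fun x => mul_le_mul_right (h1 x) _
    simp_rw [mul_add, ENNReal.tsum_add] at h2
    rw [hπ, ENNReal.tsum_mul_right (a := b), PMF.tsum_coe, one_mul] at h2
    refine (ENNReal.add_le_add_iff_left ?_).1 h2
    have : ∑' x, π x * min (f x) M ≤ M := by
      refine (ENNReal.tsum_le_tsum fun x => mul_le_mul_right (min_le_right _ _) _).trans ?_
      rw [ENNReal.tsum_mul_right, PMF.tsum_coe, one_mul]
    exact (this.trans_lt (ENNReal.natCast_lt_top M)).ne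
  rw [ENNReal.tsum_eq_iSup_sum]
  refine iSup_le fun s => ?_
  obtain ⟨M, hM⟩ : ∃ M : ℕ, ∀ x ∈ s, f x ≤ M := by
    induction s using Finset.induction_on with
    | empty => exact ⟨0, by simp⟩
    | insert a s ha ih =>
      obtain ⟨M, hM⟩ := ih
      obtain ⟨M', hM'⟩ := ENNReal.exists_nat_gt (hf a)
      refine ⟨max M M', fun x hx => ?_⟩
      rcases Finset.mem_insert.1 hx with rfl | hx
      · exact hM'.le.trans (by exact_mod_cast le_max_right _ _)
      · exact (hM x hx).trans (by exact_mod_cast le_max_left _ _)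
  calc ∑ x ∈ s, π x * g x = ∑ x ∈ s, π x * (if f x ≤ M then g x else 0) :=
        Finset.sum_congr rfl fun x hx => by rw [if_pos (hM x hx)]
    _ ≤ ∑' x, π x * (if f x ≤ M then g x else 0) := ENNReal.sum_le_tsum s
    _ ≤ b := trunc M

end Markov

/-! ### The arrivals of one time slot -/

section Arrivals

variable {n : ℕ} (p : unitInterval)

lemma arrivalLaw_toMeasure : (arrivalLaw n p).toMeasure =
    Measure.pi fun _ : Fin n => Measure.pi fun _ : Fin n => bernoulliMeasure (1 : ℕ) 0 p :=
  Measure.toPMF_toMeasure _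

lemma ae_arrival_le_one : ∀ᵐ a ∂(arrivalLaw n p).toMeasure, ∀ i j, a i j ≤ 1 := by
  rw [arrivalLaw_toMeasure]
  refine ae_all_iff.2 fun i => ae_all_iff.2 fun j => ?_
  have h0 : ∀ᵐ x ∂(bernoulliMeasure (1 : ℕ) 0 p), x ≤ 1 := by
    rw [ae_iff, bernoulliMeasure_apply_of_notMem_of_notMem] <;> simp
  have h1 : ∀ᵐ b ∂(Measure.pi fun _ : Fin n => bernoulliMeasure (1 : ℕ) 0 p), b j ≤ 1 :=
    (Measure.tendsto_eval_ae_ae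
      (μ := fun _ : Fin n => bernoulliMeasure (1 : ℕ) 0 p)).eventually h0
  exact (Measure.tendsto_eval_ae_ae (μ := fun _ : Fin n =>
    Measure.pi fun _ : Fin n => bernoulliMeasure (1 : ℕ) 0 p)).eventually h1

/-- The arrivals are almost surely in a finite box, so no growth condition is needed. -/
lemma integrable_arrival (f : (Fin n → Fin n → ℕ) → ℝ) :
    Integrable f (arrivalLaw n p).toMeasure := by
  have hfin : (Set.Icc (0 : Fin n → Fin n → ℕ) (fun _ _ => 1)).Finite := Set.finite_Icc _ _
  obtain ⟨C, hC⟩ := (hfin.image fun a => ‖f a‖).bddAbove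
  refine Integrable.of_bound (Measurable.of_discrete).aestronglyMeasurable C ?_
  filter_upwards [ae_arrival_le_one p] with a ha
  exact hC ⟨a, ⟨fun i j => Nat.zero_le _, ha⟩, rfl⟩

lemma integral_arrival (i j : Fin n) : ∫ a, (a i j : ℝ) ∂(arrivalLaw n p).toMeasure = p := by
  rw [arrivalLaw_toMeasure]
  have h1 := (measurePreserving_eval
    (fun _ : Fin n => Measure.pi fun _ : Fin n => bernoulliMeasure (1 : ℕ) 0 p) i)
  have h2 := (measurePreserving_eval (fun _ : Fin n => bernoulliMeasure (1 : ℕ) 0 p) j)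
  have h := h2.comp h1
  have := integral_map (μ := Measure.pi fun _ : Fin n => Measure.pi fun _ : Fin n =>
    bernoulliMeasure (1 : ℕ) 0 p) h.measurable.aemeasurable
    (f := fun x : ℕ => (x : ℝ)) (Measurable.of_discrete).aestronglyMeasurable
  rw [h.map_eq, integral_bernoulliMeasure] at this
  simpa using this.symm

lemma integral_linear_arrival (c : Fin n → Fin n → ℝ) :
    ∫ a, (∑ i, ∑ j, c i j * (a i j : ℝ)) ∂(arrivalLaw n p).toMeasure = p * ∑ i, ∑ j, c i j := by
  rw [integral_finsetSum _ fun i _ => integrable_arrival p _]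
  simp_rw [integral_finsetSum _ fun j _ => integrable_arrival p _, integral_const_mul,
    integral_arrival, Finset.mul_sum]
  exact Finset.sum_congr rfl fun i _ => Finset.sum_congr rfl fun j _ => mul_comm _ _

lemma variance_linear_arrival (c : Fin n → Fin n → ℝ) :
    Var[fun a : Fin n → Fin n → ℕ => ∑ i, ∑ j, c i j * (a i j : ℝ); (arrivalLaw n p).toMeasure] =
      p * (1 - p) * ∑ i, ∑ j, c i j ^ 2 := by
  have hbern : ∀ f : ℕ → ℝ, MemLp f 2 (bernoulliMeasure (1 : ℕ) 0 p) := fun f => by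
    rw [memLp_two_iff_integrable_sq (Measurable.of_discrete).aestronglyMeasurable]
    exact integrable_bernoulliMeasure _ _ _ _
  have hcoord : ∀ j : Fin n, MemLp (fun b : Fin n → ℕ => (b j : ℝ)) 2
      (Measure.pi fun _ : Fin n => bernoulliMeasure (1 : ℕ) 0 p) := fun j =>
    (hbern fun x => (x : ℝ)).comp_measurePreserving
      (measurePreserving_eval (fun _ : Fin n => bernoulliMeasure (1 : ℕ) 0 p) j)
  have hrow : ∀ i, MemLp (fun b : Fin n → ℕ => ∑ j, c i j * (b j : ℝ)) 2
      (Measure.pi fun _ : Fin n => bernoulliMeasure (1 : ℕ) 0 p) := fun i =>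
    memLp_finsetSum _ fun j _ => (hcoord j).const_mul (c i j)
  rw [arrivalLaw_toMeasure]
  have e : (fun a : Fin n → Fin n → ℕ => ∑ i, ∑ j, c i j * (a i j : ℝ)) =
      ∑ i, fun a : Fin n → Fin n → ℕ => ∑ j, c i j * (a i j : ℝ) := by
    ext a; simp
  rw [e, variance_sum_pi (X := fun i (b : Fin n → ℕ) => ∑ j, c i j * (b j : ℝ)) hrow,
    Finset.mul_sum]
  refine Finset.sum_congr rfl fun i _ => ?_
  have e' : (fun b : Fin n → ℕ => ∑ j, c i j * (b j : ℝ)) =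
      ∑ j, fun b : Fin n → ℕ => c i j * (b j : ℝ) := by
    ext a; simp
  rw [e', variance_sum_pi (X := fun j (x : ℕ) => c i j * (x : ℝ)) fun j => hbern _,
    Finset.mul_sum]
  refine Finset.sum_congr rfl fun j _ => ?_
  rw [variance_const_mul, variance_eq_sub (hbern _)]
  simp only [Pi.pow_apply, integral_bernoulliMeasure]
  simp
  ring

lemma integral_sq_linear_arrival (c : Fin n → Fin n → ℝ) :
    ∫ a, (∑ i, ∑ j, c i j * (a i j : ℝ)) ^ 2 ∂(arrivalLaw n p).toMeasure =
      p * (1 - p) * ∑ i, ∑ j, c i j ^ 2 + (p * ∑ i, ∑ j, c i j) ^ 2 := by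
  have h := variance_linear_arrival p c
  rw [variance_eq_sub ((memLp_two_iff_integrable_sq
    (Measurable.of_discrete).aestronglyMeasurable).2 (integrable_arrival p _)),
    integral_linear_arrival] at h
  simp only [Pi.pow_apply] at h
  linarith

/-- A slot without arrivals has positive probability; this is what lets the switch drain. -/
lemma arrivalLaw_zero_ne_zero (hp : (p : ℝ) < 1) : arrivalLaw n p 0 ≠ 0 := by
  rw [arrivalLaw, Measure.toPMF_apply]
  have : ({0} : Set (Fin n → Fin n → ℕ)) =
      Set.univ.pi fun _ : Fin n => Set.univ.pi fun _ : Fin n => ({0} : Set ℕ) := by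
    simp only [Set.univ_pi_singleton]; rfl
  rw [this, Measure.pi_pi]
  simp_rw [Measure.pi_pi]
  refine Finset.prod_ne_zero_iff.2 fun i _ => Finset.prod_ne_zero_iff.2 fun j _ => ?_
  rw [bernoulliMeasure_apply_of_notMem_of_mem (s := {0}) p (MeasurableSet.of_discrete) (by simp) (Set.mem_singleton 0)]
  simp only [ne_eq, ENNReal.coe_eq_zero]
  intro h
  have h2 : ((unitInterval.symm p : unitInterval) : ℝ) = 0 := by
    have := congrArg NNReal.toReal h
    simpa using this
  rw [unitInterval.coe_symm_eq] at h2
  linarith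

end Arrivals

/-! ### One step of the queue length chain -/

section Transition

variable {n : ℕ} (p : unitInterval) (A : Policy n)

lemma lintegral_toMeasure {β : Type*} [MeasurableSpace β] [Countable β]
    [MeasurableSingletonClass β] (μ : PMF β) (f : β → ℝ≥0∞) :
    ∫⁻ x, f x ∂μ.toMeasure = ∑' x, μ x * f x := by
  rw [lintegral_countable']
  refine tsum_congr fun x => ?_
  rw [PMF.toMeasure_apply_singleton _ _ (measurableSet_singleton x), mul_comm]

lemma tsum_bind_mul' {β γ : Type*} (μ : PMF β) (K : β → PMF γ) (f : γ → ℝ≥0∞) :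
    ∑' y, μ.bind K y * f y = ∑' x, μ x * ∑' y, K x y * f y := by
  simp only [PMF.bind_apply, ← ENNReal.tsum_mul_right, ← ENNReal.tsum_mul_left]
  rw [ENNReal.tsum_comm]
  exact tsum_congr fun x => tsum_congr fun y => by ring

lemma tsum_pure_mul {β : Type*} (x : β) (f : β → ℝ≥0∞) :
    ∑' y, PMF.pure x y * f y = f x := by
  classical
  rw [tsum_eq_single x fun y hy => by simp [hy]]
  simp

lemma stepMean_transition (f : QueueState n → ℝ≥0∞) (q : QueueState n) :
    stepMean (transition p A) f q =
      ∑' s, A q s * ∫⁻ a, f (nextQueue q a s) ∂(arrivalLaw n p).toMeasure := by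
  rw [stepMean, transition, tsum_bind_mul']
  refine tsum_congr fun s => ?_
  rw [tsum_bind_mul', lintegral_toMeasure]
  simp_rw [tsum_pure_mul]

/-- A drift bound that holds for every schedule in the support survives averaging, so the
tie-breaking rule never enters. -/
lemma stepMean_transition_le {F : QueueState n → ℝ} (hF : ∀ q, 0 ≤ F q) {q : QueueState n} {c : ℝ}
    (h : ∀ s ∈ (A q).support, ∫ a, F (nextQueue q a s) ∂(arrivalLaw n p).toMeasure ≤ c) :
    stepMean (transition p A) (fun x => ENNReal.ofReal (F x)) q ≤ ENNReal.ofReal c := by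
  rw [stepMean_transition]
  calc _ ≤ ∑' s, A q s * ENNReal.ofReal c := by
        refine ENNReal.tsum_le_tsum fun s => ?_
        by_cases hs : A q s = 0
        · simp [hs]
        · refine mul_le_mul_right ?_ _
          rw [← ofReal_integral_eq_lintegral_ofReal (integrable_arrival p _)
            (Eventually.of_forall fun a => hF _)]
          exact ENNReal.ofReal_le_ofReal (h s ((A q).mem_support_iff s |>.2 hs))
    _ = ENNReal.ofReal c := by rw [ENNReal.tsum_mul_right, PMF.tsum_coe, one_mul]

lemma nextQueue_zero_mem_support (hp : (p : ℝ) < 1) {q : QueueState n} {s : feasibleSchedules n}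
    (hs : s ∈ (A q).support) : nextQueue q 0 s ∈ (transition p A q).support := by
  rw [transition, PMF.mem_support_bind_iff]
  refine ⟨s, hs, ?_⟩
  rw [PMF.mem_support_bind_iff]
  exact ⟨0, (PMF.mem_support_iff _ _).2 (arrivalLaw_zero_ne_zero p hp), by simp⟩

end Transition

/-! ### MaxWeight schedules -/

section Schedules

variable {n : ℕ}

lemma feasible_single (i₀ j₀ : Fin n) :
    (fun i j => if i = i₀ ∧ j = j₀ then 1 else 0) ∈ feasibleSchedules n := by
  refine ⟨fun i j => by dsimp only; split_ifs <;> simp, fun j => ?_, fun i => ?_⟩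
  · by_cases h : j = j₀ <;> simp [h]
  · by_cases h : i = i₀ <;> simp [h]

lemma weight_single (q : QueueState n) (i₀ j₀ : Fin n) :
    weight q (fun i j => if i = i₀ ∧ j = j₀ then 1 else 0) = q i₀ j₀ := by
  simp only [weight, mul_ite, mul_one, mul_zero]
  rw [Finset.sum_eq_single i₀ (by intro b _ hb; simp [hb]) (by simp)]
  simp

lemma feasible_perm (σ : Equiv.Perm (Fin n)) :
    (fun i j => if σ i = j then 1 else 0) ∈ feasibleSchedules n := by
  refine ⟨fun i j => by dsimp only; split_ifs <;> simp, fun j => ?_, fun i => by simp⟩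
  have : ∀ i, (σ i = j) = (i = σ.symm j) := fun i => by
    rw [eq_iff_iff, Equiv.eq_symm_apply]
  simp [this]

/-- Serving a single nonempty queue has positive weight, so a maximizer also serves some nonempty
queue. -/
lemma totalQueue_nextQueue_zero_lt {q : QueueState n} (hq : q ≠ 0) {s : Fin n → Fin n → ℕ}
    (hs : ∀ s' ∈ feasibleSchedules n, weight q s' ≤ weight q s) :
    totalQueue (nextQueue q 0 s) < totalQueue q := by
  obtain ⟨i₀, j₀, h0⟩ : ∃ i j, q i j ≠ 0 := by
    by_contra! h
    exact hq (funext fun i => funext fun j => h i j)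
  have hw : 0 < weight q s := by
    have := hs _ (feasible_single i₀ j₀)
    rw [weight_single] at this
    omega
  obtain ⟨i₁, j₁, h1⟩ : ∃ i j, q i j * s i j ≠ 0 := by
    by_contra! h
    simp [weight, h] at hw
  have hle : ∀ i j, nextQueue q 0 s i j ≤ q i j := fun i j => by simp [nextQueue]
  refine Finset.sum_lt_sum (fun i _ => Finset.sum_le_sum fun j _ => hle i j)
    ⟨i₁, Finset.mem_univ _, Finset.sum_lt_sum (fun j _ => hle i₁ j) ⟨j₁, Finset.mem_univ _, ?_⟩⟩
  have := mul_ne_zero_iff.1 h1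
  simp only [nextQueue, Pi.zero_apply]
  omega

/-- A doubly substochastic matrix is dominated by a doubly stochastic one. -/
lemma exists_doublyStochastic_ge {P : Fin n → Fin n → ℝ} (hr : ∀ i, ∑ j, P i j ≤ 1)
    (hc : ∀ j, ∑ i, P i j ≤ 1) :
    ∃ Q : Fin n → Fin n → ℝ, (∀ i j, P i j + (1 - ∑ k, P i k) * (1 - ∑ k, P k j) /
        (n - ∑ k, ∑ l, P k l) = Q i j) ∧ (∀ i j, P i j ≤ Q i j) ∧
      (∀ i, ∑ j, Q i j = 1) ∧ ∀ j, ∑ i, Q i j = 1 := by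
  refine ⟨_, fun i j => rfl, fun i j => ?_, fun i => ?_, fun j => ?_⟩
  · have : 0 ≤ (n : ℝ) - ∑ k, ∑ l, P k l := by
      have := Finset.sum_le_sum fun i (_ : i ∈ Finset.univ) => hr i
      simp at this
      linarith
    have h1 := hr i
    have h2 := hc j
    have := div_nonneg (mul_nonneg (sub_nonneg.2 h1) (sub_nonneg.2 h2)) this
    linarith
  · have e : ∑ j, (1 - ∑ k, P k j) = (n : ℝ) - ∑ k, ∑ l, P k l := by
      rw [Finset.sum_sub_distrib, Finset.sum_comm]; simp
    rw [Finset.sum_add_distrib, ← Finset.sum_div, ← Finset.mul_sum, e]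
    -- If the total deficit vanishes, so does each row deficit, being a nonnegative summand; the row
    -- is then already full.
    by_cases hz : (n : ℝ) - ∑ k, ∑ l, P k l = 0
    · have e' : ∑ i, (1 - ∑ k, P i k) = 0 := by
        rw [Finset.sum_sub_distrib]; simpa using hz
      have := (Finset.sum_eq_zero_iff_of_nonneg fun i _ => sub_nonneg.2 (hr i)).1 e' i
        (Finset.mem_univ _)
      rw [this]
      simp
      linarith
    · field_simp
      ring
  · have e : ∑ i, (1 - ∑ k, P i k) = (n : ℝ) - ∑ k, ∑ l, P k l := by
      rw [Finset.sum_sub_distrib]; simp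
    rw [Finset.sum_add_distrib, ← Finset.sum_div, ← Finset.sum_mul, e]
    by_cases hz : (n : ℝ) - ∑ k, ∑ l, P k l = 0
    · have e' : ∑ j, (1 - ∑ k, P k j) = 0 := by
        rw [Finset.sum_sub_distrib, Finset.sum_comm]; simpa using hz
      have := (Finset.sum_eq_zero_iff_of_nonneg fun i _ => sub_nonneg.2 (hc i)).1 e' j
        (Finset.mem_univ _)
      rw [this]
      simp
      linarith
    · field_simp
      ring

/-- The weight of a doubly substochastic matrix is at most the largest weight of a schedule. -/
lemma sum_mul_le_weight {q : QueueState n} {s : Fin n → Fin n → ℕ}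
    (hs : ∀ s' ∈ feasibleSchedules n, weight q s' ≤ weight q s) {P : Fin n → Fin n → ℝ}
    (h0 : ∀ i j, 0 ≤ P i j) (hr : ∀ i, ∑ j, P i j ≤ 1) (hc : ∀ j, ∑ i, P i j ≤ 1) :
    ∑ i, ∑ j, (q i j : ℝ) * P i j ≤ weight q s := by
  -- Since `q` is nonnegative, passing to `Q` only increases the weight, and by Birkhoff's theorem
  -- `Q` is a convex combination of permutations, which are schedules.
  obtain ⟨Q, -, hPQ, hQr, hQc⟩ := exists_doublyStochastic_ge hr hc
  have hQ : (Matrix.of Q) ∈ doublyStochastic ℝ (Fin n) :=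
    mem_doublyStochastic_iff_sum.2 ⟨fun i j => (h0 i j).trans (hPQ i j), hQr, hQc⟩
  obtain ⟨w, hw0, hw1, hw⟩ := exists_eq_sum_perm_of_mem_doublyStochastic hQ
  have hQe : ∀ i j, Q i j = ∑ σ, w σ * (if σ i = j then 1 else 0) := fun i j => by
    have := congrFun (congrFun hw i) j
    rw [Matrix.sum_apply] at this
    simpa [Equiv.Perm.permMatrix, PEquiv.toMatrix_apply, eq_comm] using this.symm
  have hσ : ∀ σ : Equiv.Perm (Fin n),
      ∑ i, ∑ j, (q i j : ℝ) * (if σ i = j then 1 else 0) ≤ weight q s := fun σ => by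
    have := hs _ (feasible_perm σ)
    have h2 : ((weight q fun i j => if σ i = j then 1 else 0 : ℕ) : ℝ) ≤ weight q s := by
      exact_mod_cast this
    simpa [weight] using h2
  calc ∑ i, ∑ j, (q i j : ℝ) * P i j ≤ ∑ i, ∑ j, (q i j : ℝ) * Q i j := by
        gcongr with i _ j _; exact hPQ i j
    _ = ∑ σ, w σ * ∑ i, ∑ j, (q i j : ℝ) * (if σ i = j then 1 else 0) := by
        simp_rw [hQe, Finset.mul_sum]
        refine ((Finset.sum_congr rfl fun i _ => Finset.sum_comm).trans Finset.sum_comm).trans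
          (Finset.sum_congr rfl fun σ _ => Finset.sum_congr rfl fun i _ =>
            Finset.sum_congr rfl fun j _ => ?_)
        ring
    _ ≤ ∑ σ, w σ * (weight q s : ℝ) := by
        gcongr with σ _
        · exact hw0 σ
        · exact hσ σ
    _ = weight q s := by rw [← Finset.sum_mul, hw1, one_mul]

lemma totalQueue_div_le_weight {q : QueueState n} {s : Fin n → Fin n → ℕ}
    (hs : ∀ s' ∈ feasibleSchedules n, weight q s' ≤ weight q s) :
    (totalQueue q : ℝ) / n ≤ weight q s := by
  rcases Nat.eq_zero_or_pos n with rfl | hn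
  · simp
  have hn' : (n : ℝ) ≠ 0 := by positivity
  have := sum_mul_le_weight hs (P := fun _ _ => 1 / (n : ℝ)) (fun _ _ => by positivity)
    (fun i => by simp [hn']) (fun j => by simp [hn'])
  simpa [totalQueue, ← Finset.sum_mul, div_eq_mul_inv] using this

end Schedules

/-! ### Weak convergence on the discrete space of queue length vectors -/

section WeakConvergence

variable {n : ℕ} (p : unitInterval) (A : Policy n)

/-- On a discrete space every bounded function is continuous, so weak convergence tests all of them.
-/
lemma ConvergesInLaw.tendsto {p : unitInterval} {A : Policy n} {μ₀ π : PMF (QueueState n)}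
    (h : ConvergesInLaw p A μ₀ π) {φ : QueueState n → ℝ≥0∞} (hφ : ∀ x, φ x ≤ 1) :
    Tendsto (fun t => ∑' x, lawAt (transition p A) μ₀ t x * φ x) atTop
      (𝓝 (∑' x, π x * φ x)) := by
  have hfin : ∀ x, φ x ≠ ∞ := fun x => ((hφ x).trans_lt ENNReal.one_lt_top).ne
  have hle : ∀ x, (φ x).toNNReal ≤ 1 := fun x => by
    simpa using ENNReal.toNNReal_mono ENNReal.one_ne_top (hφ x)
  let f : BoundedContinuousFunction (QueueState n) NNReal :=
    BoundedContinuousFunction.mkOfDiscrete (fun x => (φ x).toNNReal) 1 fun x y => by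
      have h1 : ((φ x).toNNReal : ℝ) ≤ 1 := hle x
      have h2 : ((φ y).toNNReal : ℝ) ≤ 1 := hle y
      rw [NNReal.dist_eq, abs_sub_le_iff]
      constructor <;> linarith [(φ x).toNNReal.coe_nonneg, (φ y).toNNReal.coe_nonneg]
  have := (ProbabilityMeasure.tendsto_iff_forall_lintegral_tendsto.1 h) f
  simp only [toProbabilityMeasure, ProbabilityMeasure.coe_mk, lintegral_toMeasure] at this
  simpa [f, ENNReal.coe_toNNReal (hfin _)] using this

/-- A weak limit of the laws of the chain is stationary. -/
lemma ConvergesInLaw.isStationary {p : unitInterval} {A : Policy n} {μ₀ π : PMF (QueueState n)}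
    (h : ConvergesInLaw p A μ₀ π) : IsStationary (transition p A) π := by
  classical
  have key : ∀ y, π.bind (transition p A) y = π y := by
    intro y
    set φ : QueueState n → ℝ≥0∞ := fun x => if x = y then 1 else 0 with hφd
    have hφ : ∀ x, φ x ≤ 1 := fun x => by simp only [hφd]; split_ifs <;> simp
    have h1 := (tendsto_add_atTop_iff_nat 1).2 (h.tendsto hφ)
    simp only [lawAt, tsum_bind_mul] at h1
    have h2 := h.tendsto (φ := stepMean (transition p A) φ) (stepMean_le_const _ hφ)
    have h3 := tendsto_nhds_unique h1 h2
    rw [← tsum_bind_mul] at h3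
    have e : ∀ ν : PMF (QueueState n), ∑' x, ν x * φ x = ν y := fun ν => by
      rw [tsum_eq_single y fun x hx => by simp [hφd, hx]]
      simp [hφd]
    rw [e, e] at h3
    exact h3.symm
  intro f
  rw [← tsum_bind_mul, PMF.ext key]

lemma convergesInLaw_of_tendsto {μ₀ π : PMF (QueueState n)}
    (h : ∀ φ : QueueState n → ℝ≥0∞, (∀ x, φ x ≤ 1) →
      Tendsto (fun t => ∑' x, lawAt (transition p A) μ₀ t x * φ x) atTop
        (𝓝 (∑' x, π x * φ x))) : ConvergesInLaw p A μ₀ π := by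
  refine ProbabilityMeasure.tendsto_iff_forall_lintegral_tendsto.2 fun f => ?_
  simp only [toProbabilityMeasure, ProbabilityMeasure.coe_mk, lintegral_toMeasure]
  obtain ⟨C, hC⟩ : ∃ C : NNReal, ∀ x, f x ≤ C := by
    refine ⟨nndist f 0 + 0, fun x => ?_⟩
    have := BoundedContinuousFunction.nndist_coe_le_nndist (f := f) (g := 0) x
    simpa [NNReal.nndist_eq] using this
  -- Rescaling to values in `[0, 1]`; the extra `1` keeps the divisor nonzero.
  set D : ℝ≥0∞ := (C : ℝ≥0∞) + 1 with hD
  have hD0 : D ≠ 0 := by simp [hD]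
  have hDt : D ≠ ∞ := by simp [hD]
  have h1 := h (fun x => (f x : ℝ≥0∞) / D) fun x => by
    refine ENNReal.div_le_of_le_mul ?_
    rw [one_mul, hD]
    exact (ENNReal.coe_le_coe.2 (hC x)).trans le_self_add
  have h2 := ENNReal.Tendsto.mul_const (b := D) h1 (Or.inr hDt)
  simp_rw [← ENNReal.tsum_mul_right, mul_assoc, ENNReal.div_mul_cancel hD0 hDt] at h2
  exact h2

end WeakConvergence

/-! ### Stability of MaxWeight -/

section Stability

variable {n : ℕ} {p : unitInterval} {A : Policy n}

lemma reachable_zero (hp : (p : ℝ) < 1) (hA : IsMaxWeight A) (q : QueueState n) :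
    Reachable (transition p A) q 0 := by
  induction h : totalQueue q using Nat.strong_induction_on generalizing q with
  | _ m ih =>
    by_cases hq : q = 0
    · rw [hq]; exact Relation.ReflTransGen.refl
    · obtain ⟨s, hs⟩ := (A q).support_nonempty
      exact Relation.ReflTransGen.head (nextQueue_zero_mem_support p A hp hs)
        (ih _ (h ▸ totalQueue_nextQueue_zero_lt hq (hA q s hs)) _ rfl)

lemma exists_drain_step (hp : (p : ℝ) < 1) (hA : IsMaxWeight A) (q : QueueState n) :
    ∃ q' ∈ (transition p A q).support, totalQueue q' ≤ totalQueue q ∧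
      (q ≠ 0 → totalQueue q' < totalQueue q) := by
  obtain ⟨s, hs⟩ := (A q).support_nonempty
  refine ⟨_, nextQueue_zero_mem_support p A hp hs, ?_, fun hq =>
    totalQueue_nextQueue_zero_lt hq (hA q s hs)⟩
  exact Finset.sum_le_sum fun i _ => Finset.sum_le_sum fun j _ => by simp [nextQueue]

/-- Without arrivals both copies drain, and a copy that is already empty stays empty while it waits
for the other. This waiting replaces an aperiodicity argument. -/
lemma reachable_pair_zero (hp : (p : ℝ) < 1) (hA : IsMaxWeight A) (x : QueueState n × QueueState n) :
    Reachable (pairChain (transition p A)) x (0, 0) := by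
  induction h : totalQueue x.1 + totalQueue x.2 using Nat.strong_induction_on generalizing x with
  | _ m ih =>
    by_cases hx : x = (0, 0)
    · rw [hx]; exact Relation.ReflTransGen.refl
    · obtain ⟨y, hy, hy1, hy2⟩ := exists_drain_step hp hA x.1
      obtain ⟨z, hz, hz1, hz2⟩ := exists_drain_step hp hA x.2
      have hmem : (y, z) ∈ (pairChain (transition p A) x).support := by
        rw [PMF.mem_support_iff, pairChain_apply]
        exact mul_ne_zero hy hz
      refine Relation.ReflTransGen.head hmem (ih _ ?_ _ rfl)
      by_cases h1 : x.1 = 0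
      · have h2 : x.2 ≠ 0 := fun h2 => hx (Prod.ext h1 h2)
        have := hz2 h2
        simp only; omega
      · have := hy2 h1
        simp only; omega

/-- The squared Euclidean norm of a queue length vector. -/
def sqNorm (q : QueueState n) : ℝ := ∑ i, ∑ j, (q i j : ℝ) ^ 2

lemma sqNorm_nonneg (q : QueueState n) : 0 ≤ sqNorm q :=
  Finset.sum_nonneg fun _ _ => Finset.sum_nonneg fun _ _ => sq_nonneg _

lemma sq_nextQueue_le (q a s : ℕ) : ((q + a - s : ℕ) : ℝ) ^ 2 ≤ ((q : ℝ) + a - s) ^ 2 := by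
  rcases le_total s (q + a) with h | h
  · rw [Nat.cast_sub h]; push_cast; exact le_rfl
  · rw [Nat.sub_eq_zero_of_le h]; simp; positivity

lemma feasible_sum_le (s : feasibleSchedules n) : ∑ i, ∑ j, ((s : Fin n → Fin n → ℕ) i j : ℝ) ≤ n := by
  have : ∀ i, ∑ j, ((s : Fin n → Fin n → ℕ) i j : ℝ) ≤ 1 := fun i => by
    exact_mod_cast s.2.2.2 i
  simpa using Finset.sum_le_sum fun i (_ : i ∈ Finset.univ) => this i

lemma feasible_le_one (s : feasibleSchedules n) (i j : Fin n) : (s : Fin n → Fin n → ℕ) i j ≤ 1 := by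
  rcases s.2.1 i j with h | h <;> omega

lemma sq_sub_le_add {a s : ℕ} (ha : a ≤ 1) (hs : s ≤ 1) : ((a : ℝ) - s) ^ 2 ≤ a + s := by
  interval_cases a <;> interval_cases s <;> norm_num

/-- Expanding the square, arrivals contribute `2 p` times the total and service removes twice the
weight, which is at least `2 / n` times the total. Of the constant `2 * n`, one `n` bounds the
scheduled service and the other the mean arrivals. -/
lemma integral_sqNorm_le (hp : n * (p : ℝ) ≤ 1) {q : QueueState n} {s : feasibleSchedules n}
    (hs : ∀ s' ∈ feasibleSchedules n, weight q s' ≤ weight q s) :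
    ∫ a, sqNorm (nextQueue q a s) ∂(arrivalLaw n p).toMeasure ≤
      sqNorm q - 2 * (1 / n - p) * totalQueue q + 2 * n := by
  have hpt : ∀ᵐ a ∂(arrivalLaw n p).toMeasure, sqNorm (nextQueue q a s) ≤
      (sqNorm q - 2 * weight q s + n) + ∑ i, ∑ j, (2 * (q i j : ℝ) + 1) * (a i j : ℝ) := by
    filter_upwards [ae_arrival_le_one p] with a ha
    calc sqNorm (nextQueue q a s)
        ≤ ∑ i, ∑ j, ((q i j : ℝ) ^ 2 - 2 * (q i j * (s : Fin n → Fin n → ℕ) i j) +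
            (s : Fin n → Fin n → ℕ) i j + (2 * (q i j : ℝ) + 1) * a i j) := by
          refine Finset.sum_le_sum fun i _ => Finset.sum_le_sum fun j _ => ?_
          refine (sq_nextQueue_le _ _ _).trans ?_
          have := sq_sub_le_add (ha i j) (feasible_le_one s i j)
          nlinarith
      _ = sqNorm q - 2 * weight q s + ∑ i, ∑ j, ((s : Fin n → Fin n → ℕ) i j : ℝ) +
            ∑ i, ∑ j, (2 * (q i j : ℝ) + 1) * (a i j : ℝ) := by
          simp only [Finset.sum_add_distrib, Finset.sum_sub_distrib, ← Finset.mul_sum, sqNorm,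
            weight]
          push_cast
          ring
      _ ≤ _ := by linarith [feasible_sum_le s]
  refine (integral_mono_ae (integrable_arrival p _) (integrable_arrival p _) hpt).trans ?_
  rw [integral_add (integrable_const _) (integrable_arrival p _), integral_linear_arrival]
  have hw := totalQueue_div_le_weight hs
  have e : ∑ i, ∑ j, (2 * (q i j : ℝ) + 1) = 2 * totalQueue q + n * n := by
    simp only [Finset.sum_add_distrib, ← Finset.mul_sum, totalQueue]
    push_cast
    simp
  simp only [integral_const, probReal_univ, smul_eq_mul, one_mul, e]
  have : (p : ℝ) * (n * n) ≤ n := by nlinarith [(Nat.cast_nonneg n : (0 : ℝ) ≤ n)]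
  have e2 : 2 * (1 / (n : ℝ) - p) * totalQueue q =
    2 * (totalQueue q / n) - 2 * p * totalQueue q := by ring
  rw [e2]
  nlinarith

lemma stepMean_sqNorm_le (hp : n * (p : ℝ) ≤ 1) (hA : IsMaxWeight A) (q : QueueState n) :
    stepMean (transition p A) (fun x => ENNReal.ofReal (sqNorm x)) q +
        ENNReal.ofReal (2 * (1 / n - p) * totalQueue q) ≤
      ENNReal.ofReal (sqNorm q) + ENNReal.ofReal (2 * n) := by
  have h0 : 0 ≤ 2 * (1 / (n : ℝ) - p) * totalQueue q := by
    rcases Nat.eq_zero_or_pos n with rfl | hn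
    · simp [totalQueue]
    have : (p : ℝ) ≤ 1 / n := by
      rw [le_div_iff₀ (by positivity)]; linarith
    have : 0 ≤ 1 / (n : ℝ) - p := by linarith
    positivity
  have hstep := stepMean_transition_le p A (F := sqNorm) sqNorm_nonneg
    (fun s hs => integral_sqNorm_le hp (hA q s hs))
  have hc : 0 ≤ sqNorm q - 2 * (1 / n - p) * totalQueue q + 2 * n := by
    obtain ⟨s, hs⟩ := (A q).support_nonempty
    exact (integral_nonneg fun a => sqNorm_nonneg _).trans (integral_sqNorm_le hp (hA q s hs))
  calc _ ≤ ENNReal.ofReal (sqNorm q - 2 * (1 / n - p) * totalQueue q + 2 * n) +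
        ENNReal.ofReal (2 * (1 / n - p) * totalQueue q) := by gcongr
    _ = ENNReal.ofReal (sqNorm q + 2 * n) := by
        rw [← ENNReal.ofReal_add hc h0]; congr 1; ring
    _ = _ := ENNReal.ofReal_add (sqNorm_nonneg q) (by positivity)

lemma finite_totalQueue_le (M : ℝ) : {q : QueueState n | (totalQueue q : ℝ) ≤ M}.Finite := by
  obtain ⟨N, hN⟩ := exists_nat_ge M
  refine (Set.finite_Icc (0 : QueueState n) (fun _ _ => N)).subset fun q hq => ?_
  have hq' : totalQueue q ≤ N := by exact_mod_cast (le_trans hq hN)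
  refine ⟨fun i j => Nat.zero_le _, fun i j => ?_⟩
  calc q i j ≤ ∑ j, q i j := Finset.single_le_sum (f := fun j => q i j)
        (fun _ _ => Nat.zero_le _) (Finset.mem_univ j)
    _ ≤ totalQueue q := Finset.single_le_sum (f := fun i => ∑ j, q i j)
        (fun _ _ => Nat.zero_le _) (Finset.mem_univ i)
    _ ≤ N := hq'

lemma stepMean_sqNorm_ne_top (hp : n * (p : ℝ) ≤ 1) (hA : IsMaxWeight A) (q : QueueState n) :
    stepMean (transition p A) (fun x => ENNReal.ofReal (sqNorm x)) q ≠ ∞ := by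
  exact ((le_self_add.trans (stepMean_sqNorm_le hp hA q)).trans_lt
    (ENNReal.add_lt_top.2 ⟨ENNReal.ofReal_lt_top, ENNReal.ofReal_lt_top⟩)).ne

lemma one_div_sub_pos (hn : 0 < n) (hp : n * (p : ℝ) < 1) : 0 < 1 / (n : ℝ) - p := by
  rw [sub_pos, lt_div_iff₀ (by positivity)]; linarith

lemma coe_lt_one_of_load (hn : 0 < n) (hp : n * (p : ℝ) < 1) : (p : ℝ) < 1 := by
  have : (1 : ℝ) ≤ n := by exact_mod_cast hn
  nlinarith [p.2.1]

/-- MaxWeight is positive recurrent when the load is below one. -/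
theorem isPositiveRecurrent_maxWeight (hn : 0 < n) (hp : n * (p : ℝ) < 1) (hA : IsMaxWeight A) :
    IsPositiveRecurrent p A := by
  have hp1 := coe_lt_one_of_load hn hp
  have hδ := one_div_sub_pos hn hp
  intro q hq
  refine ⟨reachable_zero hp1 hA q, lt_top_iff_ne_top.2 ?_⟩
  -- Above this level the negative drift exceeds the constant `2 * n` by at least one.
  set M : ℝ := (2 * n + 1) / (2 * (1 / n - p)) with hM
  refine tsum_avoidProb_ne_top _ q (finite_totalQueue_le (n := n) M).toFinset
    (fun x _ => (reachable_zero hp1 hA x).trans hq) (fun x => ENNReal.ofReal (sqNorm x))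
    (fun x => ENNReal.ofReal_ne_top) (stepMean_sqNorm_ne_top hp.le hA) (fun x hx => ?_) q
  have hx' : M < totalQueue x := by simpa using hx
  have h1 : 2 * (n : ℝ) + 1 ≤ 2 * (1 / n - p) * totalQueue x := by
    rw [hM, div_lt_iff₀ (by positivity)] at hx'; linarith
  have h2 := stepMean_sqNorm_le hp.le hA x
  have h3 : ENNReal.ofReal (2 * n) + 1 ≤ ENNReal.ofReal (2 * (1 / n - p) * totalQueue x) := by
    rw [← ENNReal.ofReal_one, ← ENNReal.ofReal_add (by positivity) zero_le_one]
    exact ENNReal.ofReal_le_ofReal h1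
  refine (ENNReal.add_le_add_iff_right (a := ENNReal.ofReal (2 * n)) ENNReal.ofReal_ne_top).1 ?_
  calc _ = stepMean (transition p A) (fun x => ENNReal.ofReal (sqNorm x)) x +
        (ENNReal.ofReal (2 * n) + 1) := by ring
    _ ≤ _ := (add_le_add_right h3 _).trans h2

/-- The chain of two independent MaxWeight switches hits the pair of empty switches quickly. -/
lemma tsum_avoidProb_pair_ne_top (hn : 0 < n) (hp : n * (p : ℝ) < 1) (hA : IsMaxWeight A)
    (x : QueueState n × QueueState n) :
    ∑' t, avoidProb (pairChain (transition p A)) (0, 0) t x ≠ ∞ := by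
  have hp1 := coe_lt_one_of_load hn hp
  have hδ := one_div_sub_pos hn hp
  -- One large copy suffices: its negative drift beats the constants `2 * n` of both copies by one.
  set M : ℝ := (4 * n + 1) / (2 * (1 / n - p)) with hM
  have hstep : ∀ x : QueueState n × QueueState n, stepMean (pairChain (transition p A))
      (fun z => ENNReal.ofReal (sqNorm z.1) + ENNReal.ofReal (sqNorm z.2)) x =
      stepMean (transition p A) (fun x => ENNReal.ofReal (sqNorm x)) x.1 +
      stepMean (transition p A) (fun x => ENNReal.ofReal (sqNorm x)) x.2 := fun x => by
    rw [stepMean_add, stepMean_pairChain_fst _ (fun x => ENNReal.ofReal (sqNorm x)),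
      stepMean_pairChain_snd _ (fun x => ENNReal.ofReal (sqNorm x))]
  refine tsum_avoidProb_ne_top _ (0, 0)
    ((finite_totalQueue_le (n := n) M).toFinset ×ˢ (finite_totalQueue_le (n := n) M).toFinset)
    (fun x _ => reachable_pair_zero hp1 hA x)
    (fun z => ENNReal.ofReal (sqNorm z.1) + ENNReal.ofReal (sqNorm z.2))
    (fun x => by simp) (fun x => ?_) (fun x hx => ?_) x
  · rw [hstep]
    exact ENNReal.add_ne_top.2
      ⟨stepMean_sqNorm_ne_top hp.le hA _, stepMean_sqNorm_ne_top hp.le hA _⟩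
  have h0 : ∀ q : QueueState n, 0 ≤ 2 * (1 / (n : ℝ) - p) * totalQueue q := fun q => by positivity
  have h1 : 4 * (n : ℝ) + 1 ≤
      2 * (1 / n - p) * totalQueue x.1 + 2 * (1 / n - p) * totalQueue x.2 := by
    have hx' : M < totalQueue x.1 ∨ M < totalQueue x.2 := by
      simp only [Finset.mem_product, Set.Finite.mem_toFinset, Set.mem_ofPred_eq, not_and_or,
        not_le] at hx
      exact hx
    rw [hM, div_lt_iff₀ (by positivity), div_lt_iff₀ (by positivity)] at hx'
    rcases hx' with h | h <;> nlinarith [h0 x.1, h0 x.2]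
  have h2 := add_le_add (stepMean_sqNorm_le hp.le hA x.1) (stepMean_sqNorm_le hp.le hA x.2)
  have h3 : ENNReal.ofReal (2 * n) + ENNReal.ofReal (2 * n) + 1 ≤
      ENNReal.ofReal (2 * (1 / n - p) * totalQueue x.1) +
        ENNReal.ofReal (2 * (1 / n - p) * totalQueue x.2) := by
    rw [← ENNReal.ofReal_one, ← ENNReal.ofReal_add (by positivity) (by positivity),
      ← ENNReal.ofReal_add (by positivity) zero_le_one, ← ENNReal.ofReal_add (h0 _) (h0 _)]
    exact ENNReal.ofReal_le_ofReal (by linarith)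
  rw [hstep]
  refine (ENNReal.add_le_add_iff_right (a := ENNReal.ofReal (2 * n) + ENNReal.ofReal (2 * n))
    (ENNReal.add_ne_top.2 ⟨ENNReal.ofReal_ne_top, ENNReal.ofReal_ne_top⟩)).1 ?_
  calc _ = (stepMean (transition p A) (fun x => ENNReal.ofReal (sqNorm x)) x.1 +
        stepMean (transition p A) (fun x => ENNReal.ofReal (sqNorm x)) x.2) +
        (ENNReal.ofReal (2 * n) + ENNReal.ofReal (2 * n) + 1) := by ring
    _ ≤ _ := add_le_add_right h3 _
    _ = _ := by ring
    _ ≤ _ := h2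
    _ = _ := by ring

/-- MaxWeight has a limiting law, from every initial law. -/
theorem exists_convergesInLaw_maxWeight (hn : 0 < n) (hp : n * (p : ℝ) < 1) (hA : IsMaxWeight A) :
    ∃ π : PMF (QueueState n), ∀ μ₀, ConvergesInLaw p A μ₀ π := by
  obtain ⟨π, hπ⟩ := exists_isStationary (transition p A) 0
    ((isPositiveRecurrent_maxWeight hn hp hA 0 Relation.ReflTransGen.refl).2).ne
  exact ⟨π, fun μ₀ => convergesInLaw_of_tendsto p A fun φ hφ =>
    tendsto_tsum_lawAt_mul _ 0 (tsum_avoidProb_pair_ne_top hn hp hA) π μ₀ hπ hφ⟩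

/-- The stationary mean total queue length of MaxWeight is finite. -/
theorem meanTotalQueue_ne_top (hn : 0 < n) (hp : n * (p : ℝ) < 1) (hA : IsMaxWeight A)
    {π : PMF (QueueState n)} (hπ : IsStationary (transition p A) π) : meanTotalQueue π ≠ ∞ := by
  have hδ := one_div_sub_pos hn hp
  have h := hπ.tsum_mul_le (fun x => ENNReal.ofReal_ne_top) (stepMean_sqNorm_le hp.le hA)
  have e : ∀ q : QueueState n, π q * ENNReal.ofReal (2 * (1 / n - p) * totalQueue q) =
      ENNReal.ofReal (2 * (1 / n - p)) * (π q * (totalQueue q : ℝ≥0∞)) := fun q => by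
    rw [ENNReal.ofReal_mul (by positivity), ENNReal.ofReal_natCast]; ring
  simp_rw [e, ENNReal.tsum_mul_left] at h
  intro htop
  rw [show (∑' q, π q * (totalQueue q : ℝ≥0∞)) = ∞ from htop, ENNReal.mul_top] at h
  · exact absurd (top_le_iff.1 h) ENNReal.ofReal_ne_top
  · simpa using hδ

end Stability

/-! ### Balance equations of a stationary law -/

section Balance

variable {n : ℕ} (p : unitInterval) (A : Policy n) (π : PMF (QueueState n))

/-- The joint law of the queue lengths and the schedule. -/
def queueScheduleLaw : PMF (QueueState n × feasibleSchedules n) :=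
  π.bind fun q => (A q).bind fun s => PMF.pure (q, s)

/-- A time slot: the queue lengths, the schedule, and the arrivals. -/
abbrev Slot (n : ℕ) : Type := (QueueState n × feasibleSchedules n) × (Fin n → Fin n → ℕ)

/-- The joint law of the queue lengths, the schedule and the arrivals in one time slot. -/
def slotLaw : Measure (Slot n) :=
  (queueScheduleLaw A π).toMeasure.prod (arrivalLaw n p).toMeasure

instance : IsProbabilityMeasure (slotLaw p A π) := by unfold slotLaw; infer_instance

/-- The number of packets that leave each queue. -/
def departures (w : Slot n) (i j : Fin n) : ℕ :=
  min ((w.1.2 : Fin n → Fin n → ℕ) i j) (w.1.1 i j + w.2 i j)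

/-- The queue lengths after the slot. -/
def nextState (w : Slot n) : QueueState n := nextQueue w.1.1 w.2 w.1.2

lemma nextState_eq (w : Slot n) (i j : Fin n) :
    (nextState w i j : ℝ) = w.1.1 i j + w.2 i j - departures w i j := by
  simp only [nextState, nextQueue, departures]
  rcases le_total ((w.1.2 : Fin n → Fin n → ℕ) i j) (w.1.1 i j + w.2 i j) with h | h
  · rw [Nat.cast_sub h, min_eq_left h]; push_cast; ring
  · rw [Nat.sub_eq_zero_of_le h, min_eq_right h]; push_cast; ring

lemma lintegral_slotLaw_fst (f : QueueState n × feasibleSchedules n → ℝ≥0∞) :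
    ∫⁻ w, f w.1 ∂slotLaw p A π = ∑' x, queueScheduleLaw A π x * f x := by
  rw [slotLaw, lintegral_prod _ (Measurable.of_discrete).aemeasurable]
  simp [lintegral_toMeasure]

lemma lintegral_slotLaw_queue (f : QueueState n → ℝ≥0∞) :
    ∫⁻ w, f w.1.1 ∂slotLaw p A π = ∑' q, π q * f q := by
  rw [lintegral_slotLaw_fst p A π fun x => f x.1, queueScheduleLaw, tsum_bind_mul']
  refine tsum_congr fun q => ?_
  rw [tsum_bind_mul']
  simp_rw [tsum_pure_mul]
  rw [ENNReal.tsum_mul_right, PMF.tsum_coe, one_mul]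

lemma lintegral_slotLaw_next (f : QueueState n → ℝ≥0∞) :
    ∫⁻ w, f (nextState w) ∂slotLaw p A π = ∑' q, π q * stepMean (transition p A) f q := by
  rw [slotLaw, lintegral_prod _ (Measurable.of_discrete).aemeasurable, lintegral_toMeasure,
    queueScheduleLaw, tsum_bind_mul']
  refine tsum_congr fun q => ?_
  rw [tsum_bind_mul', stepMean_transition]
  simp_rw [tsum_pure_mul]
  rfl

lemma ae_slotLaw_queue_schedule {P : QueueState n × feasibleSchedules n → Prop}
    (h : ∀ q, ∀ s ∈ (A q).support, P (q, s)) : ∀ᵐ w ∂slotLaw p A π, P w.1 := by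
  classical
  have h1 : ∀ᵐ x ∂(queueScheduleLaw A π).toMeasure, P x := by
    rw [ae_iff, PMF.toMeasure_apply_eq_zero_iff _ (MeasurableSet.of_discrete)]
    rw [Set.disjoint_left]
    rintro ⟨q, s⟩ hx hP
    refine hP ?_
    rw [queueScheduleLaw, PMF.mem_support_bind_iff] at hx
    obtain ⟨q', -, hx⟩ := hx
    rw [PMF.mem_support_bind_iff] at hx
    obtain ⟨s', hs', hx⟩ := hx
    rw [PMF.support_pure, Set.mem_singleton_iff, Prod.mk.injEq] at hx
    rw [hx.1, hx.2]
    exact h q' s' hs'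
  exact Measure.quasiMeasurePreserving_fst.ae h1

lemma ae_slotLaw_arrival : ∀ᵐ w ∂slotLaw p A π, ∀ i j, w.2 i j ≤ 1 :=
  Measure.quasiMeasurePreserving_snd.ae (ae_arrival_le_one p)

variable {p A π}

lemma integrable_totalQueue (hT : meanTotalQueue π ≠ ∞) :
    Integrable (fun w : Slot n => (totalQueue w.1.1 : ℝ)) (slotLaw p A π) := by
  refine ⟨(Measurable.of_discrete).aestronglyMeasurable, ?_⟩
  rw [HasFiniteIntegral]
  have e : ∀ w : Slot n, ‖(totalQueue w.1.1 : ℝ)‖ₑ = (totalQueue w.1.1 : ℝ≥0∞) := fun w => by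
    rw [Real.enorm_of_nonneg (by positivity), ENNReal.ofReal_natCast]
  simp_rw [e]
  rw [lintegral_slotLaw_queue p A π fun q => (totalQueue q : ℝ≥0∞)]
  exact lt_top_iff_ne_top.2 hT

lemma integral_totalQueue :
    ∫ w, (totalQueue w.1.1 : ℝ) ∂slotLaw p A π = (meanTotalQueue π).toReal := by
  rw [integral_eq_lintegral_of_nonneg_ae (Eventually.of_forall fun w => by positivity)
    (Measurable.of_discrete).aestronglyMeasurable]
  simp_rw [ENNReal.ofReal_natCast]
  rw [lintegral_slotLaw_queue p A π fun q => (totalQueue q : ℝ≥0∞)]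
  rfl

/-- A function bounded by an affine function of the total queue length is integrable. -/
lemma integrable_of_le (hT : meanTotalQueue π ≠ ∞) {F : Slot n → ℝ} (C : ℝ)
    (h : ∀ w : Slot n, (∀ i j, w.2 i j ≤ 1) → |F w| ≤ C * (1 + totalQueue w.1.1)) :
    Integrable F (slotLaw p A π) := by
  refine (((integrable_const 1).add (integrable_totalQueue hT)).const_mul C).mono'
    (Measurable.of_discrete).aestronglyMeasurable ?_
  filter_upwards [ae_slotLaw_arrival p A π] with w hw
  exact h w hw

/-- The balance equation: integrable increments of a function along the stationary chain have mean
zero, even if the function itself is not integrable. -/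
lemma IsStationary.integral_increment_eq_zero (hπ : IsStationary (transition p A) π)
    {V : QueueState n → ℝ} (hV : ∀ q, 0 ≤ V q)
    (hint : Integrable (fun w : Slot n => V (nextState w) - V w.1.1) (slotLaw p A π)) :
    ∫ w, (V (nextState w) - V w.1.1) ∂slotLaw p A π = 0 := by
  -- For bounded functions the statement is stationarity itself. Truncation is 1-Lipschitz, so the
  -- truncated increments are dominated by the true one.
  have trunc : ∀ M : ℕ, ∫ w, (min (V (nextState w)) M - min (V w.1.1) M) ∂slotLaw p A π = 0 := by
    intro M
    have hb : ∀ q, ‖min (V q) (M : ℝ)‖ ≤ M := fun q => by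
      rw [Real.norm_of_nonneg (le_min (hV q) (by positivity))]; exact min_le_right _ _
    have hi1 : Integrable (fun w : Slot n => min (V (nextState w)) (M : ℝ)) (slotLaw p A π) :=
      Integrable.of_bound (Measurable.of_discrete).aestronglyMeasurable (M : ℝ)
        (Eventually.of_forall fun w => hb _)
    have hi2 : Integrable (fun w : Slot n => min (V w.1.1) (M : ℝ)) (slotLaw p A π) :=
      Integrable.of_bound (Measurable.of_discrete).aestronglyMeasurable (M : ℝ)
        (Eventually.of_forall fun w => hb _)
    rw [integral_sub hi1 hi2, sub_eq_zero,
      integral_eq_lintegral_of_nonneg_ae (Eventually.of_forall fun w => le_min (hV _) (by positivity))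
        hi1.1,
      integral_eq_lintegral_of_nonneg_ae (Eventually.of_forall fun w => le_min (hV _) (by positivity))
        hi2.1,
      lintegral_slotLaw_queue p A π fun q => ENNReal.ofReal (min (V q) M),
      lintegral_slotLaw_next p A π fun q => ENNReal.ofReal (min (V q) M), hπ]
  have lim : Tendsto (fun M : ℕ => ∫ w, (min (V (nextState w)) M - min (V w.1.1) M) ∂slotLaw p A π)
      atTop (𝓝 (∫ w, (V (nextState w) - V w.1.1) ∂slotLaw p A π)) := by
    refine tendsto_integral_of_dominated_convergence
      (fun w => ‖V (nextState w) - V w.1.1‖) (fun M => (Measurable.of_discrete).aestronglyMeasurable)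
      hint.norm (fun M => Eventually.of_forall fun w => ?_) (Eventually.of_forall fun w => ?_)
    · exact abs_min_sub_min_le_max _ _ _ _ |>.trans (by simp)
    · refine tendsto_const_nhds.congr' ?_
      obtain ⟨N, hN⟩ := exists_nat_ge (max (V (nextState w)) (V w.1.1))
      filter_upwards [eventually_ge_atTop N] with M hM
      have hM' : (N : ℝ) ≤ M := by exact_mod_cast hM
      rw [min_eq_left ((le_max_left _ _).trans (hN.trans hM')),
        min_eq_left ((le_max_right _ _).trans (hN.trans hM'))]
  simp_rw [trunc] at lim
  exact (tendsto_nhds_unique lim tendsto_const_nhds)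

/-- The linear functional with coefficients `c`. -/
def linearForm (c : Fin n → Fin n → ℝ) (x : Fin n → Fin n → ℕ) : ℝ := ∑ i, ∑ j, c i j * x i j

lemma linearForm_nextState (c : Fin n → Fin n → ℝ) (w : Slot n) :
    linearForm c (nextState w) =
      linearForm c w.1.1 + linearForm c w.2 - linearForm c (departures w) := by
  simp only [linearForm, nextState_eq, mul_sub, mul_add, Finset.sum_add_distrib,
    Finset.sum_sub_distrib]

lemma linearForm_nonneg {c : Fin n → Fin n → ℝ} (hc : ∀ i j, 0 ≤ c i j) (x : Fin n → Fin n → ℕ) :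
    0 ≤ linearForm c x :=
  Finset.sum_nonneg fun i _ => Finset.sum_nonneg fun j _ => mul_nonneg (hc i j) (by positivity)

lemma linearForm_le_of_le_one {c : Fin n → Fin n → ℝ} (hc : ∀ i j, 0 ≤ c i j)
    {x : Fin n → Fin n → ℕ} (hx : ∀ i j, x i j ≤ 1) : linearForm c x ≤ ∑ i, ∑ j, c i j :=
  Finset.sum_le_sum fun i _ => Finset.sum_le_sum fun j _ =>
    mul_le_of_le_one_right (hc i j) (by exact_mod_cast hx i j)

lemma linearForm_le_totalQueue {c : Fin n → Fin n → ℝ} (hc : ∀ i j, 0 ≤ c i j)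
    (x : QueueState n) : linearForm c x ≤ (∑ i, ∑ j, c i j) * totalQueue x := by
  rw [totalQueue]
  push_cast
  simp only [linearForm, Finset.sum_mul]
  refine Finset.sum_le_sum fun i _ => Finset.sum_le_sum fun j _ =>
    mul_le_mul_of_nonneg_left ?_ (hc i j)
  calc (x i j : ℝ) ≤ ∑ j, (x i j : ℝ) := Finset.single_le_sum (f := fun j => (x i j : ℝ))
        (fun _ _ => by positivity) (Finset.mem_univ j)
    _ ≤ _ := Finset.single_le_sum (f := fun i => ∑ j, (x i j : ℝ))
        (fun _ _ => Finset.sum_nonneg fun _ _ => by positivity) (Finset.mem_univ i)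

lemma departures_le_one (w : Slot n) (i j : Fin n) : departures w i j ≤ 1 :=
  (min_le_left _ _).trans (feasible_le_one w.1.2 i j)

variable {c : Fin n → Fin n → ℝ}

/-- Arrivals and departures are bounded, so any expression in them times a linear form of the queues
needs only the first moment of the total. In particular no second moment of the queues is required
below. -/
lemma integrable_linearForms (hT : meanTotalQueue π ≠ ∞) (hc : ∀ i j, 0 ≤ c i j)
    (F : ℝ → ℝ → ℝ) (hF : ∀ S, ∃ C, ∀ x y, 0 ≤ x → x ≤ S →
    0 ≤ y → y ≤ S → |F x y| ≤ C) :
    Integrable (fun w : Slot n => F (linearForm c w.2) (linearForm c (departures w)))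
      (slotLaw p A π) ∧
    Integrable (fun w : Slot n => linearForm c w.1.1 *
      F (linearForm c w.2) (linearForm c (departures w))) (slotLaw p A π) := by
  set S := ∑ i, ∑ j, c i j with hS
  have hS0 : 0 ≤ S := Finset.sum_nonneg fun i _ => Finset.sum_nonneg fun j _ => hc i j
  obtain ⟨C, hC⟩ := hF S
  have hC0 : 0 ≤ C := (abs_nonneg _).trans (hC 0 0 le_rfl hS0 le_rfl hS0)
  have hb : ∀ w : Slot n, (∀ i j, w.2 i j ≤ 1) →
      |F (linearForm c w.2) (linearForm c (departures w))| ≤ C := fun w hw =>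
    hC _ _ (linearForm_nonneg hc _) (linearForm_le_of_le_one hc hw) (linearForm_nonneg hc _)
      (linearForm_le_of_le_one hc (departures_le_one w))
  refine ⟨integrable_of_le hT C fun w hw => (hb w hw).trans ?_,
    integrable_of_le hT (S * C) fun w hw => ?_⟩
  · have : (0 : ℝ) ≤ totalQueue w.1.1 := by positivity
    nlinarith
  · rw [abs_mul, abs_of_nonneg (linearForm_nonneg hc _)]
    have h1 := linearForm_le_totalQueue hc w.1.1
    have : (0 : ℝ) ≤ totalQueue w.1.1 := by positivity
    calc _ ≤ (S * totalQueue w.1.1) * C :=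
          mul_le_mul h1 (hb w hw) (abs_nonneg _) (by positivity)
      _ ≤ S * C * (1 + totalQueue w.1.1) := by nlinarith [mul_nonneg hS0 hC0]

/-- The balance of the first moments: the mean departures equal the mean arrivals. -/
lemma integral_linearForm_departures (hT : meanTotalQueue π ≠ ∞)
    (hπ : IsStationary (transition p A) π) (hc : ∀ i j, 0 ≤ c i j) :
    ∫ w, linearForm c (departures w) ∂slotLaw p A π = p * ∑ i, ∑ j, c i j := by
  have ha := (integrable_linearForms (p := p) (A := A) hT hc (fun x _ => x)
    fun S => ⟨S, fun x y hx hxS _ _ => by rwa [abs_of_nonneg hx]⟩).1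
  have hd := (integrable_linearForms (p := p) (A := A) hT hc (fun _ y => y)
    fun S => ⟨S, fun x y _ _ hy hyS => by rwa [abs_of_nonneg hy]⟩).1
  have h := hπ.integral_increment_eq_zero (V := linearForm c) (linearForm_nonneg hc) (by
    refine (ha.sub hd).congr (Eventually.of_forall fun w => ?_)
    simp only [linearForm_nextState, Pi.sub_apply]
    ring)
  simp_rw [linearForm_nextState] at h
  have e : ∀ w : Slot n, linearForm c w.1.1 + linearForm c w.2 - linearForm c (departures w) -
      linearForm c w.1.1 = linearForm c w.2 - linearForm c (departures w) := fun w => by ring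
  simp_rw [e] at h
  rw [integral_sub ha hd, sub_eq_zero] at h
  rw [← h, slotLaw, integral_fun_snd (μ := (queueScheduleLaw A π).toMeasure)
    (ν := (arrivalLaw n p).toMeasure) (f := linearForm c)]
  simp only [probReal_univ, one_smul]
  exact integral_linear_arrival p c

/-- The balance of the second moments. -/
lemma integral_linearForm_balance (hT : meanTotalQueue π ≠ ∞)
    (hπ : IsStationary (transition p A) π) (hc : ∀ i j, 0 ≤ c i j) :
    2 * ∫ w, linearForm c w.1.1 * (linearForm c (departures w) - p * ∑ i, ∑ j, c i j)
        ∂slotLaw p A π =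
      ∫ w, (linearForm c w.2 - linearForm c (departures w)) ^ 2 ∂slotLaw p A π := by
  have hid : ∀ S : ℝ, ∃ C, ∀ x y : ℝ, 0 ≤ x → x ≤ S → 0 ≤ y → y ≤ S → |x| ≤ C :=
    fun S => ⟨S, fun x y hx hxS _ _ => by rwa [abs_of_nonneg hx]⟩
  have hid' : ∀ S : ℝ, ∃ C, ∀ x y : ℝ, 0 ≤ x → x ≤ S → 0 ≤ y → y ≤ S → |y| ≤ C :=
    fun S => ⟨S, fun x y _ _ hy hyS => by rwa [abs_of_nonneg hy]⟩
  have hsq : ∀ S : ℝ, ∃ C, ∀ x y : ℝ, 0 ≤ x → x ≤ S → 0 ≤ y → y ≤ S → |(x - y) ^ 2| ≤ C :=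
    fun S => ⟨S ^ 2, fun x y hx hxS hy hyS => by
      rw [abs_of_nonneg (sq_nonneg _)]; nlinarith⟩
  have h1 : ∀ S : ℝ, ∃ C, ∀ x y : ℝ, 0 ≤ x → x ≤ S → 0 ≤ y → y ≤ S → |(1 : ℝ)| ≤ C :=
    fun S => ⟨1, fun x y _ _ _ _ => by simp⟩
  have ia := (integrable_linearForms (p := p) (A := A) hT hc (fun x _ => x) hid).2
  have id := (integrable_linearForms (p := p) (A := A) hT hc (fun _ y => y) hid').2
  have isq := (integrable_linearForms (p := p) (A := A) hT hc (fun x y => (x - y) ^ 2) hsq).1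
  have iL : Integrable (fun w : Slot n => linearForm c w.1.1) (slotLaw p A π) := by
    simpa using (integrable_linearForms (p := p) (A := A) hT hc (fun _ _ => 1) h1).2
  have e : ∀ w : Slot n, linearForm c (nextState w) ^ 2 - linearForm c w.1.1 ^ 2 =
      2 * (linearForm c w.1.1 * linearForm c w.2) -
        2 * (linearForm c w.1.1 * linearForm c (departures w)) +
        (linearForm c w.2 - linearForm c (departures w)) ^ 2 := fun w => by
    rw [linearForm_nextState]; ring
  have h := hπ.integral_increment_eq_zero (V := fun q => linearForm c q ^ 2)
    (fun q => sq_nonneg _) (by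
      simp_rw [e]
      exact ((ia.const_mul 2).sub (id.const_mul 2)).add isq)
  simp_rw [e] at h
  have isub : Integrable (fun w : Slot n => 2 * (linearForm c w.1.1 * linearForm c w.2) -
      2 * (linearForm c w.1.1 * linearForm c (departures w))) (slotLaw p A π) :=
    (ia.const_mul 2).sub (id.const_mul 2)
  rw [integral_add isub isq,
    integral_sub (ia.const_mul 2) (id.const_mul 2), integral_const_mul, integral_const_mul] at h
  -- The arrivals of a slot are independent of the queue lengths at its start.
  have hind : ∫ w, linearForm c w.1.1 * linearForm c w.2 ∂slotLaw p A π =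
      (∫ w, linearForm c w.1.1 ∂slotLaw p A π) * (p * ∑ i, ∑ j, c i j) := by
    have e1 := integral_prod_mul (μ := (queueScheduleLaw A π).toMeasure)
      (ν := (arrivalLaw n p).toMeasure) (fun x : QueueState n × feasibleSchedules n =>
        linearForm c x.1) (fun a => linearForm c a)
    have e2 := integral_fun_fst (μ := (queueScheduleLaw A π).toMeasure)
      (ν := (arrivalLaw n p).toMeasure) (f := fun x : QueueState n × feasibleSchedules n =>
        linearForm c x.1)
    rw [slotLaw, e1, e2]
    simp only [probReal_univ, one_smul]
    congr 1
    exact integral_linear_arrival p c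
  have e3 : ∀ w : Slot n, linearForm c w.1.1 * (linearForm c (departures w) -
      p * ∑ i, ∑ j, c i j) = linearForm c w.1.1 * linearForm c (departures w) -
      linearForm c w.1.1 * (p * ∑ i, ∑ j, c i j) := fun w => by ring
  simp_rw [e3]
  rw [integral_sub id (iL.mul_const _), integral_mul_const]
  rw [hind] at h
  linarith

end Balance

/-! ### Rows and columns, and the universal lower bound -/

section Lines

variable {n : ℕ}

/-- The indicator of a set of `n` queues of which at most one can be served in a slot. -/
structure IsLine (c : Fin n → Fin n → ℝ) : Prop where
  zero_or_one : ∀ i j, c i j = 0 ∨ c i j = 1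
  sum_eq : ∑ i, ∑ j, c i j = n
  schedule_le : ∀ s ∈ feasibleSchedules n, linearForm c s ≤ 1

/-- The indicator of a row. -/
def rowForm (i₀ : Fin n) : Fin n → Fin n → ℝ := fun i _ => if i = i₀ then 1 else 0

/-- The indicator of a column. -/
def colForm (j₀ : Fin n) : Fin n → Fin n → ℝ := fun _ j => if j = j₀ then 1 else 0

lemma linearForm_rowForm (i₀ : Fin n) (x : Fin n → Fin n → ℕ) :
    linearForm (rowForm i₀) x = ∑ j, (x i₀ j : ℝ) := by
  simp only [linearForm, rowForm]
  rw [Finset.sum_eq_single i₀ (by intro b _ hb; simp [hb]) (by simp)]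
  simp

lemma linearForm_colForm (j₀ : Fin n) (x : Fin n → Fin n → ℕ) :
    linearForm (colForm j₀) x = ∑ i, (x i j₀ : ℝ) := by
  simp [linearForm, colForm]

lemma linearForm_one (x : Fin n → Fin n → ℕ) :
    linearForm (fun _ _ => 1) x = ∑ i, ∑ j, (x i j : ℝ) := by
  simp [linearForm]

lemma isLine_rowForm (i₀ : Fin n) : IsLine (rowForm i₀) where
  zero_or_one i j := by unfold rowForm; split_ifs <;> simp
  sum_eq := by
    simp only [rowForm]
    rw [Finset.sum_eq_single i₀ (by intro b _ hb; simp [hb]) (by simp)]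
    simp
  schedule_le s hs := by
    rw [linearForm_rowForm]
    exact_mod_cast hs.2.2 i₀

lemma isLine_colForm (j₀ : Fin n) : IsLine (colForm j₀) where
  zero_or_one i j := by unfold colForm; split_ifs <;> simp
  sum_eq := by simp [colForm]
  schedule_le s hs := by
    rw [linearForm_colForm]
    exact_mod_cast hs.2.1 j₀

lemma IsLine.nonneg {c : Fin n → Fin n → ℝ} (hc : IsLine c) (i j : Fin n) : 0 ≤ c i j := by
  rcases hc.zero_or_one i j with h | h <;> simp [h]

lemma IsLine.departures_le {c : Fin n → Fin n → ℝ} (hc : IsLine c) (w : Slot n) :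
    linearForm c (departures w) ≤ 1 := by
  refine le_trans ?_ (hc.schedule_le w.1.2 w.1.2.2)
  refine Finset.sum_le_sum fun i _ => Finset.sum_le_sum fun j _ =>
    mul_le_mul_of_nonneg_left ?_ (hc.nonneg i j)
  exact_mod_cast min_le_left _ _

/-- A line has zero or one departure, hence an idempotent count. This turns its second moment into
its first, which stationarity fixes. -/
lemma IsLine.departures_sq {c : Fin n → Fin n → ℝ} (hc : IsLine c) (w : Slot n) :
    linearForm c (departures w) ^ 2 = linearForm c (departures w) := by
  obtain ⟨m, hm⟩ : ∃ m : ℕ, linearForm c (departures w) = m := by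
    choose e he using fun i j => show ∃ e : ℕ, c i j = e from by
      rcases hc.zero_or_one i j with h | h
      · exact ⟨0, by simp [h]⟩
      · exact ⟨1, by simp [h]⟩
    exact ⟨∑ i, ∑ j, e i j * departures w i j, by simp [linearForm, he]⟩
  have h1 := hc.departures_le w
  rw [hm] at h1 ⊢
  have h2 : m ≤ 1 := by exact_mod_cast h1
  interval_cases m <;> norm_num

variable {p : unitInterval} {A : Policy n} {π : PMF (QueueState n)}

lemma integral_slotLaw_arrival (f : (Fin n → Fin n → ℕ) → ℝ) :
    ∫ w, f w.2 ∂slotLaw p A π = ∫ a, f a ∂(arrivalLaw n p).toMeasure := by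
  rw [slotLaw, integral_fun_snd (μ := (queueScheduleLaw A π).toMeasure)
    (ν := (arrivalLaw n p).toMeasure) (f := f)]
  simp

/-- The balance of the second moments along a line. -/
lemma IsLine.balance {c : Fin n → Fin n → ℝ} (hc : IsLine c) (hn : 0 < n)
    (hT : meanTotalQueue π ≠ ∞) (hπ : IsStationary (transition p A) π) :
    ∃ r : ℝ, 0 ≤ r ∧ r ≤ 2 * n * (1 - n * p) ∧
      2 * (1 - n * (p : ℝ)) * ∫ w, linearForm c w.1.1 ∂slotLaw p A π =
        2 * ∫ w, linearForm c w.1.1 * (1 - linearForm c (departures w)) ∂slotLaw p A π +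
          (n * (p : ℝ)) ^ 2 * (1 - 1 / n) + r := by
  have hn' : (n : ℝ) ≠ 0 := by positivity
  have h0 := hc.nonneg
  have bd : ∀ (F : ℝ → ℝ → ℝ), (∀ S : ℝ, ∃ C, ∀ x y, 0 ≤ x → x ≤ S → 0 ≤ y → y ≤ S →
      |F x y| ≤ C) → Integrable (fun w : Slot n => F (linearForm c w.2)
        (linearForm c (departures w))) (slotLaw p A π) ∧
      Integrable (fun w : Slot n => linearForm c w.1.1 *
        F (linearForm c w.2) (linearForm c (departures w))) (slotLaw p A π) :=
    fun F hF => integrable_linearForms hT h0 F hF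
  have iL : Integrable (fun w : Slot n => linearForm c w.1.1) (slotLaw p A π) := by
    simpa using (bd (fun _ _ => 1) fun S => ⟨1, fun x y _ _ _ _ => by simp⟩).2
  have iLD := (bd (fun _ y => 1 - y) fun S => ⟨1 + S, fun x y _ _ hy hyS => by
    rw [abs_le]; constructor <;> linarith⟩).2
  have iD := (bd (fun _ y => y) fun S => ⟨S, fun x y _ _ hy hyS => by
    rwa [abs_of_nonneg hy]⟩).1
  have iA := (bd (fun x _ => x) fun S => ⟨S, fun x y hx hxS _ _ => by
    rwa [abs_of_nonneg hx]⟩).1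
  have iA2 := (bd (fun x _ => x ^ 2) fun S => ⟨S ^ 2, fun x y hx hxS _ _ => by
    rw [abs_of_nonneg (sq_nonneg _)]; nlinarith⟩).1
  have iAD := (bd (fun x y => x * (1 - y)) fun S => ⟨S * (1 + S), fun x y hx hxS hy hyS => by
    rw [abs_mul, abs_of_nonneg hx]
    refine mul_le_mul hxS ?_ (abs_nonneg _) (hx.trans hxS)
    rw [abs_le]; constructor <;> linarith⟩).1
  have hD := integral_linearForm_departures hT hπ h0
  have hB := integral_linearForm_balance hT hπ h0
  rw [hc.sum_eq] at hD hB
  have hA1 : ∫ w, linearForm c w.2 ∂slotLaw p A π = p * n := by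
    rw [integral_slotLaw_arrival, ← hc.sum_eq]
    exact integral_linear_arrival p c
  have hA2 : ∫ w, linearForm c w.2 ^ 2 ∂slotLaw p A π = p * (1 - p) * n + (p * n) ^ 2 := by
    rw [integral_slotLaw_arrival fun a => linearForm c a ^ 2]
    have := integral_sq_linear_arrival p c
    have e : ∑ i, ∑ j, c i j ^ 2 = n := by
      rw [← hc.sum_eq]
      refine Finset.sum_congr rfl fun i _ => Finset.sum_congr rfl fun j _ => ?_
      rcases hc.zero_or_one i j with h | h <;> simp [h]
    rw [e, hc.sum_eq] at this
    exact this
  -- `r` is the correlation of arrivals with idleness of the line. Arrivals are at most `n`, and the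
  -- line is idle with probability `1 - n p`.
  refine ⟨2 * ∫ w, linearForm c w.2 * (1 - linearForm c (departures w)) ∂slotLaw p A π, ?_, ?_, ?_⟩
  · refine mul_nonneg zero_le_two (integral_nonneg fun w => mul_nonneg (linearForm_nonneg h0 _) ?_)
    linarith [hc.departures_le w]
  · have : ∫ w, linearForm c w.2 * (1 - linearForm c (departures w)) ∂slotLaw p A π ≤
        ∫ w, n * (1 - linearForm c (departures w)) ∂slotLaw p A π := by
      refine integral_mono_ae iAD (((integrable_const 1).sub iD).const_mul _) ?_
      filter_upwards [ae_slotLaw_arrival p A π] with w hw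
      refine mul_le_mul_of_nonneg_right ?_ (by linarith [hc.departures_le w])
      rw [← hc.sum_eq]
      exact linearForm_le_of_le_one h0 hw
    rw [integral_const_mul, integral_sub (integrable_const _) iD, hD] at this
    simp only [integral_const, probReal_univ, smul_eq_mul, one_mul] at this
    calc _ ≤ 2 * ((n : ℝ) * (1 - p * n)) := by gcongr
      _ = _ := by ring
  · have e1 : ∀ w : Slot n, (linearForm c w.2 - linearForm c (departures w)) ^ 2 =
        linearForm c w.2 ^ 2 - 2 * linearForm c w.2 +
          2 * (linearForm c w.2 * (1 - linearForm c (departures w))) +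
          linearForm c (departures w) := fun w => by
      have := hc.departures_sq w
      linear_combination this
    have e2 : ∀ w : Slot n, linearForm c w.1.1 * (linearForm c (departures w) - p * n) =
        (1 - p * n) * linearForm c w.1.1 -
          linearForm c w.1.1 * (1 - linearForm c (departures w)) := fun w => by ring
    have i1 : Integrable (fun w : Slot n => linearForm c w.2 ^ 2 - 2 * linearForm c w.2)
      (slotLaw p A π) := iA2.sub (iA.const_mul 2)
    have i2 : Integrable (fun w : Slot n => linearForm c w.2 ^ 2 - 2 * linearForm c w.2 +
      2 * (linearForm c w.2 * (1 - linearForm c (departures w)))) (slotLaw p A π) :=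
      i1.add (iAD.const_mul 2)
    simp_rw [e1, e2] at hB
    rw [integral_sub (iL.const_mul _) iLD, integral_const_mul, integral_add i2 iD,
      integral_add i1 (iAD.const_mul 2), integral_sub iA2 (iA.const_mul 2), integral_const_mul,
      integral_const_mul, hD, hA1, hA2] at hB
    have e3 : ((n : ℝ) * p) ^ 2 * (1 - 1 / n) = (n * p) ^ 2 - n * (p : ℝ) ^ 2 := by
      field_simp
    rw [e3]
    linear_combination hB

lemma totalQueue_eq_sum_rows (q : QueueState n) :
    (totalQueue q : ℝ) = ∑ i, linearForm (rowForm i) q := by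
  simp [linearForm_rowForm, totalQueue]

lemma totalQueue_eq_sum_cols (q : QueueState n) :
    (totalQueue q : ℝ) = ∑ j, linearForm (colForm j) q := by
  simp only [linearForm_colForm, totalQueue]
  rw [Finset.sum_comm]
  push_cast
  rfl

lemma IsLine.integrable {c : Fin n → Fin n → ℝ} (hc : IsLine c) (hT : meanTotalQueue π ≠ ∞) :
    Integrable (fun w : Slot n => linearForm c w.1.1) (slotLaw p A π) := by
  simpa using (integrable_linearForms (p := p) (A := A) hT hc.nonneg (fun _ _ => 1)
    fun S => ⟨1, fun x y _ _ _ _ => by simp⟩).2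

/-- The lower bound on the mean total queue length under an arbitrary policy. -/
theorem IsStationary.le_meanTotalQueue (hn : 0 < n) (hp : n * (p : ℝ) < 1)
    (hπ : IsStationary (transition p A) π) :
    ENNReal.ofReal ((n * p) ^ 2 * (n - 1) / (2 * (1 - n * p))) ≤ meanTotalQueue π := by
  by_cases hT : meanTotalQueue π = ∞
  · simp [hT]
  rw [ENNReal.ofReal_le_iff_le_toReal hT, ← integral_totalQueue (p := p) (A := A),
    div_le_iff₀ (by linarith)]
  simp_rw [totalQueue_eq_sum_rows]
  rw [integral_finsetSum _ fun i _ => (isLine_rowForm i).integrable hT, mul_comm (Finset.sum _ _),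
    Finset.mul_sum]
  -- The discarded terms, the correlation of queue length and idleness and the remainder `r`, are
  -- nonnegative.
  have : ∀ i : Fin n, ((n : ℝ) * p) ^ 2 * (1 - 1 / n) ≤
      2 * (1 - n * p) * ∫ w, linearForm (rowForm i) w.1.1 ∂slotLaw p A π := fun i => by
    obtain ⟨r, hr, -, h⟩ := (isLine_rowForm i).balance hn hT hπ
    have h1 : 0 ≤ ∫ w, linearForm (rowForm i) w.1.1 *
        (1 - linearForm (rowForm i) (departures w)) ∂slotLaw p A π :=
      integral_nonneg fun w => mul_nonneg (linearForm_nonneg (isLine_rowForm i).nonneg _)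
        (by linarith [(isLine_rowForm i).departures_le w])
    linarith
  have h2 := Finset.sum_le_sum fun i (_ : i ∈ Finset.univ) => this i
  refine le_trans (le_of_eq ?_) h2
  have hn' : (n : ℝ) ≠ 0 := by positivity
  simp
  field_simp

end Lines

/-! ### State space collapse -/

section Collapse

variable {n : ℕ}

/-- A dual description of the cone of the matrices `k i j = v i + w j` with nonnegative `v`, `w`. -/
structure InCone (k : Fin n → Fin n → ℝ) : Prop where
  nonneg : ∀ i j, 0 ≤ k i j
  exchange : ∀ i j l m, k i j + k l m = k i m + k l j
  schedule_le : ∀ s ∈ feasibleSchedules n, ∑ i, ∑ j, k i j * s i j ≤ (∑ i, ∑ j, k i j) / n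

lemma inCone_rowForm (i₀ : Fin n) : InCone (rowForm i₀) where
  nonneg := (isLine_rowForm i₀).nonneg
  exchange i j l m := by simp [rowForm]
  schedule_le s hs := by
    have hn : (n : ℝ) ≠ 0 := by have := i₀.pos; positivity
    rw [(isLine_rowForm i₀).sum_eq, div_self hn]
    exact (isLine_rowForm i₀).schedule_le s hs

lemma inCone_colForm (j₀ : Fin n) : InCone (colForm j₀) where
  nonneg := (isLine_colForm j₀).nonneg
  exchange i j l m := by simp only [colForm]; ring
  schedule_le s hs := by
    have hn : (n : ℝ) ≠ 0 := by have := j₀.pos; positivity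
    rw [(isLine_colForm j₀).sum_eq, div_self hn]
    exact (isLine_colForm j₀).schedule_le s hs

lemma inCone_zero : InCone (fun _ _ : Fin n => (0 : ℝ)) where
  nonneg _ _ := le_rfl
  exchange _ _ _ _ := rfl
  schedule_le _ _ := by simp

lemma InCone.add {k l : Fin n → Fin n → ℝ} (hk : InCone k) (hl : InCone l) :
    InCone fun i j => k i j + l i j where
  nonneg i j := add_nonneg (hk.nonneg i j) (hl.nonneg i j)
  exchange a b c d := by have := hk.exchange a b c d; have := hl.exchange a b c d; linarith
  schedule_le s hs := by
    simp only [add_mul, Finset.sum_add_distrib, add_div]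
    exact add_le_add (hk.schedule_le s hs) (hl.schedule_le s hs)

lemma InCone.smul {k : Fin n → Fin n → ℝ} (hk : InCone k) {t : ℝ} (ht : 0 ≤ t) :
    InCone fun i j => t * k i j where
  nonneg i j := mul_nonneg ht (hk.nonneg i j)
  exchange a b c d := by have := hk.exchange a b c d; linear_combination t * this
  schedule_le s hs := by
    simp only [mul_assoc, ← Finset.mul_sum, mul_div_assoc]
    exact mul_le_mul_of_nonneg_left (hk.schedule_le s hs) ht

/-- The projection onto the cone. -/
lemma exists_proj (x : Fin n → Fin n → ℝ) : ∃ k : Fin n → Fin n → ℝ, InCone k ∧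
    ∑ i, ∑ j, (x i j - k i j) * k i j = 0 ∧
    ∀ l, InCone l → ∑ i, ∑ j, (x i j - k i j) * l i j ≤ 0 := by
  let K : Set (EuclideanSpace ℝ (Fin n × Fin n)) := {v | InCone fun i j => v (i, j)}
  have hconv : Convex ℝ K := by
    intro u hu v hv a b ha hb _
    exact (InCone.smul hu ha).add (InCone.smul hv hb)
  have hne : K.Nonempty := ⟨0, inCone_zero⟩
  have hcoord : ∀ i j, Continuous fun v : EuclideanSpace ℝ (Fin n × Fin n) => v (i, j) :=
    fun i j => by fun_prop
  have hclosed : IsClosed K := by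
    -- The dual description exhibits the cone as an intersection of closed half-spaces and
    -- hyperplanes, so closedness needs no representation by `v` and `w`.
    have : K = (⋂ i, ⋂ j, {v : EuclideanSpace ℝ (Fin n × Fin n) | 0 ≤ v (i, j)}) ∩
        (⋂ i, ⋂ j, ⋂ l, ⋂ m,
          {v : EuclideanSpace ℝ (Fin n × Fin n) | v (i, j) + v (l, m) = v (i, m) + v (l, j)}) ∩
        (⋂ s ∈ feasibleSchedules n,
          {v : EuclideanSpace ℝ (Fin n × Fin n) |
            ∑ i, ∑ j, v (i, j) * s i j ≤ (∑ i, ∑ j, v (i, j)) / n}) := by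
      ext v
      simp only [Set.mem_inter_iff, Set.mem_iInter]
      exact ⟨fun h => ⟨⟨h.nonneg, h.exchange⟩, h.schedule_le⟩, fun h => ⟨h.1.1, h.1.2, h.2⟩⟩
    rw [this]
    refine ((isClosed_iInter fun i => isClosed_iInter fun j => ?_).inter
      (isClosed_iInter fun i => isClosed_iInter fun j => isClosed_iInter fun l =>
        isClosed_iInter fun m => ?_)).inter (isClosed_biInter fun s _ => ?_)
    · exact isClosed_le continuous_const (hcoord i j)
    · exact isClosed_eq ((hcoord _ _).add (hcoord _ _)) ((hcoord _ _).add (hcoord _ _))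
    · exact isClosed_le
        (continuous_finsetSum _ fun i _ => continuous_finsetSum _ fun j _ =>
          (hcoord i j).mul continuous_const)
        ((continuous_finsetSum _ fun i _ => continuous_finsetSum _ fun j _ =>
          hcoord i j).div_const _)
  let u : EuclideanSpace ℝ (Fin n × Fin n) := WithLp.toLp 2 fun z => x z.1 z.2
  obtain ⟨v, hvK, hv⟩ := exists_norm_eq_iInf_of_complete_convex hne hclosed.isComplete hconv u
  have hproj := (norm_eq_iInf_iff_real_inner_le_zero hconv hvK).1 hv
  have hin : ∀ w : EuclideanSpace ℝ (Fin n × Fin n), inner ℝ (u - v) w =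
      ∑ i, ∑ j, (x i j - v (i, j)) * w (i, j) := fun w => by
    rw [PiLp.inner_apply, Fintype.sum_prod_type]
    refine Finset.sum_congr rfl fun i _ => Finset.sum_congr rfl fun j _ => ?_
    simp only [u, PiLp.sub_apply, RCLike.inner_apply, conj_trivial]
    ring
  -- Testing the variational inequality at `2 v` and at `0` gives orthogonality; testing it at `v +
  -- l` gives polarity.
  have h2 : inner ℝ (u - v) v ≤ 0 := by
    have := hproj ((2 : ℝ) • v) (InCone.smul hvK zero_le_two)
    rwa [two_smul, add_sub_cancel_right] at this
  have h0 : 0 ≤ inner ℝ (u - v) v := by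
    have := hproj 0 inCone_zero
    rw [zero_sub, inner_neg_right] at this
    linarith
  refine ⟨fun i j => v (i, j), hvK, ?_, fun l hl => ?_⟩
  · rw [← hin]; exact le_antisymm h2 h0
  · have := hproj (v + WithLp.toLp 2 fun z => l z.1 z.2) (InCone.add hvK hl)
    rwa [add_sub_cancel_left, hin] at this

/-- The component of the queue length vector that lies in the cone. -/
def conePart (q : QueueState n) : Fin n → Fin n → ℝ := (exists_proj fun i j => (q i j : ℝ)).choose

/-- The component of the queue length vector that is polar to the cone. -/
def polarPart (q : QueueState n) (i j : Fin n) : ℝ := q i j - conePart q i j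

/-- The squared distance to the cone. -/
def sqDist (q : QueueState n) : ℝ := ∑ i, ∑ j, polarPart q i j ^ 2

lemma inCone_conePart (q : QueueState n) : InCone (conePart q) :=
  (exists_proj fun i j => (q i j : ℝ)).choose_spec.1

lemma sum_polarPart_mul_conePart (q : QueueState n) :
    ∑ i, ∑ j, polarPart q i j * conePart q i j = 0 :=
  (exists_proj fun i j => (q i j : ℝ)).choose_spec.2.1

lemma sum_polarPart_mul_le (q : QueueState n) {l : Fin n → Fin n → ℝ} (hl : InCone l) :
    ∑ i, ∑ j, polarPart q i j * l i j ≤ 0 :=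
  (exists_proj fun i j => (q i j : ℝ)).choose_spec.2.2 l hl

lemma sqDist_nonneg (q : QueueState n) : 0 ≤ sqDist q :=
  Finset.sum_nonneg fun _ _ => Finset.sum_nonneg fun _ _ => sq_nonneg _

/-- The projection is the nearest point of the cone. In the drift estimate this allows the
projection of the old state to serve as a competitor for the new one. -/
lemma sqDist_le (q : QueueState n) {l : Fin n → Fin n → ℝ} (hl : InCone l) :
    sqDist q ≤ ∑ i, ∑ j, ((q i j : ℝ) - l i j) ^ 2 := by
  have e : ∑ i, ∑ j, ((q i j : ℝ) - l i j) ^ 2 = sqDist q +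
      2 * ∑ i, ∑ j, polarPart q i j * conePart q i j - 2 * ∑ i, ∑ j, polarPart q i j * l i j +
      ∑ i, ∑ j, (conePart q i j - l i j) ^ 2 := by
    simp only [sqDist, Finset.mul_sum, ← Finset.sum_add_distrib, ← Finset.sum_sub_distrib]
    refine Finset.sum_congr rfl fun i _ => Finset.sum_congr rfl fun j _ => ?_
    rw [polarPart]; ring
  have h1 := sum_polarPart_mul_conePart q
  have h2 := sum_polarPart_mul_le q hl
  have h3 : 0 ≤ ∑ i, ∑ j, (conePart q i j - l i j) ^ 2 :=
    Finset.sum_nonneg fun _ _ => Finset.sum_nonneg fun _ _ => sq_nonneg _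
  linarith

lemma sum_mul_sq_le (f g : Fin n → Fin n → ℝ) :
    (∑ i, ∑ j, f i j * g i j) ^ 2 ≤ (∑ i, ∑ j, f i j ^ 2) * ∑ i, ∑ j, g i j ^ 2 := by
  simp only [← Fintype.sum_prod_type']
  exact Finset.sum_mul_sq_le_sq_mul_sq _ _ _

lemma abs_polarPart_le (q : QueueState n) (i j : Fin n) : |polarPart q i j| ≤ √(sqDist q) := by
  refine Real.abs_le_sqrt ?_
  calc polarPart q i j ^ 2 ≤ ∑ j, polarPart q i j ^ 2 :=
        Finset.single_le_sum (f := fun j => polarPart q i j ^ 2)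
          (fun _ _ => sq_nonneg _) (Finset.mem_univ j)
    _ ≤ sqDist q := Finset.single_le_sum (f := fun i => ∑ j, polarPart q i j ^ 2)
        (fun _ _ => Finset.sum_nonneg fun _ _ => sq_nonneg _) (Finset.mem_univ i)

/-- The weight of a MaxWeight schedule exceeds the average weight by a multiple of the distance to
the cone. -/
lemma add_sqrt_sqDist_le_weight {q : QueueState n} {s : Fin n → Fin n → ℕ}
    (hs : ∀ s' ∈ feasibleSchedules n, weight q s' ≤ weight q s) :
    (totalQueue q + √(sqDist q)) / n ≤ weight q s := by
  rcases Nat.eq_zero_or_pos n with rfl | hn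
  · simp
  have hn' : (0 : ℝ) < n := by positivity
  set y := √(sqDist q) with hy
  have hy0 : 0 ≤ y := Real.sqrt_nonneg _
  rcases hy0.eq_or_lt with h | hypos
  · rw [← h, add_zero]; exact totalQueue_div_le_weight hs
  have hrow : ∀ i, ∑ j, polarPart q i j ≤ 0 := fun i => by
    have := sum_polarPart_mul_le q (inCone_rowForm i)
    simp only [rowForm] at this
    rw [Finset.sum_eq_single i (by intro b _ hb; simp [hb]) (by simp)] at this
    simpa using this
  have hcol : ∀ j, ∑ i, polarPart q i j ≤ 0 := fun j => by
    have := sum_polarPart_mul_le q (inCone_colForm j)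
    simpa [colForm] using this
  -- The uniform matrix is tilted in the direction of the polar part. It stays nonnegative since
  -- every entry of the polar part is at most `y` in absolute value, and its line sums stay at most
  -- one since rows and columns lie in the cone. The tilt gains `⟨q, polarPart q⟩ / (n y) = y / n`.
  have hP := sum_mul_le_weight hs (P := fun i j => (1 + polarPart q i j / y) / n)
    (fun i j => by
      have h1 := abs_le.1 (abs_polarPart_le q i j)
      have : -1 ≤ polarPart q i j / y := by rw [le_div_iff₀ hypos]; linarith [h1.1]
      exact div_nonneg (by linarith) hn'.le)
    (fun i => by
      rw [← Finset.sum_div, Finset.sum_add_distrib, ← Finset.sum_div, div_le_one hn']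
      have := div_nonpos_of_nonpos_of_nonneg (hrow i) hy0
      simpa using this)
    (fun j => by
      rw [← Finset.sum_div, Finset.sum_add_distrib, ← Finset.sum_div, div_le_one hn']
      have := div_nonpos_of_nonpos_of_nonneg (hcol j) hy0
      simpa using this)
  refine le_trans (le_of_eq ?_) hP
  have hq : ∑ i, ∑ j, (q i j : ℝ) * polarPart q i j = y ^ 2 := by
    rw [hy, Real.sq_sqrt (sqDist_nonneg q), sqDist, ← sub_eq_zero, ← sum_polarPart_mul_conePart q]
    simp only [← Finset.sum_sub_distrib]
    refine Finset.sum_congr rfl fun i _ => Finset.sum_congr rfl fun j _ => ?_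
    rw [polarPart]; ring
  have e : ∑ i, ∑ j, (q i j : ℝ) * ((1 + polarPart q i j / y) / n) =
      (∑ i, ∑ j, (q i j : ℝ) + (∑ i, ∑ j, (q i j : ℝ) * polarPart q i j) / y) / n := by
    simp only [Finset.sum_div, ← Finset.sum_add_distrib]
    refine Finset.sum_congr rfl fun i _ => Finset.sum_congr rfl fun j _ => ?_
    ring
  rw [e, hq, totalQueue]
  push_cast
  field_simp

variable {p : unitInterval} {A : Policy n}

/-- Keeping the old projection, the squared distance changes by at most `2 G + B`, with `G` the
inner product of the polar part with `a - s` and `B` the total of `a + s`. Squaring once more and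
using `G ^ 2 ≤ sqDist q * B` gives the coefficients. -/
lemma sqDist_nextQueue_sq_le (q : QueueState n) (s : feasibleSchedules n)
    {a : Fin n → Fin n → ℕ} (ha : ∀ i j, a i j ≤ 1) :
    sqDist (nextQueue q a s) ^ 2 ≤ sqDist q ^ 2 +
      4 * sqDist q * ∑ i, ∑ j, polarPart q i j * ((a i j : ℝ) - (s : Fin n → Fin n → ℕ) i j) +
      (10 * sqDist q + 4 * n ^ 2) * ∑ i, ∑ j, ((a i j : ℝ) + (s : Fin n → Fin n → ℕ) i j) := by
  set Y := sqDist q with hY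
  have hY0 : 0 ≤ Y := sqDist_nonneg q
  set G := ∑ i, ∑ j, polarPart q i j * ((a i j : ℝ) - (s : Fin n → Fin n → ℕ) i j) with hG
  set B := ∑ i, ∑ j, ((a i j : ℝ) + (s : Fin n → Fin n → ℕ) i j) with hB
  have hB0 : 0 ≤ B := Finset.sum_nonneg fun _ _ => Finset.sum_nonneg fun _ _ => by positivity
  have step : sqDist (nextQueue q a s) ≤ Y + 2 * G + B := by
    refine (sqDist_le _ (inCone_conePart q)).trans ?_
    simp only [hY, hG, hB, sqDist, Finset.mul_sum, ← Finset.sum_add_distrib]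
    refine Finset.sum_le_sum fun i _ => Finset.sum_le_sum fun j _ => ?_
    have hk := (inCone_conePart q).nonneg i j
    have hs1 := feasible_le_one s i j
    have ha1 := ha i j
    have hsq := sq_sub_le_add ha1 hs1
    simp only [nextQueue, polarPart]
    rcases le_total ((s : Fin n → Fin n → ℕ) i j) (q i j + a i j) with h | h
    · rw [Nat.cast_sub h]; push_cast; nlinarith
    · by_cases h2 : (s : Fin n → Fin n → ℕ) i j = q i j + a i j
      · rw [h2] at hsq ⊢
        push_cast at hsq ⊢
        simp only [Nat.sub_self]
        push_cast
        nlinarith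
      -- Truncation at an empty queue only helps: the cone part is nonnegative, so `0` is closer to
      -- it than `-1`.
      · have e1 : q i j = 0 := by omega
        have e2 : a i j = 0 := by omega
        have e3 : (s : Fin n → Fin n → ℕ) i j = 1 := by omega
        simp only [e1, e2, e3]
        norm_num
        nlinarith
  have hG2 : G ^ 2 ≤ Y * B := by
    refine (sum_mul_sq_le _ _).trans (mul_le_mul_of_nonneg_left ?_ hY0)
    exact Finset.sum_le_sum fun i _ => Finset.sum_le_sum fun j _ =>
      sq_sub_le_add (ha i j) (feasible_le_one s i j)
  have hBn : B ≤ 2 * n ^ 2 := by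
    have : B ≤ ∑ _i : Fin n, ∑ _j : Fin n, (2 : ℝ) := by
      refine Finset.sum_le_sum fun i _ => Finset.sum_le_sum fun j _ => ?_
      have h1 : (a i j : ℝ) ≤ 1 := by exact_mod_cast ha i j
      have h2 : ((s : Fin n → Fin n → ℕ) i j : ℝ) ≤ 1 := by exact_mod_cast feasible_le_one s i j
      linarith
    refine this.trans (le_of_eq ?_)
    simp
    ring
  have h1 : sqDist (nextQueue q a s) ^ 2 ≤ (Y + 2 * G + B) ^ 2 :=
    pow_le_pow_left₀ (sqDist_nonneg _) step 2
  have h2 : B ^ 2 ≤ 2 * n ^ 2 * B := by nlinarith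
  -- The hint gives `4 G B ≤ 4 G ^ 2 + B ^ 2`; then `8 G ^ 2 ≤ 8 Y B` and `2 B ^ 2 ≤ 4 n ^ 2 B`
  -- produce `10 Y + 4 n ^ 2`.
  nlinarith [sq_nonneg (2 * G - B)]

lemma sum_feasible_eq (s : feasibleSchedules n) (a : Fin n → Fin n → ℕ) :
    ∑ i, ∑ j, ((a i j : ℝ) + (s : Fin n → Fin n → ℕ) i j) =
      linearForm (fun _ _ => 1) a + ∑ i, ∑ j, ((s : Fin n → Fin n → ℕ) i j : ℝ) := by
  simp only [linearForm_one, Finset.sum_add_distrib]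

/-- The drift of the fourth power of the distance to the cone. -/
lemma integral_sqDist_sq_le (hn : 0 < n) (hp : n * (p : ℝ) ≤ 1)
    (hload : n * (1 - n * (p : ℝ)) ≤ 1 / 2) {q : QueueState n} {s : feasibleSchedules n}
    (hs : ∀ s' ∈ feasibleSchedules n, weight q s' ≤ weight q s) :
    ∫ a, sqDist (nextQueue q a s) ^ 2 ∂(arrivalLaw n p).toMeasure ≤
      sqDist q ^ 2 - √(sqDist q) ^ 3 / n + 8008 * n ^ 5 := by
  have hn1 : (1 : ℝ) ≤ n := by exact_mod_cast hn
  set y := √(sqDist q) with hy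
  have hy0 : 0 ≤ y := Real.sqrt_nonneg _
  have hY : sqDist q = y ^ 2 := (Real.sq_sqrt (sqDist_nonneg q)).symm
  set sTot := ∑ i, ∑ j, ((s : Fin n → Fin n → ℕ) i j : ℝ) with hsT
  set zs := ∑ i, ∑ j, polarPart q i j * (s : Fin n → Fin n → ℕ) i j with hzs
  set Z := ∑ i, ∑ j, polarPart q i j with hZ
  have hmean : ∫ a, sqDist (nextQueue q a s) ^ 2 ∂(arrivalLaw n p).toMeasure ≤
      y ^ 4 + 4 * y ^ 2 * (p * Z - zs) + (10 * y ^ 2 + 4 * n ^ 2) * (p * n ^ 2 + sTot) := by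
    have hpt : ∀ᵐ a ∂(arrivalLaw n p).toMeasure, sqDist (nextQueue q a s) ^ 2 ≤
        (y ^ 4 - 4 * y ^ 2 * zs + (10 * y ^ 2 + 4 * n ^ 2) * sTot) +
          (4 * y ^ 2 * linearForm (polarPart q) a +
            (10 * y ^ 2 + 4 * n ^ 2) * linearForm (fun _ _ => 1) a) := by
      filter_upwards [ae_arrival_le_one p] with a ha
      refine (sqDist_nextQueue_sq_le q s ha).trans (le_of_eq ?_)
      rw [sum_feasible_eq, hY]
      have : ∑ i, ∑ j, polarPart q i j * ((a i j : ℝ) - (s : Fin n → Fin n → ℕ) i j) =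
          linearForm (polarPart q) a - zs := by
        simp only [linearForm, hzs, mul_sub, Finset.sum_sub_distrib]
      rw [this]
      ring
    refine (integral_mono_ae (integrable_arrival p _) (integrable_arrival p _) hpt).trans ?_
    rw [integral_add (integrable_const _) (integrable_arrival p _),
      integral_add (f := fun a => 4 * y ^ 2 * linearForm (polarPart q) a)
        (g := fun a => (10 * y ^ 2 + 4 * n ^ 2) * linearForm (fun _ _ => 1) a)
        (integrable_arrival p _) (integrable_arrival p _), integral_const_mul,
      integral_const_mul]
    have e1 : ∫ a, linearForm (polarPart q) a ∂(arrivalLaw n p).toMeasure = p * Z :=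
      integral_linear_arrival p _
    have e2 : ∫ a, linearForm (fun _ _ => 1) a ∂(arrivalLaw n p).toMeasure =
        p * ∑ _i : Fin n, ∑ _j : Fin n, (1 : ℝ) := integral_linear_arrival p _
    rw [e1, e2]
    simp only [integral_const, probReal_univ, smul_eq_mul, one_mul, Finset.sum_const,
      Finset.card_univ, Fintype.card_fin, nsmul_eq_mul, mul_one]
    apply le_of_eq
    ring
  have hsn : sTot ≤ n := feasible_sum_le s
  have hB : p * (n : ℝ) ^ 2 + sTot ≤ 2 * n := by nlinarith
  -- The cone part has weight at most its average under any schedule, so the whole gain `y / n` of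
  -- MaxWeight falls on the polar part.
  have hgap : (Z + y) / n ≤ zs := by
    have h1 := add_sqrt_sqDist_le_weight hs
    have h2 := (inCone_conePart q).schedule_le s s.2
    have e1 : Z = totalQueue q - ∑ i, ∑ j, conePart q i j := by
      rw [hZ, totalQueue]; push_cast; simp only [polarPart, Finset.sum_sub_distrib]
    have e2 : zs = weight q s - ∑ i, ∑ j, conePart q i j * (s : Fin n → Fin n → ℕ) i j := by
      rw [hzs, weight]; push_cast; simp only [polarPart, sub_mul, Finset.sum_sub_distrib]
    rw [e1, e2]
    have : (totalQueue q - ∑ i, ∑ j, conePart q i j + y) / (n : ℝ) =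
      (totalQueue q + y) / n - (∑ i, ∑ j, conePart q i j) / n := by ring
    rw [this]
    linarith
  have hZy : -(n * y) ≤ Z := by
    have h1 := sum_mul_sq_le (polarPart q) (fun _ _ => 1)
    have h2 : Z ^ 2 ≤ (n * y) ^ 2 := by
      have e : (∑ _i : Fin n, ∑ _j : Fin n, (1 : ℝ) ^ 2) = n ^ 2 := by simp; ring
      rw [e] at h1
      simp only [mul_one] at h1
      have : (n * y) ^ 2 = sqDist q * n ^ 2 := by rw [hY]; ring
      rw [this]
      exact h1
    exact (abs_le.1 (abs_le_of_sq_le_sq h2 (by positivity))).1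
  -- The load condition ensures that the slack `1 / n - p` costs at most half of the gain.
  have hG : p * Z - zs ≤ -(y / (2 * n)) := by
    have hε : 0 ≤ 1 / (n : ℝ) - p := by
      rw [sub_nonneg, le_div_iff₀ (by positivity)]; linarith
    have h1 : p * Z - zs ≤ -((1 / n - (p : ℝ)) * Z) - y / n := by
      have : (Z + y) / n = 1 / n * Z + y / n := by ring
      rw [this] at hgap
      linarith
    have h2 : -((1 / n - (p : ℝ)) * Z) ≤ (1 / (n : ℝ) - p) * (n * y) := by nlinarith
    have h3 : (1 / (n : ℝ) - p) * (n * y) = (n * (1 - n * (p : ℝ))) * (y / n) := by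
      field_simp
    have h4 : (n * (1 - n * (p : ℝ))) * (y / n) ≤ 1 / 2 * (y / n) :=
      mul_le_mul_of_nonneg_right hload (by positivity)
    have h5 : y / (2 * n) = 1 / 2 * (y / n) := by field_simp
    rw [h5]
    linarith
  have main : ∫ a, sqDist (nextQueue q a s) ^ 2 ∂(arrivalLaw n p).toMeasure ≤
      y ^ 4 - 2 * (y ^ 3 / n) + 20 * n * y ^ 2 + 8 * n ^ 3 := by
    have h1 : 4 * y ^ 2 * (p * Z - zs) ≤ 4 * y ^ 2 * -(y / (2 * n)) :=
      mul_le_mul_of_nonneg_left hG (by positivity)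
    have h2 : (10 * y ^ 2 + 4 * n ^ 2) * (p * n ^ 2 + sTot) ≤ (10 * y ^ 2 + 4 * n ^ 2) * (2 * n) :=
      mul_le_mul_of_nonneg_left hB (by positivity)
    have h3 : 4 * y ^ 2 * -(y / (2 * n)) = -(2 * (y ^ 3 / n)) := by field_simp; ring
    rw [h3] at h1
    linarith
  -- The two terms cross at `y = 20 n ^ 2`; below it the left side is at most `20 n * (20 n ^ 2) ^ 2
  -- = 8000 n ^ 5`.
  have young : 20 * n * y ^ 2 ≤ y ^ 3 / n + 8000 * n ^ 5 := by
    rcases le_total y (20 * n ^ 2) with h | h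
    · have h1 : y ^ 2 ≤ (20 * n ^ 2) ^ 2 := pow_le_pow_left₀ hy0 h 2
      have : 20 * n * y ^ 2 ≤ 20 * n * (20 * (n : ℝ) ^ 2) ^ 2 :=
        mul_le_mul_of_nonneg_left h1 (by positivity)
      have h3 : 0 ≤ y ^ 3 / n := by positivity
      linarith
    · have h1 : 20 * n * y ^ 2 ≤ y ^ 3 / n := by
        rw [le_div_iff₀ (by positivity)]
        nlinarith [mul_le_mul_of_nonneg_right h (sq_nonneg y)]
      have : (0 : ℝ) ≤ 8000 * n ^ 5 := by positivity
      linarith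
  have h35 : (n : ℝ) ^ 3 ≤ n ^ 5 := pow_le_pow_right₀ hn1 (by norm_num)
  have e4 : sqDist q ^ 2 = y ^ 4 := by rw [hY]; ring
  rw [e4]
  linarith

/-- The third moment of the distance to the cone. -/
theorem tsum_sqrt_sqDist_cube_le (hn : 0 < n) (hp : n * (p : ℝ) ≤ 1)
    (hload : n * (1 - n * (p : ℝ)) ≤ 1 / 2) (hA : IsMaxWeight A) {π : PMF (QueueState n)}
    (hπ : IsStationary (transition p A) π) :
    ∑' q, π q * ENNReal.ofReal (√(sqDist q) ^ 3) ≤ ENNReal.ofReal (8008 * n ^ 6) := by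
  have hn' : (0 : ℝ) < n := by positivity
  have h := hπ.tsum_mul_le (f := fun q => ENNReal.ofReal (sqDist q ^ 2))
    (g := fun q => ENNReal.ofReal (√(sqDist q) ^ 3 / n)) (b := ENNReal.ofReal (8008 * n ^ 5))
    (fun q => ENNReal.ofReal_ne_top) (fun q => by
      have hstep := stepMean_transition_le p A (F := fun q => sqDist q ^ 2)
        (fun q => sq_nonneg _) (fun s hs => integral_sqDist_sq_le hn hp hload (hA q s hs))
      have hc : 0 ≤ sqDist q ^ 2 - √(sqDist q) ^ 3 / n + 8008 * n ^ 5 := by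
        obtain ⟨s, hs⟩ := (A q).support_nonempty
        exact (integral_nonneg fun a => sq_nonneg _).trans
          (integral_sqDist_sq_le hn hp hload (hA q s hs))
      calc _ ≤ ENNReal.ofReal (sqDist q ^ 2 - √(sqDist q) ^ 3 / n + 8008 * n ^ 5) +
            ENNReal.ofReal (√(sqDist q) ^ 3 / n) := by gcongr
        _ = ENNReal.ofReal (sqDist q ^ 2 + 8008 * n ^ 5) := by
            rw [← ENNReal.ofReal_add hc (by positivity)]; congr 1; ring
        _ = _ := ENNReal.ofReal_add (sq_nonneg _) (by positivity))
  have e : ∀ q : QueueState n, π q * ENNReal.ofReal (√(sqDist q) ^ 3) =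
      ENNReal.ofReal n * (π q * ENNReal.ofReal (√(sqDist q) ^ 3 / n)) := fun q => by
    rw [mul_left_comm, ← ENNReal.ofReal_mul hn'.le, mul_div_cancel₀ _ hn'.ne']
  simp_rw [e]
  rw [ENNReal.tsum_mul_left]
  calc _ ≤ ENNReal.ofReal n * ENNReal.ofReal (8008 * n ^ 5) := by gcongr
    _ = _ := by rw [← ENNReal.ofReal_mul hn'.le]; congr 1; ring

lemma integrable_sqrt_sqDist_cube (hn : 0 < n) (hp : n * (p : ℝ) ≤ 1)
    (hload : n * (1 - n * (p : ℝ)) ≤ 1 / 2) (hA : IsMaxWeight A) {π : PMF (QueueState n)}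
    (hπ : IsStationary (transition p A) π) :
    Integrable (fun w : Slot n => √(sqDist w.1.1) ^ 3) (slotLaw p A π) ∧
      ∫ w, √(sqDist w.1.1) ^ 3 ∂slotLaw p A π ≤ 8008 * n ^ 6 := by
  have h := tsum_sqrt_sqDist_cube_le hn hp hload hA hπ
  have e := lintegral_slotLaw_queue p A π fun q => ENNReal.ofReal (√(sqDist q) ^ 3)
  constructor
  · refine ⟨(Measurable.of_discrete).aestronglyMeasurable, ?_⟩
    rw [hasFiniteIntegral_iff_ofReal (Eventually.of_forall fun w => by positivity), e]
    exact h.trans_lt ENNReal.ofReal_lt_top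
  · rw [integral_eq_lintegral_of_nonneg_ae (Eventually.of_forall fun w => by positivity)
      (Measurable.of_discrete).aestronglyMeasurable, e]
    exact ENNReal.toReal_le_of_le_ofReal (by positivity) h

end Collapse

/-! ### The mean total queue length of MaxWeight -/

section MeanBound

variable {n : ℕ}

/-- The number of idle ports. -/
def idle (w : Slot n) : ℝ := n - linearForm (fun _ _ => 1) (departures w)

/-- A MaxWeight schedule leaves no nonempty queue between two ports that it does not use. -/
lemma queue_eq_zero_of_unused {q : QueueState n} {s : Fin n → Fin n → ℕ}
    (hsf : s ∈ feasibleSchedules n) (hs : ∀ s' ∈ feasibleSchedules n, weight q s' ≤ weight q s)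
    {i₀ j₀ : Fin n} (hi : ∑ j, s i₀ j = 0) (hj : ∑ i, s i j₀ = 0) : q i₀ j₀ = 0 := by
  have hrow : ∀ j, s i₀ j = 0 := fun j => (Finset.sum_eq_zero_iff.1 hi) j (Finset.mem_univ _)
  have hcol : ∀ i, s i j₀ = 0 := fun i => (Finset.sum_eq_zero_iff.1 hj) i (Finset.mem_univ _)
  -- Otherwise the queue between the two free ports could be added to the schedule, raising the
  -- weight.
  set e : Fin n → Fin n → ℕ := fun i j => if i = i₀ ∧ j = j₀ then 1 else 0 with he
  have hf : (fun i j => s i j + e i j) ∈ feasibleSchedules n := by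
    refine ⟨fun i j => ?_, fun j => ?_, fun i => ?_⟩
    · have h1 := hsf.1 i j
      simp only [he]
      split_ifs with h
      · right; rw [h.1, hrow]
      · simpa using h1
    · rw [Finset.sum_add_distrib]
      by_cases h : j = j₀
      · rw [h, hj, zero_add]; exact (feasible_single i₀ j₀).2.1 j₀
      · have : ∑ i, e i j = 0 := by simp [he, h]
        rw [this]; exact hsf.2.1 j
    · rw [Finset.sum_add_distrib]
      by_cases h : i = i₀
      · rw [h, hi, zero_add]; exact (feasible_single i₀ j₀).2.2 i₀
      · have : ∑ j, e i j = 0 := by simp [he, h]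
        rw [this]; exact hsf.2.2 i
  have hw := hs _ hf
  have hadd : weight q (fun i j => s i j + e i j) = weight q s + weight q e := by
    simp only [weight, mul_add, Finset.sum_add_distrib]
  rw [hadd, weight_single] at hw
  omega

/-- The idle ports can be (fractionally) matched through empty queues. -/
lemma exists_idle_matching (w : Slot n)
    (hs : ∀ s' ∈ feasibleSchedules n, weight w.1.1 s' ≤ weight w.1.1 w.1.2) :
    ∃ m : Fin n → Fin n → ℝ, (∀ i j, 0 ≤ m i j) ∧ (∀ i j, m i j ≤ 1) ∧
      (∀ i, ∑ j, m i j = 1 - linearForm (rowForm i) (departures w)) ∧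
      (∀ j, ∑ i, m i j = 1 - linearForm (colForm j) (departures w)) ∧
      ∀ i j, (w.1.1 i j : ℝ) * m i j = 0 := by
  set s : Fin n → Fin n → ℕ := w.1.2.1 with hsd
  have hsf : s ∈ feasibleSchedules n := w.1.2.2
  obtain ⟨Q, hQ, hle, hr, hc⟩ := exists_doublyStochastic_ge (P := fun i j => (s i j : ℝ))
    (fun i => by exact_mod_cast hsf.2.2 i) (fun j => by exact_mod_cast hsf.2.1 j)
  have hd : ∀ i j, (departures w i j : ℝ) ≤ s i j := fun i j => by
    exact_mod_cast min_le_left _ _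
  -- The completion `Q` of the schedule minus the actual departures. It consists of wasted service,
  -- which occurs only at empty queues, and of the completion between unused ports, which meets only
  -- empty queues by maximality.
  refine ⟨fun i j => Q i j - departures w i j, fun i j => ?_, fun i j => ?_, fun i => ?_,
    fun j => ?_, fun i j => ?_⟩
  · linarith [hd i j, hle i j]
  · have h1 : Q i j ≤ ∑ j, Q i j := Finset.single_le_sum (f := fun j => Q i j)
      (fun l _ => (Nat.cast_nonneg (s i l)).trans (hle i l)) (Finset.mem_univ j)
    rw [hr] at h1
    have : (0 : ℝ) ≤ departures w i j := by positivity
    linarith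
  · rw [Finset.sum_sub_distrib, hr, linearForm_rowForm]
  · rw [Finset.sum_sub_distrib, hc, linearForm_colForm]
  · by_cases hq : w.1.1 i j = 0
    · simp [hq]
    · have h1 : departures w i j = s i j := by
        have := feasible_le_one w.1.2 i j
        rw [departures]
        exact min_eq_left (by omega)
      have h2 : (1 - ∑ k, (s i k : ℝ)) * (1 - ∑ k, (s k j : ℝ)) = 0 := by
        by_contra hne
        obtain ⟨ha, hb⟩ := mul_ne_zero_iff.1 hne
        refine hq (queue_eq_zero_of_unused hsf hs ?_ ?_)
        · have h3 := hsf.2.2 i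
          rcases Nat.le_one_iff_eq_zero_or_eq_one.1 h3 with h | h
          · exact h
          · exact absurd (by rw [sub_eq_zero]; exact_mod_cast h.symm) ha
        · have h3 := hsf.2.1 j
          rcases Nat.le_one_iff_eq_zero_or_eq_one.1 h3 with h | h
          · exact h
          · exact absurd (by rw [sub_eq_zero]; exact_mod_cast h.symm) hb
      dsimp only
      rw [← hQ, h1, h2]
      simp

/-- The correlation of queue lengths and idleness that appears in the second moment balance. -/
def idleCorrelation (w : Slot n) : ℝ :=
  ∑ i, linearForm (rowForm i) w.1.1 * (1 - linearForm (rowForm i) (departures w)) +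
    ∑ j, linearForm (colForm j) w.1.1 * (1 - linearForm (colForm j) (departures w)) -
    totalQueue w.1.1 * idle w / n

/-- Summing the exchange relation over all `l`, `m` recovers an entry from its row sum, its column
sum and the total; this is the additive form `v i + w j` of `k`. -/
lemma InCone.eq_sum {k : Fin n → Fin n → ℝ} (hk : InCone k) (i j : Fin n) :
    (n : ℝ) * (n * k i j) + ∑ l, ∑ m, k l m = n * ∑ m, k i m + n * ∑ l, k l j := by
  have h : ∑ l, ∑ m, (k i j + k l m) = ∑ l, ∑ m, (k i m + k l j) :=
    Finset.sum_congr rfl fun l _ => Finset.sum_congr rfl fun m _ => hk.exchange i j l m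
  simpa [Finset.sum_add_distrib, Finset.mul_sum] using h

/-- The correlation is an inner product of `q` with a matrix `M`. Subtracting `n * m` from its
coefficients is free, as `m` lives on empty queues, and makes `M` orthogonal to the cone. Only the
polar part of `q` then contributes, and Cauchy-Schwarz applies. -/
lemma sq_idleCorrelation_le (hn : 0 < n) (w : Slot n)
    (hs : ∀ s' ∈ feasibleSchedules n, weight w.1.1 s' ≤ weight w.1.1 w.1.2) :
    idleCorrelation w ^ 2 ≤ sqDist w.1.1 * (16 * n ^ 2 * idle w) := by
  have hn' : (0 : ℝ) < n := by positivity
  have hn1 : (1 : ℝ) ≤ n := by exact_mod_cast hn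
  obtain ⟨m, hm0, hm1, hmr, hmc, hqm⟩ := exists_idle_matching w hs
  set I : Fin n → ℝ := fun i => ∑ j, m i j with hI
  set J : Fin n → ℝ := fun j => ∑ i, m i j with hJ
  set S := ∑ i, ∑ j, m i j with hS
  have hidle : idle w = S := by
    rw [idle, hS]
    simp_rw [hmr, Finset.sum_sub_distrib, linearForm_rowForm, linearForm_one]
    simp
  have hI0 : ∀ i, 0 ≤ I i := fun i => Finset.sum_nonneg fun j _ => hm0 i j
  have hJ0 : ∀ j, 0 ≤ J j := fun j => Finset.sum_nonneg fun i _ => hm0 i j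
  have hI1 : ∀ i, I i ≤ 1 := fun i => by
    have : 0 ≤ linearForm (rowForm i) (departures w) :=
      linearForm_nonneg (isLine_rowForm i).nonneg _
    simp only [hI, hmr]; linarith
  have hJ1 : ∀ j, J j ≤ 1 := fun j => by
    have : 0 ≤ linearForm (colForm j) (departures w) :=
      linearForm_nonneg (isLine_colForm j).nonneg _
    simp only [hJ, hmc]; linarith
  have hSI : ∑ i, I i = S := rfl
  have hSJ : ∑ j, J j = S := Finset.sum_comm
  have hS0 : 0 ≤ S := Finset.sum_nonneg fun i _ => hI0 i
  have hSn : S ≤ n := by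
    rw [← hSI]
    simpa using Finset.sum_le_sum fun i (_ : i ∈ Finset.univ) => hI1 i
  -- the coefficients of the correlation
  set M : Fin n → Fin n → ℝ := fun i j => I i + J j - S / n - n * m i j with hM
  have expand : ∀ x : Fin n → Fin n → ℝ, ∑ i, ∑ j, x i j * M i j =
      ∑ i, (∑ j, x i j) * I i + ∑ j, (∑ i, x i j) * J j - (∑ i, ∑ j, x i j) * S / n -
        n * ∑ i, ∑ j, x i j * m i j := fun x => by
    have e1 : ∑ j, (∑ i, x i j) * J j = ∑ i, ∑ j, x i j * J j := by
      simp_rw [Finset.sum_mul]; exact Finset.sum_comm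
    rw [e1]
    simp only [hM, Finset.sum_mul, Finset.mul_sum, Finset.sum_div, ← Finset.sum_add_distrib,
      ← Finset.sum_sub_distrib]
    exact Finset.sum_congr rfl fun i _ => Finset.sum_congr rfl fun j _ => by ring
  have hk : ∑ i, ∑ j, conePart w.1.1 i j * M i j = 0 := by
    set k := conePart w.1.1 with hkd
    have hkc : InCone k := inCone_conePart _
    rw [expand]
    have e : ∀ i j, (n : ℝ) * (k i j * m i j) = (∑ l, k i l) * m i j + (∑ l, k l j) * m i j -
        (∑ l, ∑ r, k l r) * m i j / n := fun i j => by
      have := hkc.eq_sum i j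
      field_simp
      linear_combination m i j * this
    have e2 : (n : ℝ) * ∑ i, ∑ j, k i j * m i j = ∑ i, (∑ l, k i l) * I i +
        ∑ j, (∑ l, k l j) * J j - (∑ l, ∑ r, k l r) * S / n := by
      simp_rw [Finset.mul_sum (a := (n : ℝ)), e, Finset.sum_sub_distrib, Finset.sum_add_distrib]
      congr 1
      · congr 1
        · simp only [hI, Finset.mul_sum]
        · rw [Finset.sum_comm]; simp only [hJ, Finset.mul_sum]
      · simp only [hS, ← Finset.sum_div, ← Finset.mul_sum]
    rw [e2]; ring
  have hqM : ∑ i, ∑ j, (w.1.1 i j : ℝ) * M i j = idleCorrelation w := by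
    rw [expand, idleCorrelation, hidle, totalQueue]
    simp only [hqm, Finset.sum_const_zero, mul_zero, sub_zero, linearForm_rowForm,
      linearForm_colForm, hI, hJ, hmr, hmc]
    push_cast
    rfl
  have hz : idleCorrelation w = ∑ i, ∑ j, polarPart w.1.1 i j * M i j := by
    rw [← hqM, ← sub_eq_zero, ← hk]
    simp only [← Finset.sum_sub_distrib, polarPart]
    exact Finset.sum_congr rfl fun i _ => Finset.sum_congr rfl fun j _ => by ring
  -- The square of a sum of four terms is at most four times the sum of squares. All of `I`, `J`,
  -- `m` are in `[0, 1]`, so squares are bounded by first powers and everything sums to multiples of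
  -- `S ≤ n`.
  have hM2 : ∑ i, ∑ j, M i j ^ 2 ≤ 16 * n ^ 2 * S := by
    have h1 : ∑ i, ∑ j, M i j ^ 2 ≤
        ∑ i, ∑ j, 4 * (I i + J j + (S / n) ^ 2 + n ^ 2 * m i j) := by
      refine Finset.sum_le_sum fun i _ => Finset.sum_le_sum fun j _ => ?_
      have a1 : I i ^ 2 ≤ I i := by nlinarith [hI0 i, hI1 i]
      have a2 : J j ^ 2 ≤ J j := by nlinarith [hJ0 j, hJ1 j]
      have a3 : (n * m i j) ^ 2 ≤ n ^ 2 * m i j := by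
        rw [mul_pow]
        exact mul_le_mul_of_nonneg_left (by nlinarith [hm0 i j, hm1 i j]) (by positivity)
      simp only [hM]
      nlinarith [sq_nonneg (I i - J j), sq_nonneg (I i + S / n), sq_nonneg (I i + n * m i j),
        sq_nonneg (J j + S / n), sq_nonneg (J j + n * m i j), sq_nonneg (S / n - n * m i j)]
    have h2 : ∑ i, ∑ j, 4 * (I i + J j + (S / n) ^ 2 + n ^ 2 * m i j) =
        4 * (2 * n * S + S ^ 2 + n ^ 2 * S) := by
      simp only [← Finset.mul_sum, Finset.sum_add_distrib, Finset.sum_const, Finset.card_univ,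
        Fintype.card_fin, nsmul_eq_mul, hSI, hSJ]
      rw [← hS]
      field_simp
      ring
    rw [h2] at h1
    have h3 : S ^ 2 ≤ n * S := by nlinarith
    have h4 : n * S ≤ n ^ 2 * S := by nlinarith
    linarith
  rw [hz, hidle]
  exact (sum_mul_sq_le _ _).trans (mul_le_mul_of_nonneg_left hM2 (sqDist_nonneg _))

lemma idle_nonneg (w : Slot n) : 0 ≤ idle w := by
  rw [idle, linearForm_one, sub_nonneg]
  refine le_trans ?_ (feasible_sum_le w.1.2)
  exact Finset.sum_le_sum fun i _ => Finset.sum_le_sum fun j _ => by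
    exact_mod_cast min_le_left _ _

lemma idle_eq_natCast (w : Slot n) : ∃ m : ℕ, idle w = m := by
  have h := idle_nonneg w
  rw [idle, linearForm_one] at h ⊢
  refine ⟨n - ∑ i, ∑ j, departures w i j, ?_⟩
  rw [Nat.cast_sub]
  · push_cast; rfl
  · have : ((∑ i, ∑ j, departures w i j : ℕ) : ℝ) ≤ n := by push_cast; linarith
    exact_mod_cast this

/-- A weighted Young inequality in which integrality matters: for `m ≥ 1` one has `√m ≤ m`, so a
third moment of `y` and a first moment of `m` suffice. The parameter `θ` decides which of `y * θ`
and `√m` dominates. -/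
lemma mul_sqrt_natCast_le {y θ : ℝ} (hy : 0 ≤ y) (hθ : 0 < θ) (m : ℕ) :
    y * √(m : ℝ) ≤ y ^ 3 * θ ^ 2 + m / θ := by
  rcases Nat.eq_zero_or_pos m with rfl | hm
  · simp; positivity
  have hm1 : (1 : ℝ) ≤ m := by exact_mod_cast hm
  set r := √(m : ℝ) with hr
  have hr2 : r ^ 2 = m := Real.sq_sqrt (by positivity)
  have hr1 : 1 ≤ r := by rw [hr]; exact Real.one_le_sqrt.2 hm1
  rcases le_total (y * θ) r with h | h
  · have : y * r ≤ m / θ := by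
      rw [le_div_iff₀ hθ, ← hr2]; nlinarith
    have h3 : 0 ≤ y ^ 3 * θ ^ 2 := by positivity
    linarith
  · have h2 : r ^ 2 ≤ (y * θ) ^ 2 := pow_le_pow_left₀ (by linarith) h 2
    have : y * r ≤ y ^ 3 * θ ^ 2 := by
      calc y * r ≤ y * r ^ 2 := mul_le_mul_of_nonneg_left (by nlinarith) hy
        _ ≤ y * (y * θ) ^ 2 := mul_le_mul_of_nonneg_left h2 hy
        _ = _ := by ring
    have h3 : 0 ≤ (m : ℝ) / θ := by positivity
    linarith

lemma abs_idleCorrelation_le (hn : 0 < n) (w : Slot n)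
    (hs : ∀ s' ∈ feasibleSchedules n, weight w.1.1 s' ≤ weight w.1.1 w.1.2) {θ : ℝ} (hθ : 0 < θ) :
    |idleCorrelation w| ≤ 4 * n * (√(sqDist w.1.1) ^ 3 * θ ^ 2 + idle w / θ) := by
  have h1 : |idleCorrelation w| ≤ 4 * n * (√(sqDist w.1.1) * √(idle w)) := by
    refine abs_le_of_sq_le_sq ?_ (by have := idle_nonneg w; positivity)
    refine (sq_idleCorrelation_le hn w hs).trans (le_of_eq ?_)
    rw [mul_pow, mul_pow, mul_pow, Real.sq_sqrt (sqDist_nonneg _), Real.sq_sqrt (idle_nonneg w)]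
    ring
  obtain ⟨m, hm⟩ := idle_eq_natCast w
  rw [hm] at h1 ⊢
  exact h1.trans (mul_le_mul_of_nonneg_left (mul_sqrt_natCast_le (Real.sqrt_nonneg _) hθ m)
    (by positivity))

variable {p : unitInterval} {A : Policy n} {π : PMF (QueueState n)}

lemma integrable_linearForm_mul_sub (hT : meanTotalQueue π ≠ ∞) {c : Fin n → Fin n → ℝ}
    (hc : ∀ i j, 0 ≤ c i j) (b : ℝ) :
    Integrable (fun w : Slot n => linearForm c w.1.1 * (b - linearForm c (departures w)))
      (slotLaw p A π) :=
  (integrable_linearForms hT hc (fun _ y => b - y) fun S => ⟨|b| + S, fun x y _ _ hy hyS => by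
    have h1 := neg_abs_le b
    have h2 := le_abs_self b
    rw [abs_le]; constructor <;> linarith⟩).2

lemma one_nonneg_coeff (i j : Fin n) : (0 : ℝ) ≤ (fun _ _ => 1 : Fin n → Fin n → ℝ) i j :=
  zero_le_one

lemma sum_one_coeff : ∑ _i : Fin n, ∑ _j : Fin n, (1 : ℝ) = n ^ 2 := by simp; ring

lemma linearForm_one_eq_totalQueue (q : QueueState n) :
    linearForm (fun _ _ => 1) q = totalQueue q := by
  rw [linearForm_one, totalQueue]; push_cast; rfl

lemma integrable_departures (hT : meanTotalQueue π ≠ ∞) :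
    Integrable (fun w : Slot n => linearForm (fun _ _ => 1) (departures w)) (slotLaw p A π) :=
  (integrable_linearForms hT one_nonneg_coeff (fun _ y => y) fun S =>
    ⟨S, fun x y _ _ hy hyS => by rwa [abs_of_nonneg hy]⟩).1

lemma integrable_idle (hT : meanTotalQueue π ≠ ∞) :
    Integrable (fun w : Slot n => idle w) (slotLaw p A π) :=
  (integrable_const _).sub (integrable_departures hT)

lemma integral_idle (hT : meanTotalQueue π ≠ ∞) (hπ : IsStationary (transition p A) π) :
    ∫ w, idle w ∂slotLaw p A π = n * (1 - n * p) := by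
  have hD : ∫ w, linearForm (fun _ _ => 1) (departures w) ∂slotLaw p A π = p * n ^ 2 := by
    rw [← sum_one_coeff]; exact integral_linearForm_departures hT hπ one_nonneg_coeff
  have : ∫ w, idle w ∂slotLaw p A π =
      ∫ w, ((n : ℝ) - linearForm (fun _ _ => 1) (departures w)) ∂slotLaw p A π := rfl
  rw [this, integral_sub (integrable_const _) (integrable_departures hT), hD]
  simp only [integral_const, probReal_univ, smul_eq_mul, one_mul]
  ring

lemma integrable_totalQueue_mul_idle (hT : meanTotalQueue π ≠ ∞) :
    Integrable (fun w : Slot n => (totalQueue w.1.1 : ℝ) * idle w) (slotLaw p A π) := by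
  refine (integrable_linearForm_mul_sub hT one_nonneg_coeff n).congr
    (Eventually.of_forall fun w => ?_)
  simp only [idle, linearForm_one_eq_totalQueue w.1.1]

/-- Arrivals minus departures is the centred arrivals plus the centred number of idle ports. The
former has variance at most `n`; for the latter, `idle ^ 2 ≤ n * idle` reduces to the mean `n (1 - n
p)`. -/
lemma integral_sq_arrival_sub_departures_le (hp : n * (p : ℝ) ≤ 1) (hT : meanTotalQueue π ≠ ∞)
    (hπ : IsStationary (transition p A) π) :
    ∫ w, (linearForm (fun _ _ => 1) w.2 - linearForm (fun _ _ => 1) (departures w)) ^ 2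
      ∂slotLaw p A π ≤ 2 * n + 2 * n ^ 2 * (1 - n * p) := by
  have hn0 : (0 : ℝ) ≤ n := by positivity
  set ε := 1 - n * (p : ℝ) with hε
  have iIdle := integrable_idle (p := p) (A := A) hT
  have iA : Integrable (fun w : Slot n => linearForm (fun _ _ => 1) w.2) (slotLaw p A π) :=
    (integrable_linearForms hT one_nonneg_coeff (fun x _ => x) fun S => ⟨S, fun x y hx hxS _ _ => by
      rwa [abs_of_nonneg hx]⟩).1
  have iA2 : Integrable (fun w : Slot n => linearForm (fun _ _ => 1) w.2 ^ 2) (slotLaw p A π) :=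
    (integrable_linearForms hT one_nonneg_coeff (fun x _ => x ^ 2) fun S => ⟨S ^ 2,
      fun x y hx hxS _ _ => by rw [abs_of_nonneg (sq_nonneg _)]; nlinarith⟩).1
  have iX : Integrable (fun w : Slot n => (linearForm (fun _ _ => 1) w.2 -
      linearForm (fun _ _ => 1) (departures w)) ^ 2) (slotLaw p A π) :=
    (integrable_linearForms hT one_nonneg_coeff (fun x y => (x - y) ^ 2) fun S => ⟨S ^ 2,
      fun x y hx hxS hy hyS => by rw [abs_of_nonneg (sq_nonneg _)]; nlinarith⟩).1
  have hA1 : ∫ w, linearForm (fun _ _ => 1) w.2 ∂slotLaw p A π = p * n ^ 2 := by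
    rw [integral_slotLaw_arrival, ← sum_one_coeff]
    exact integral_linear_arrival p _
  have hA2 : ∫ w, linearForm (fun _ _ => 1) w.2 ^ 2 ∂slotLaw p A π =
      p * (1 - p) * n ^ 2 + (p * n ^ 2) ^ 2 := by
    rw [integral_slotLaw_arrival fun a => linearForm (fun _ _ => 1) a ^ 2]
    have := integral_sq_linear_arrival (n := n) p (fun _ _ => 1)
    simp only [one_pow] at this
    rw [sum_one_coeff] at this
    exact this
  have hcε : p * (n : ℝ) ^ 2 = n - n * ε := by rw [hε]; ring
  have hidle := integral_idle hT hπ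
  rw [← hε] at hidle
  obtain ⟨c, hc⟩ : ∃ c, c = p * (n : ℝ) ^ 2 := ⟨_, rfl⟩
  rw [← hc] at hA1 hA2 hcε
  have hpt : ∀ w : Slot n, (linearForm (fun _ _ => 1) w.2 -
      linearForm (fun _ _ => 1) (departures w)) ^ 2 ≤
      2 * linearForm (fun _ _ => 1) w.2 ^ 2 - 4 * c * linearForm (fun _ _ => 1) w.2 +
        (2 * (n - 2 * n * ε) * idle w + (2 * c ^ 2 + 2 * (n * ε) ^ 2)) := fun w => by
    have h0 := idle_nonneg w
    have h1 : idle w ≤ n := by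
      rw [idle, sub_le_self_iff]; exact linearForm_nonneg one_nonneg_coeff _
    have h2 : linearForm (fun _ _ => 1) (departures w) = n - idle w := by rw [idle]; ring
    rw [h2]
    generalize linearForm (fun _ _ => (1 : ℝ)) w.2 = a
    have h4 : (a - (n - idle w)) ^ 2 ≤ 2 * (a - c) ^ 2 + 2 * (idle w - n * ε) ^ 2 := by
      have : a - (n - idle w) = (a - c) + (idle w - n * ε) := by rw [hcε]; ring
      rw [this]
      nlinarith [sq_nonneg ((a - c) - (idle w - n * ε))]
    have h5 : idle w ^ 2 ≤ n * idle w := by nlinarith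
    linarith
  have i1 : Integrable (fun w : Slot n => 2 * linearForm (fun _ _ => 1) w.2 ^ 2 -
      4 * c * linearForm (fun _ _ => 1) w.2) (slotLaw p A π) :=
    (iA2.const_mul 2).sub (iA.const_mul _)
  have i2 : Integrable (fun w : Slot n => 2 * (n - 2 * n * ε) * idle w +
      (2 * c ^ 2 + 2 * (n * ε) ^ 2)) (slotLaw p A π) :=
    (iIdle.const_mul _).add (integrable_const _)
  have h := integral_mono iX (i1.add i2) hpt
  simp only [Pi.add_apply] at h
  rw [integral_add i1 i2, integral_sub (iA2.const_mul 2) (iA.const_mul _),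
    integral_add (iIdle.const_mul _) (integrable_const _), integral_const_mul,
    integral_const_mul, integral_const_mul, hA1, hA2, hidle] at h
  simp only [integral_const, probReal_univ, smul_eq_mul, one_mul] at h
  have hvar : p * (1 - p) * (n : ℝ) ^ 2 ≤ n := by
    have h1 : c ≤ n := by
      have : 0 ≤ n * ε := mul_nonneg hn0 (by linarith)
      linarith
    have h2 : p * (1 - p) * (n : ℝ) ^ 2 = c - (p * n) ^ 2 := by rw [hc]; ring
    have h3 := sq_nonneg ((p : ℝ) * n)
    linarith
  have h3 := sq_nonneg ((n : ℝ) * ε)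
  linarith

/-- The balance of the second moment of the total queue length. -/
lemma total_balance (hp : n * (p : ℝ) ≤ 1) (hT : meanTotalQueue π ≠ ∞)
    (hπ : IsStationary (transition p A) π) :
    ∃ X : ℝ, 0 ≤ X ∧ X ≤ 2 * n + 2 * n ^ 2 * (1 - n * p) ∧
      2 * n * (1 - n * (p : ℝ)) * (meanTotalQueue π).toReal =
        2 * ∫ w, (totalQueue w.1.1 : ℝ) * idle w ∂slotLaw p A π + X := by
  refine ⟨_, integral_nonneg fun w => sq_nonneg _,
    integral_sq_arrival_sub_departures_le hp hT hπ, ?_⟩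
  have h := integral_linearForm_balance (p := p) (A := A) hT hπ one_nonneg_coeff
  rw [sum_one_coeff] at h
  have e : ∀ w : Slot n, linearForm (fun _ _ => 1) w.1.1 *
      (linearForm (fun _ _ => 1) (departures w) - p * n ^ 2) =
      n * (1 - n * p) * totalQueue w.1.1 - totalQueue w.1.1 * idle w := fun w => by
    rw [linearForm_one_eq_totalQueue w.1.1, idle]; ring
  simp_rw [e] at h
  rw [integral_sub ((integrable_totalQueue hT).const_mul _) (integrable_totalQueue_mul_idle hT),
    integral_const_mul, integral_totalQueue] at h
  linarith

/-- The sum of the second moment balances along a family of lines that covers every queue once. -/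
lemma lines_balance (hn : 0 < n) (hT : meanTotalQueue π ≠ ∞)
    (hπ : IsStationary (transition p A) π) {c : Fin n → Fin n → Fin n → ℝ}
    (hc : ∀ i, IsLine (c i))
    (hcT : ∀ q : QueueState n, (totalQueue q : ℝ) = ∑ i, linearForm (c i) q) :
    ∃ r : ℝ, 0 ≤ r ∧ r ≤ 2 * n ^ 2 * (1 - n * p) ∧
      2 * (1 - n * (p : ℝ)) * (meanTotalQueue π).toReal =
        2 * ∫ w, ∑ i, linearForm (c i) w.1.1 * (1 - linearForm (c i) (departures w))
          ∂slotLaw p A π + (n * (p : ℝ)) ^ 2 * (n - 1) + r := by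
  have hn' : (n : ℝ) ≠ 0 := by positivity
  choose r hr0 hr1 hr using fun i => (hc i).balance (p := p) (A := A) hn hT hπ
  refine ⟨∑ i, r i, Finset.sum_nonneg fun i _ => hr0 i, ?_, ?_⟩
  · refine (Finset.sum_le_sum fun i _ => hr1 i).trans (le_of_eq ?_)
    simp only [Finset.sum_const, Finset.card_univ, Fintype.card_fin, nsmul_eq_mul]
    ring
  · have h := Finset.sum_congr (rfl : (Finset.univ : Finset (Fin n)) = _) fun i _ => hr i
    rw [← Finset.mul_sum, ← integral_finsetSum _ fun i _ => (hc i).integrable hT] at h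
    simp_rw [← hcT] at h
    rw [integral_totalQueue, Finset.sum_add_distrib, Finset.sum_add_distrib, ← Finset.mul_sum,
      ← integral_finsetSum _ fun i _ => integrable_linearForm_mul_sub hT (hc i).nonneg 1] at h
    rw [h]
    simp only [Finset.sum_const, Finset.card_univ, Fintype.card_fin, nsmul_eq_mul]
    field_simp

lemma abs_integral_idleCorrelation_le (hn : 0 < n) (hp : n * (p : ℝ) < 1)
    (hload : n * (1 - n * (p : ℝ)) ≤ 1 / 2) (hA : IsMaxWeight A)
    (hπ : IsStationary (transition p A) π) {θ : ℝ} (hθ : 0 < θ) :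
    |∫ w, idleCorrelation w ∂slotLaw p A π| ≤
      4 * n * (8008 * n ^ 6 * θ ^ 2 + n * (1 - n * p) / θ) := by
  have hT := meanTotalQueue_ne_top hn hp hA hπ
  have iIdle := integrable_idle (p := p) (A := A) hT
  obtain ⟨iy, hy⟩ := integrable_sqrt_sqDist_cube hn hp.le hload hA hπ
  have ib : Integrable (fun w : Slot n => √(sqDist w.1.1) ^ 3 * θ ^ 2 + idle w / θ)
    (slotLaw p A π) := (iy.mul_const _).add (iIdle.div_const _)
  have h1 : ‖∫ w, idleCorrelation w ∂slotLaw p A π‖ ≤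
      ∫ w, 4 * n * (√(sqDist w.1.1) ^ 3 * θ ^ 2 + idle w / θ) ∂slotLaw p A π := by
    refine norm_integral_le_of_norm_le (ib.const_mul _) ?_
    filter_upwards [ae_slotLaw_queue_schedule p A π
      (P := fun x => ∀ s' ∈ feasibleSchedules n, weight x.1 s' ≤ weight x.1 x.2)
      fun q s hs => hA q s hs] with w hw
    exact abs_idleCorrelation_le hn w hw hθ
  rw [integral_const_mul, integral_add (iy.mul_const _) (iIdle.div_const _), integral_mul_const,
    integral_div, integral_idle hT hπ] at h1
  refine h1.trans ?_
  gcongr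

lemma integral_idleCorrelation (hT : meanTotalQueue π ≠ ∞) :
    ∫ w, idleCorrelation w ∂slotLaw p A π =
      ∫ w, ∑ i, linearForm (rowForm i) w.1.1 * (1 - linearForm (rowForm i) (departures w))
        ∂slotLaw p A π +
      ∫ w, ∑ j, linearForm (colForm j) w.1.1 * (1 - linearForm (colForm j) (departures w))
        ∂slotLaw p A π - (∫ w, (totalQueue w.1.1 : ℝ) * idle w ∂slotLaw p A π) / n := by
  have hi : ∀ c : Fin n → Fin n → Fin n → ℝ, (∀ i, IsLine (c i)) →
      Integrable (fun w : Slot n => ∑ i, linearForm (c i) w.1.1 *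
        (1 - linearForm (c i) (departures w))) (slotLaw p A π) := fun c hc =>
    integrable_finsetSum _ fun i _ => integrable_linearForm_mul_sub hT (hc i).nonneg 1
  have iR := hi rowForm isLine_rowForm
  have iC := hi colForm isLine_colForm
  have iRC : Integrable (fun w : Slot n => ∑ i, linearForm (rowForm i) w.1.1 *
      (1 - linearForm (rowForm i) (departures w)) + ∑ j, linearForm (colForm j) w.1.1 *
      (1 - linearForm (colForm j) (departures w))) (slotLaw p A π) := iR.add iC
  rw [← integral_div, ← integral_add iR iC,
    ← integral_sub iRC ((integrable_totalQueue_mul_idle hT).div_const _)]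
  rfl

/-- The mean total queue length of MaxWeight, up to an explicit error. -/
theorem abs_meanTotalQueue_sub_le (hn : 0 < n) (hp : n * (p : ℝ) < 1)
    (hload : n * (1 - n * (p : ℝ)) ≤ 1 / 2) (hA : IsMaxWeight A)
    (hπ : IsStationary (transition p A) π) {θ : ℝ} (hθ : 0 < θ) :
    |(1 - n * (p : ℝ)) * (meanTotalQueue π).toReal - n| ≤
      4 * n * (8008 * n ^ 6 * θ ^ 2 + n * (1 - n * p) / θ) + 2 + 5 * n ^ 2 * (1 - n * p) := by
  have hn' : (0 : ℝ) < n := by positivity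
  have hn1 : (1 : ℝ) ≤ n := by exact_mod_cast hn
  have hT := meanTotalQueue_ne_top hn hp hA hπ
  obtain ⟨X, hX0, hX1, htot⟩ := total_balance hp.le hT hπ
  obtain ⟨r₁, hr₁0, hr₁1, hrow⟩ := lines_balance hn hT hπ isLine_rowForm totalQueue_eq_sum_rows
  obtain ⟨r₂, hr₂0, hr₂1, hcol⟩ := lines_balance hn hT hπ isLine_colForm totalQueue_eq_sum_cols
  have hcorr := integral_idleCorrelation (p := p) (A := A) hT
  have hbound := abs_integral_idleCorrelation_le hn hp hload hA hπ hθ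
  generalize ∫ w, ∑ i, linearForm (rowForm i) w.1.1 *
    (1 - linearForm (rowForm i) (departures w)) ∂slotLaw p A π = R at *
  generalize ∫ w, ∑ i, linearForm (colForm i) w.1.1 *
    (1 - linearForm (colForm i) (departures w)) ∂slotLaw p A π = C at *
  generalize ∫ w, (totalQueue w.1.1 : ℝ) * idle w ∂slotLaw p A π = U at *
  generalize ∫ w, idleCorrelation w ∂slotLaw p A π = Φ at *
  generalize (meanTotalQueue π).toReal = T at *
  have hp0 : 0 ≤ n * (p : ℝ) := mul_nonneg hn'.le p.2.1
  obtain ⟨ε, hε⟩ : ∃ ε, ε = 1 - n * (p : ℝ) := ⟨_, rfl⟩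
  have hnp : n * (p : ℝ) = 1 - ε := by linarith
  have hε0 : 0 < ε := by linarith
  have hε1 : ε ≤ 1 := by linarith
  rw [hnp] at hrow hcol
  rw [← hε] at htot hX1 hr₁1 hr₂1 hbound ⊢
  have htot' : 2 * ε * T = 2 * (U / n) + X / n := by
    field_simp
    linarith
  have hXn0 : 0 ≤ X / n := by positivity
  have hXn1 : X / n ≤ 2 + 2 * n * ε := by
    rw [div_le_iff₀ hn']
    linarith
  -- Half of rows plus columns minus `1 / n` times the total: the unknown correlations enter only
  -- through `Φ`.
  have key : ε * T - n = Φ + ((1 - ε) ^ 2 * (n - 1) - n) + (r₁ + r₂) / 2 - X / n / 2 := by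
    rw [hcorr]
    linear_combination (hrow + hcol - htot') / 2
  have hnε : n * ε ≤ n ^ 2 * ε := by nlinarith
  have hmid0 : -(1 + 2 * n * ε) ≤ (1 - ε) ^ 2 * (n - 1) - n := by nlinarith
  have hmid1 : (1 - ε) ^ 2 * (n - 1) - n ≤ 0 := by nlinarith
  have hn2ε : 0 ≤ n ^ 2 * ε := by positivity
  rw [key]
  rw [abs_le] at hbound ⊢
  constructor <;> linarith [hbound.1, hbound.2]

end MeanBound

/-! ### Heavy traffic asymptotics -/

section Asymptotic

variable {β : ℝ} {n₀ : ℕ} {γ : ℕ → ℝ} {p : ℕ → unitInterval}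

lemma load_eq {n : ℕ} (hn : 0 < n) (hp : (p n : ℝ) = (1 - γ n * (n : ℝ) ^ (-β)) / n) :
    n * (p n : ℝ) = 1 - γ n * (n : ℝ) ^ (-β) := by
  rw [hp]; field_simp

lemma load_lt_one {n : ℕ} (hn : 0 < n) (hγ : 0 < γ n)
    (hp : (p n : ℝ) = (1 - γ n * (n : ℝ) ^ (-β)) / n) : n * (p n : ℝ) < 1 := by
  rw [load_eq hn hp]
  have : 0 < γ n * (n : ℝ) ^ (-β) := by positivity
  linarith

lemma lower_bound_of_isStationary {n : ℕ} (hn : 0 < n) (hγ : 0 < γ n)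
    (hp : (p n : ℝ) = (1 - γ n * (n : ℝ) ^ (-β)) / n) {A : Policy n} {π : PMF (QueueState n)}
    (hπ : IsStationary (transition (p n) A) π) :
    ENNReal.ofReal
        ((1 - γ n * (n : ℝ) ^ (-β)) ^ 2 / (2 * γ n) * (n : ℝ) ^ β * ((n : ℝ) - 1)) ≤
      meanTotalQueue π := by
  have h := hπ.le_meanTotalQueue hn (load_lt_one hn hγ hp)
  rw [load_eq hn hp] at h
  refine le_trans (le_of_eq ?_) h
  congr 1
  have hpos : 0 < (n : ℝ) ^ β := by positivity
  have e : (1 : ℝ) - (1 - γ n * (n : ℝ) ^ (-β)) = γ n * ((n : ℝ) ^ β)⁻¹ := by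
    rw [← Real.rpow_neg (by positivity)]; ring
  rw [e]
  field_simp

lemma tendsto_natCast_rpow_neg {a : ℝ} (ha : 0 < a) :
    Tendsto (fun n : ℕ => (n : ℝ) ^ (-a)) atTop (𝓝 0) :=
  (tendsto_rpow_neg_atTop ha).comp tendsto_natCast_atTop_atTop

lemma eventually_bounds (hγ : ∀ n, n₀ ≤ n → 0 < γ n) (hγΘ : γ =Θ[atTop] fun _ => (1 : ℝ)) :
    ∃ c C : ℝ, 0 < c ∧ 0 < C ∧ ∀ᶠ n : ℕ in atTop, c ≤ γ n ∧ γ n ≤ C := by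
  obtain ⟨C, hC, h1⟩ := hγΘ.1.exists_pos
  obtain ⟨D, hD, h2⟩ := hγΘ.2.exists_pos
  refine ⟨D⁻¹, C, by positivity, hC, ?_⟩
  filter_upwards [h1.bound, h2.bound, eventually_ge_atTop n₀] with n h1 h2 hn
  have h0 := hγ n hn
  rw [Real.norm_of_nonneg h0.le] at h1 h2
  simp only [norm_one, mul_one] at h1 h2
  refine ⟨?_, h1⟩
  rw [inv_le_iff_one_le_mul₀ hD]
  linarith

/-- The universal lower bound is of order `n ^ (1 + β)`. -/
lemma eventually_le_meanTotalQueue (hβ : 0 < β) (hγ : ∀ n, n₀ ≤ n → 0 < γ n)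
    (hγΘ : γ =Θ[atTop] fun _ => (1 : ℝ))
    (hp : ∀ n : ℕ, n₀ ≤ n → (p n : ℝ) = (1 - γ n * (n : ℝ) ^ (-β)) / n) :
    ∃ c : ℝ, 0 < c ∧ ∀ᶠ n : ℕ in atTop, ∀ (A : Policy n) (π : PMF (QueueState n)),
      IsStationary (transition (p n) A) π →
        ENNReal.ofReal (c * (n : ℝ) ^ (1 + β)) ≤ meanTotalQueue π := by
  obtain ⟨_, C, -, hC, hbd⟩ := eventually_bounds hγ hγΘ
  -- Eventually `(1 - ε) ^ 2 ≥ 1 / 4`, `γ n ≤ C` and `n - 1 ≥ n / 2`, and `(1 / 4) / (2 C) * (1 / 2)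
  -- = 1 / (16 C)`.
  refine ⟨1 / (16 * C), by positivity, ?_⟩
  have hsmall : ∀ᶠ n : ℕ in atTop, C * (n : ℝ) ^ (-β) ≤ 1 / 2 := by
    have := (tendsto_natCast_rpow_neg hβ).const_mul C
    rw [mul_zero] at this
    exact this.eventually_le_const (by norm_num)
  filter_upwards [hbd, hsmall, eventually_ge_atTop n₀, eventually_ge_atTop 2] with
    n ⟨_, hγC⟩ hs hn hn2 A π hπ
  have hγ0 := hγ n hn
  have hn' : (0 : ℝ) < n := by positivity
  have hn2' : (2 : ℝ) ≤ n := by exact_mod_cast hn2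
  refine le_trans (ENNReal.ofReal_le_ofReal ?_)
    (lower_bound_of_isStationary (by omega) hγ0 (hp n hn) hπ)
  have hpow : 0 < (n : ℝ) ^ β := by positivity
  have hε : γ n * (n : ℝ) ^ (-β) ≤ 1 / 2 :=
    (mul_le_mul_of_nonneg_right hγC (by positivity)).trans hs
  have h1 : (1 / 4 : ℝ) ≤ (1 - γ n * (n : ℝ) ^ (-β)) ^ 2 := by nlinarith
  have h2 : (1 / 4 : ℝ) / (2 * C) ≤ (1 - γ n * (n : ℝ) ^ (-β)) ^ 2 / (2 * γ n) := by
    gcongr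
  rw [Real.rpow_add hn', Real.rpow_one]
  calc 1 / (16 * C) * (n * (n : ℝ) ^ β) = (1 / 4) / (2 * C) * (n : ℝ) ^ β * (n / 2) := by
        field_simp; norm_num
    _ ≤ (1 - γ n * (n : ℝ) ^ (-β)) ^ 2 / (2 * γ n) * (n : ℝ) ^ β * ((n : ℝ) - 1) := by
        gcongr
        linarith

lemma load_condition {n : ℕ} (hn : 0 < n) (hp : (p n : ℝ) = (1 - γ n * (n : ℝ) ^ (-β)) / n)
    (h : 2 * γ n ≤ (n : ℝ) ^ (β - 1)) : n * (1 - n * (p n : ℝ)) ≤ 1 / 2 := by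
  have hn' : (0 : ℝ) < n := by positivity
  rw [load_eq hn hp]
  have e : (n : ℝ) * (n : ℝ) ^ (-β) * (n : ℝ) ^ (β - 1) = 1 := by
    nth_rewrite 1 [← Real.rpow_one (n : ℝ)]
    rw [← Real.rpow_add hn', ← Real.rpow_add hn', ← Real.rpow_zero (n : ℝ)]
    congr 1
    ring
  have hpos : 0 < (n : ℝ) * (n : ℝ) ^ (-β) := by positivity
  have := mul_le_mul_of_nonneg_left h hpos.le
  rw [e] at this
  nlinarith

/-- The mean total queue length of MaxWeight is asymptotically `n ^ (1 + β) / γ n`. -/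
lemma isLittleO_meanTotalQueue_sub (hβ : 4 < β) (hn₀ : 1 ≤ n₀) (hγ : ∀ n, n₀ ≤ n → 0 < γ n)
    (hγΘ : γ =Θ[atTop] fun _ => (1 : ℝ))
    (hp : ∀ n : ℕ, n₀ ≤ n → (p n : ℝ) = (1 - γ n * (n : ℝ) ^ (-β)) / n)
    {W : ∀ n : ℕ, Policy n} (hW : ∀ n, n₀ ≤ n → IsMaxWeight (W n))
    {π : ∀ n : ℕ, PMF (QueueState n)}
    (hπ : ∀ n, n₀ ≤ n → IsStationary (transition (p n) (W n)) (π n)) :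
    (fun n : ℕ => (n : ℝ) ^ (1 + β) / γ n - (meanTotalQueue (π n)).toReal) =o[atTop]
      fun n : ℕ => (n : ℝ) ^ (1 + β) := by
  obtain ⟨c, C, hc, hC, hbd⟩ := eventually_bounds hγ hγΘ
  set δ := (β - 4) / 2 with hδ
  have hδ0 : 0 < δ := by rw [hδ]; linarith
  -- The relative error: the explicit bound of `abs_meanTotalQueue_sub_le` divided by `n`, with `γ
  -- n` replaced by its bounds `c` and `C`.
  set F : ℕ → ℝ := fun n => (4 * (8008 * (n : ℝ) ^ (-(2 * δ)) + C * (n : ℝ) ^ (-δ)) +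
    2 * (n : ℝ) ^ (-(1 : ℝ)) + 5 * C * (n : ℝ) ^ (-(β - 1))) / c with hF
  have hFlim : Tendsto F atTop (𝓝 0) := by
    have h1 := tendsto_natCast_rpow_neg (a := 2 * δ) (by linarith)
    have h2 := tendsto_natCast_rpow_neg hδ0
    have h3 := tendsto_natCast_rpow_neg (a := 1) one_pos
    have h4 := tendsto_natCast_rpow_neg (a := β - 1) (by linarith)
    have := (((((h1.const_mul 8008).add (h2.const_mul C)).const_mul 4).add
      (h3.const_mul 2)).add (h4.const_mul (5 * C))).div_const c
    rwa [show (4 * (8008 * 0 + C * 0) + 2 * 0 + 5 * C * 0) / c = (0 : ℝ) by simp] at this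
  have hload : ∀ᶠ n : ℕ in atTop, 2 * C ≤ (n : ℝ) ^ (β - 1) :=
    ((tendsto_rpow_atTop (by linarith : 0 < β - 1)).comp
      tendsto_natCast_atTop_atTop).eventually_ge_atTop (2 * C)
  have hle : ∀ᶠ n : ℕ in atTop,
      |(n : ℝ) ^ (1 + β) / γ n - (meanTotalQueue (π n)).toReal| ≤ F n * (n : ℝ) ^ (1 + β) := by
    filter_upwards [hbd, hload, eventually_ge_atTop n₀] with n ⟨hcγ, hγC⟩ hl hn
    have hγ0 := hγ n hn
    have hn0 : 0 < n := by omega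
    have hn' : (0 : ℝ) < n := by positivity
    -- `θ` has to satisfy both `n ^ 6 * θ ^ 2 → 0` and `n ^ (1 - β) / θ → 0`, so it must lie between
    -- `n ^ (1 - β)` and `n ^ (-3)`; this is where `4 < β` enters. The choice `n ^ (-(3 + δ))` is
    -- the geometric middle: `3 + δ = (3 + (β - 1)) / 2`.
    have hmain := abs_meanTotalQueue_sub_le hn0 (load_lt_one hn0 hγ0 (hp n hn))
      (load_condition hn0 (hp n hn) (by linarith)) (hW n hn) (hπ n hn)
      (θ := (n : ℝ) ^ (-(3 + δ))) (by positivity)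
    have hε : 1 - n * (p n : ℝ) = γ n * (n : ℝ) ^ (-β) := by rw [load_eq hn0 (hp n hn)]; ring
    rw [hε] at hmain
    set T := (meanTotalQueue (π n)).toReal
    have e1 : (n : ℝ) ^ 6 * ((n : ℝ) ^ (-(3 + δ))) ^ 2 = (n : ℝ) ^ (-(2 * δ)) := by
      rw [← Real.rpow_natCast, ← Real.rpow_natCast, ← Real.rpow_mul hn'.le,
        ← Real.rpow_add hn']
      congr 1; push_cast; ring
    have e2 : n * (γ n * (n : ℝ) ^ (-β)) / (n : ℝ) ^ (-(3 + δ)) = γ n * (n : ℝ) ^ (-δ) := by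
      have : (n : ℝ) * (n : ℝ) ^ (-β) / (n : ℝ) ^ (-(3 + δ)) = (n : ℝ) ^ (-δ) := by
        nth_rewrite 1 [← Real.rpow_one (n : ℝ)]
        rw [← Real.rpow_add hn', ← Real.rpow_sub hn']
        congr 1; rw [hδ]; ring
      rw [← this]; ring
    have e3 : (n : ℝ) ^ 2 * (γ n * (n : ℝ) ^ (-β)) = n * (γ n * (n : ℝ) ^ (-(β - 1))) := by
      have : (n : ℝ) ^ (-(β - 1)) = n * (n : ℝ) ^ (-β) := by
        nth_rewrite 2 [← Real.rpow_one (n : ℝ)]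
        rw [← Real.rpow_add hn']
        congr 1; ring
      rw [this]; ring
    have e4 : (n : ℝ) * (n : ℝ) ^ (-(1 : ℝ)) = 1 := by
      rw [Real.rpow_neg_one, mul_inv_cancel₀ hn'.ne']
    have hbound : |γ n * (n : ℝ) ^ (-β) * T - n| ≤ F n * c * n := by
      refine hmain.trans ?_
      have hFc : F n * c * n = 4 * n * (8008 * (n : ℝ) ^ (-(2 * δ)) + C * (n : ℝ) ^ (-δ)) +
          2 * (n * (n : ℝ) ^ (-(1 : ℝ))) + 5 * (n * (C * (n : ℝ) ^ (-(β - 1)))) := by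
        simp only [hF]
        field_simp
      rw [hFc, e2, e4, mul_assoc 8008, e1, mul_assoc 5, e3]
      have a1 : γ n * (n : ℝ) ^ (-δ) ≤ C * (n : ℝ) ^ (-δ) := by gcongr
      have a2 : γ n * (n : ℝ) ^ (-(β - 1)) ≤ C * (n : ℝ) ^ (-(β - 1)) := by gcongr
      have a3 := mul_le_mul_of_nonneg_left a1 (by positivity : (0 : ℝ) ≤ 4 * n)
      have a4 := mul_le_mul_of_nonneg_left a2 (by positivity : (0 : ℝ) ≤ n)
      linarith
    have hpow : 0 < (n : ℝ) ^ β := by positivity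
    have e5 : (n : ℝ) ^ (1 + β) = n * (n : ℝ) ^ β := by rw [Real.rpow_add hn', Real.rpow_one]
    have e6 : (n : ℝ) ^ (1 + β) / γ n - T =
        -(γ n * (n : ℝ) ^ (-β) * T - n) * ((n : ℝ) ^ β / γ n) := by
      rw [e5, Real.rpow_neg hn'.le]
      field_simp
      ring
    rw [e6, abs_mul, abs_neg, abs_of_pos (div_pos hpow hγ0), e5]
    have hF0 : 0 ≤ F n := by
      have := (abs_nonneg _).trans hbound
      by_contra! hneg
      have : F n * c * n < 0 := mul_neg_of_neg_of_pos (mul_neg_of_neg_of_pos hneg hc) hn'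
      linarith
    calc _ ≤ F n * c * n * ((n : ℝ) ^ β / c) := by
          refine mul_le_mul hbound ?_ (by positivity) (by positivity)
          gcongr
      _ = F n * (n * (n : ℝ) ^ β) := by field_simp
  refine isLittleO_iff.2 fun κ hκ => ?_
  filter_upwards [hle, hFlim.eventually_le_const hκ] with n h1 h2
  rw [Real.norm_eq_abs, Real.norm_of_nonneg (by positivity : (0 : ℝ) ≤ (n : ℝ) ^ (1 + β))]
  exact h1.trans (mul_le_mul_of_nonneg_right h2 (by positivity))

end Asymptotic

end

end InputQueuedSwitch

/-! ### Assembly of the theorem -/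

open InputQueuedSwitch in
theorem mainTheorem5 (β : ℝ) (hβ : 0 < β) (n₀ : ℕ) (hn₀ : 1 ≤ n₀)
    (γ : ℕ → ℝ) (hγ : ∀ n, n₀ ≤ n → 0 < γ n) (hγΘ : γ =Θ[atTop] fun _ => (1 : ℝ))
    (p : ℕ → unitInterval)
    (hp : ∀ n : ℕ, n₀ ≤ n → (p n : ℝ) = (1 - γ n * (n : ℝ) ^ (-β)) / n) :
    -- the universal lower bound, for every policy and every system of the sequence
    (∀ n : ℕ, n₀ ≤ n → ∀ (A : Policy n) (μ₀ π : PMF (QueueState n)),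
      IsStable (p n) A μ₀ → ConvergesInLaw (p n) A μ₀ π →
        ENNReal.ofReal
            ((1 - γ n * (n : ℝ) ^ (-β)) ^ 2 / (2 * γ n) * (n : ℝ) ^ β * ((n : ℝ) - 1)) ≤
          meanTotalQueue π) ∧
    -- it is of order at least `n ^ (1 + β)`, uniformly in the policy
    (∃ c : ℝ, 0 < c ∧ ∀ᶠ n : ℕ in atTop, ∀ (A : Policy n) (μ₀ π : PMF (QueueState n)),
      IsStable (p n) A μ₀ → ConvergesInLaw (p n) A μ₀ π →
        ENNReal.ofReal (c * (n : ℝ) ^ (1 + β)) ≤ meanTotalQueue π) ∧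
    -- MaxWeight
    (∀ W : ∀ n : ℕ, Policy n, (∀ n, n₀ ≤ n → IsMaxWeight (W n)) →
      ∃ π : ∀ n : ℕ, PMF (QueueState n),
        (∀ n, n₀ ≤ n → IsPositiveRecurrent (p n) (W n) ∧
          ∀ μ₀ : PMF (QueueState n), ConvergesInLaw (p n) (W n) μ₀ (π n)) ∧
        (4 < β →
          (∃ B₃ B₄ : ℕ → ℝ,
            B₃ =o[atTop] (fun n : ℕ => (n : ℝ) ^ (1 + β)) ∧
            B₄ =o[atTop] (fun n : ℕ => (n : ℝ) ^ (1 + β)) ∧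
            ∀ n : ℕ, n₀ ≤ n → 2 * γ n ≤ (n : ℝ) ^ (β - 1) →
              meanTotalQueue (π n) ≠ ∞ ∧
              (n : ℝ) ^ (1 + β) / γ n - B₃ n ≤ (meanTotalQueue (π n)).toReal ∧
              (meanTotalQueue (π n)).toReal ≤ (n : ℝ) ^ (1 + β) / γ n + B₄ n) ∧
          -- the mean total queue length is of order `n ^ (1 + β)`
          ((fun n : ℕ => (meanTotalQueue (π n)).toReal) =Θ[atTop]
            fun n : ℕ => (n : ℝ) ^ (1 + β)) ∧
          -- and this is optimal, up to a constant factor, among all policies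
          (∃ C : ℝ, 0 < C ∧ ∀ᶠ n : ℕ in atTop,
            ∀ (A : Policy n) (μ₀ π' : PMF (QueueState n)),
              IsStable (p n) A μ₀ → ConvergesInLaw (p n) A μ₀ π' →
                meanTotalQueue (π n) ≤ ENNReal.ofReal C * meanTotalQueue π'))) := by
  obtain ⟨c, hc, hlow⟩ := eventually_le_meanTotalQueue hβ hγ hγΘ hp
  refine ⟨fun n hn A μ₀ π _ hconv => lower_bound_of_isStationary (by omega) (hγ n hn) (hp n hn)
    hconv.isStationary, ⟨c, hc, ?_⟩, fun W hW => ?_⟩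
  · filter_upwards [hlow] with n h A μ₀ π _ hconv
    exact h A π hconv.isStationary
  have hex : ∀ n, ∃ π : PMF (QueueState n), n₀ ≤ n → ∀ μ₀, ConvergesInLaw (p n) (W n) μ₀ π := by
    intro n
    by_cases hn : n₀ ≤ n
    · have hn0 : 0 < n := by omega
      obtain ⟨π, hπ⟩ := exists_convergesInLaw_maxWeight hn0
        (load_lt_one hn0 (hγ n hn) (hp n hn)) (hW n hn)
      exact ⟨π, fun _ => hπ⟩
    · exact ⟨PMF.pure 0, fun h => absurd h hn⟩
  choose π hπ using hex
  have hstat : ∀ n, n₀ ≤ n → IsStationary (transition (p n) (W n)) (π n) := fun n hn =>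
    (hπ n hn (PMF.pure 0)).isStationary
  have hfin : ∀ n, n₀ ≤ n → meanTotalQueue (π n) ≠ ∞ := fun n hn =>
    meanTotalQueue_ne_top (by omega) (load_lt_one (by omega) (hγ n hn) (hp n hn)) (hW n hn)
      (hstat n hn)
  refine ⟨π, fun n hn => ⟨isPositiveRecurrent_maxWeight (by omega)
    (load_lt_one (by omega) (hγ n hn) (hp n hn)) (hW n hn), hπ n hn⟩, fun hβ4 => ?_⟩
  have hlittle := isLittleO_meanTotalQueue_sub hβ4 hn₀ hγ hγΘ hp hW hstat
  obtain ⟨g, _, hg, -, hbd⟩ := eventually_bounds hγ hγΘ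
  have hup : ∀ᶠ n : ℕ in atTop,
      (meanTotalQueue (π n)).toReal ≤ (g⁻¹ + 1) * (n : ℝ) ^ (1 + β) := by
    filter_upwards [hbd, hlittle.bound one_pos] with n ⟨hgγ, _⟩ h
    rw [Real.norm_of_nonneg (by positivity : (0 : ℝ) ≤ (n : ℝ) ^ (1 + β)), one_mul,
      Real.norm_eq_abs] at h
    have h1 : (n : ℝ) ^ (1 + β) / γ n ≤ g⁻¹ * (n : ℝ) ^ (1 + β) := by
      rw [div_eq_inv_mul]
      gcongr
    have h2 := (abs_le.1 h).1
    linarith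
  have hlowπ : ∀ᶠ n : ℕ in atTop, c * (n : ℝ) ^ (1 + β) ≤ (meanTotalQueue (π n)).toReal := by
    filter_upwards [hlow, eventually_ge_atTop n₀] with n h hn
    exact (ENNReal.ofReal_le_iff_le_toReal (hfin n hn)).1 (h _ _ (hstat n hn))
  -- Both `B₃` and `B₄` are the absolute value of the difference itself. For the optimality
  -- constant, the upper bound `(g⁻¹ + 1) n ^ (1 + β)` for MaxWeight is divided by the universal
  -- lower bound `c n ^ (1 + β)`.
  refine ⟨⟨_, _, hlittle.norm_left, hlittle.norm_left, fun n hn _ => ⟨hfin n hn, ?_, ?_⟩⟩,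
    ⟨?_, ?_⟩, ⟨(g⁻¹ + 1) / c, by positivity, ?_⟩⟩
  · have := le_abs_self ((n : ℝ) ^ (1 + β) / γ n - (meanTotalQueue (π n)).toReal)
    rw [Real.norm_eq_abs]
    linarith
  · have := neg_abs_le ((n : ℝ) ^ (1 + β) / γ n - (meanTotalQueue (π n)).toReal)
    rw [Real.norm_eq_abs]
    linarith
  · refine IsBigO.of_bound (g⁻¹ + 1) ?_
    filter_upwards [hup] with n h
    rwa [Real.norm_of_nonneg ENNReal.toReal_nonneg, Real.norm_of_nonneg (by positivity)]
  · refine IsBigO.of_bound c⁻¹ ?_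
    filter_upwards [hlowπ] with n h
    rw [Real.norm_of_nonneg ENNReal.toReal_nonneg, Real.norm_of_nonneg (by positivity)]
    rw [le_inv_mul_iff₀ hc]
    exact h
  · filter_upwards [hup, hlow, eventually_ge_atTop n₀] with n h1 h2 hn A μ₀ π' _ hconv
    calc meanTotalQueue (π n) = ENNReal.ofReal (meanTotalQueue (π n)).toReal :=
          (ENNReal.ofReal_toReal (hfin n hn)).symm
      _ ≤ ENNReal.ofReal ((g⁻¹ + 1) / c * (c * (n : ℝ) ^ (1 + β))) := by
          refine ENNReal.ofReal_le_ofReal (h1.trans (le_of_eq ?_))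
          field_simp
      _ = ENNReal.ofReal ((g⁻¹ + 1) / c) * ENNReal.ofReal (c * (n : ℝ) ^ (1 + β)) :=
          ENNReal.ofReal_mul (by positivity)
      _ ≤ ENNReal.ofReal ((g⁻¹ + 1) / c) * meanTotalQueue π' := by
          gcongr
          exact h2 A π' hconv.isStationary
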